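/- Let $R$ be a commutative semilocal connected ring in which $2$ is invertible. An Azumaya algebra with involution over $R$ is a pair $(A,\sigma)$, where $A$ is an $R$-algebra that is separable and projective over $R$, and $\sigma$ is an $R$-linear involution on $A$ such that $r\mapsto r\cdot 1_A$ identifies $R$ with $\{z\in Z(A)\mid \sigma(z)=z\}$. Let $(A,\sigma)$ and $(B,\tau)$ be Azumaya algebras with involution over $R$ with the same centre $S=Z(A)=Z(B)$, where $S$ is connected, such that $A$ and $B$ are Brauer equivalent over $S$ and $\sigma|_S=\tau|_S$. For $\varepsilon\in S$ with $\sigma(\varepsilon)\varepsilon=1$ let $\mathrm{Herm}^\varepsilon(A,\sigma)$ be the category whose objects are the $\varepsilon$-hermitian modules $(M,h)$ over $(A,\sigma)$ ($M$ a finitely generated projective right $A$-module, $h$ an $\varepsilon$-hermitian form on $M$, possibly singular) and whose morphisms are the isometries. A $\delta$-hermitian module $(P,\vartheta)$ over $(B,\tau)$ is said to admit $(A,\sigma)$ if $P$ is an $A$-$B$-bimodule on which the left and right actions of $S$ coincide and $\vartheta(\sigma(a)p,q)=\vartheta(p,aq)$ for all $a\in A$, $p,q\in P$; then $\vartheta\bullet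 h$ denotes the form on $M\otimes_A P$ with $$(\vartheta\bullet h)(m\otimes p,m'\otimes p')=\vartheta(p,h(m,m')p').$$ Then there exist $\delta\in\{-1,1\}$ and a nonsingular $\delta$-hermitian form $(P,\vartheta)$ over $(B,\tau)$ which admits $(A,\sigma)$ such that, for every $\varepsilon\in S$ with $\sigma(\varepsilon)\varepsilon=1$, the functor $$\mathscr F_\vartheta:\mathrm{Herm}^\varepsilon(A,\sigma)\to\mathrm{Herm}^{\delta\varepsilon}(B,\tau),\qquad (M,h)\mapsto(M\otimes_A P,\ \vartheta\bullet h),\quad f\mapsto f\otimes\mathrm{id}_P,$$ is an equivalence of categories that preserves orthogonal sums, maps nonsingular forms to nonsingular forms, and maps hyperbolic forms to hyperbolic forms. Moreover: - if $\sigma|_S=\mathrm{id}_S$, then any such $\delta$ is equal to $1$ if $\sigma$ and $\tau$ are both orthogonal or both symplectic, and to $-1$ otherwise; - if $\sigma|_S\neq\mathrm{id}_S$, then $\delta$ can be chosen freely in $\{-1,1\}$: for each of the two values there is a form $(P,\vartheta)$ as above. -/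

import Mathlib

open TensorProduct MulOpposite CategoryTheory

universe u v w

/-! ### Rings, Azumaya algebras with involution, Brauer equivalence, types

An involution on a ring `A` is a `RingInvo A`; the value of `σ` at `a`, read in `A`, is
`(σ a).unop`. A right `A`-module is a module over `Aᵐᵒᵖ`, with `m a` written `op a • m`. -/

/-- A commutative ring is connected if it is nonzero and has no idempotents besides `0`, `1`. -/
def IsConnectedRing (R : Type*) [CommRing R] : Prop :=
  Nontrivial R ∧ ∀ e : R, IsIdempotentElem e → e = 0 ∨ e = 1

/-- A commutative ring is semilocal if it has only finitely many maximal ideals. -/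
def IsSemilocalRing (R : Type*) [CommRing R] : Prop :=
  Finite (MaximalSpectrum R)

/-- `A` is separable over `R`: it is projective as an `A ⊗[R] Aᵐᵒᵖ`-module, where
`(a ⊗ op b) • x = a * x * b`. -/
def IsSeparableAlgebra (R A : Type*) [CommRing R] [Ring A] [Algebra R A] : Prop :=
  letI : Module (A ⊗[R] Aᵐᵒᵖ) A := instModuleTensorProductMop R A
  Module.Projective (A ⊗[R] Aᵐᵒᵖ) A

/-- `(A, σ)` is an Azumaya algebra with involution over `R`: `σ` is `R`-linear, `A` is separable
and projective over `R`, and `R → A` identifies `R` with the `σ`-symmetric central elements. -/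
structure IsAzumayaWithInvolution (R : Type*) {A : Type*} [CommRing R] [Ring A] [Algebra R A]
    (σ : RingInvo A) : Prop where
  map_smul : ∀ (r : R) (a : A), (σ (r • a)).unop = r • (σ a).unop
  separable : IsSeparableAlgebra R A
  projective : Module.Projective R A
  bijOn_center : Set.BijOn (algebraMap R A) Set.univ
    {a | a ∈ Subring.center A ∧ (σ a).unop = a}

/-- The structure map identifies `S` with the centre of `A`. -/
def IsCentreOf (S A : Type*) [CommRing S] [Ring A] [Algebra S A] : Prop :=
  Set.BijOn (algebraMap S A) Set.univ {a | a ∈ Subring.center A}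

/-- Brauer equivalence over `S`: `A ⊗ End P ≅ B ⊗ End Q` as `S`-algebras, for some faithfully
projective (faithful, finitely generated, projective) `S`-modules `P` and `Q`. -/
def AzumayaBrauerEquivalent (S A B : Type u) [CommRing S] [Ring A] [Ring B]
    [Algebra S A] [Algebra S B] : Prop :=
  ∃ (P Q : Type u) (_ : AddCommGroup P) (_ : AddCommGroup Q) (_ : Module S P) (_ : Module S Q),
    Module.Finite S P ∧ Module.Projective S P ∧ FaithfulSMul S P ∧
    Module.Finite S Q ∧ Module.Projective S Q ∧ FaithfulSMul S Q ∧
    Nonempty ((A ⊗[S] Module.End S P) ≃ₐ[S] (B ⊗[S] Module.End S Q))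

section InvolutionType

variable {R A : Type*} [CommRing R] [Ring A] [Algebra R A] {σ : RingInvo A}

/-- The involution as an `R`-linear map `A → A`. -/
def IsAzumayaWithInvolution.linearMap (hσ : IsAzumayaWithInvolution R σ) : A →ₗ[R] A where
  toFun a := (σ a).unop
  map_add' a b := by simp
  map_smul' r a := hσ.map_smul r a

/-- The scalar extension of the involution to the residue field `κ(p)`. -/
noncomputable def IsAzumayaWithInvolution.atPrime (hσ : IsAzumayaWithInvolution R σ)
    (p : PrimeSpectrum R) :
    (p.asIdeal.ResidueField ⊗[R] A) →ₗ[p.asIdeal.ResidueField] (p.asIdeal.ResidueField ⊗[R] A) :=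
  hσ.linearMap.baseChange p.asIdeal.ResidueField

/-- The `κ(p)`-space of symmetric elements of `κ(p) ⊗ A`. -/
noncomputable def IsAzumayaWithInvolution.symAt (hσ : IsAzumayaWithInvolution R σ)
    (p : PrimeSpectrum R) :
    Submodule p.asIdeal.ResidueField (p.asIdeal.ResidueField ⊗[R] A) :=
  LinearMap.eqLocus (hσ.atPrime p) LinearMap.id

/-- `σ` is of the first kind at `p`: it fixes the centre of `κ(p) ⊗ A`. -/
def IsAzumayaWithInvolution.FirstKindAt (hσ : IsAzumayaWithInvolution R σ)
    (p : PrimeSpectrum R) : Prop :=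
  ∀ z ∈ Subring.center (p.asIdeal.ResidueField ⊗[R] A), z ∈ hσ.symAt p

/-- `σ` is of orthogonal type: at every prime `p` it is of the first kind and the symmetric
elements have dimension `n (n + 1) / 2`, where `n` is the degree. -/
def IsAzumayaWithInvolution.IsOrthogonal (hσ : IsAzumayaWithInvolution R σ) : Prop :=
  ∀ p : PrimeSpectrum R, hσ.FirstKindAt p ∧
    ∃ n : ℕ, Module.finrank p.asIdeal.ResidueField (p.asIdeal.ResidueField ⊗[R] A) = n ^ 2 ∧
      2 * Module.finrank p.asIdeal.ResidueField (hσ.symAt p) = n * (n + 1)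

/-- `σ` is of symplectic type: at every prime `p` it is of the first kind and the symmetric
elements have dimension `n (n - 1) / 2`, where `n` is the degree. -/
def IsAzumayaWithInvolution.IsSymplectic (hσ : IsAzumayaWithInvolution R σ) : Prop :=
  ∀ p : PrimeSpectrum R, hσ.FirstKindAt p ∧
    ∃ n : ℕ, Module.finrank p.asIdeal.ResidueField (p.asIdeal.ResidueField ⊗[R] A) = n ^ 2 ∧
      2 * Module.finrank p.asIdeal.ResidueField (hσ.symAt p) = n * (n - 1)

end InvolutionType

/-! ### Hermitian forms -/

section Forms

variable {A : Type u} [Ring A]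

/-- An `ε`-hermitian form on the right `A`-module `M`: a biadditive map `h : M × M → A` with
`h (x a, y b) = σ a * h (x, y) * b` and `h (x, y) = ε * σ (h (y, x))`. The map `toHom` is the
adjoint map `x ↦ h (x, ·)`, so that `h (x, y)` is `h.toHom x y`. -/
structure HermForm (σ : RingInvo A) (ε : A) (M : Type v) [AddCommGroup M] [Module Aᵐᵒᵖ M] where
  toHom : M →+ (M →ₗ[Aᵐᵒᵖ] A)
  smul_left : ∀ (a : A) (x y : M), toHom (op a • x) y = (σ a).unop * toHom x y
  symm : ∀ x y : M, toHom x y = ε * (σ (toHom y x)).unop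

/-- The dual `Hom_A(M, A)` of a right `A`-module, as a right `A`-module through `σ`:
`(f a) (x) = σ a * f x`. -/
def HermDual (_σ : RingInvo A) (M : Type v) [AddCommGroup M] [Module Aᵐᵒᵖ M] : Type (max u v) :=
  M →ₗ[Aᵐᵒᵖ] A

instance (σ : RingInvo A) (M : Type v) [AddCommGroup M] [Module Aᵐᵒᵖ M] :
    AddCommGroup (HermDual σ M) :=
  inferInstanceAs (AddCommGroup (M →ₗ[Aᵐᵒᵖ] A))

instance (σ : RingInvo A) (M : Type v) [AddCommGroup M] [Module Aᵐᵒᵖ M] :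
    FunLike (HermDual σ M) M A :=
  inferInstanceAs (FunLike (M →ₗ[Aᵐᵒᵖ] A) M A)

instance (σ : RingInvo A) (M : Type v) [AddCommGroup M] [Module Aᵐᵒᵖ M] :
    Module Aᵐᵒᵖ (HermDual σ M) :=
  Module.compHom (M →ₗ[Aᵐᵒᵖ] A) (σ.toRingEquiv.symm : Aᵐᵒᵖ →+* A)

theorem HermDual.smul_apply (σ : RingInvo A) {M : Type v} [AddCommGroup M] [Module Aᵐᵒᵖ M]
    (a : A) (f : HermDual σ M) (x : M) : (op a • f) x = (σ a).unop * f x := by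
  have h : σ.toRingEquiv.symm (op a) = (σ a).unop := by
    rw [RingEquiv.symm_apply_eq]
    exact unop_injective (σ.involution a).symm
  rw [← h]
  rfl

/-- An `ε`-hermitian module over `(A, σ)`: a finitely generated projective right `A`-module with
an `ε`-hermitian form. These are the objects of `Herm^ε(A, σ)`. -/
structure Herm (σ : RingInvo A) (ε : A) where
  carrier : Type v
  [addCommGroup : AddCommGroup carrier]
  [module : Module Aᵐᵒᵖ carrier]
  [finite : Module.Finite Aᵐᵒᵖ carrier]
  [projective : Module.Projective Aᵐᵒᵖ carrier]
  form : HermForm σ ε carrier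

attribute [instance] Herm.addCommGroup Herm.module Herm.finite Herm.projective

namespace Herm

variable {σ : RingInvo A} {ε : A}

/-- The isometries of `ε`-hermitian modules. -/
@[ext]
structure Isometry (X Y : Herm.{u, v} σ ε) where
  toEquiv : X.carrier ≃ₗ[Aᵐᵒᵖ] Y.carrier
  map_form : ∀ x y, Y.form.toHom (toEquiv x) (toEquiv y) = X.form.toHom x y

/-- The category `Herm^ε(A, σ)`; its morphisms are the isometries. -/
instance : Category (Herm.{u, v} σ ε) where
  Hom := Isometry
  id X := ⟨LinearEquiv.refl _ _, fun _ _ => rfl⟩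
  comp f g := ⟨f.toEquiv.trans g.toEquiv, fun x y => by simp [g.map_form, f.map_form]⟩

/-- The orthogonal sum. -/
def orthSum (X Y : Herm.{u, v} σ ε) : Herm.{u, v} σ ε where
  carrier := X.carrier × Y.carrier
  form :=
    { toHom :=
        { toFun := fun x => (X.form.toHom x.1).coprod (Y.form.toHom x.2)
          map_zero' := by ext <;> simp
          map_add' := fun x y => by ext <;> simp }
      smul_left := fun a x y => by
        simp [HermForm.smul_left, mul_add]
      symm := fun x y => by
        simp only [AddMonoidHom.coe_mk, ZeroHom.coe_mk, LinearMap.coprod_apply, map_add,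
          MulOpposite.unop_add, mul_add]
        rw [← X.form.symm, ← Y.form.symm] }

/-- A form is nonsingular if its adjoint map `M → Hom_A(M, A)` is bijective. -/
def Nonsingular (X : Herm.{u, v} σ ε) : Prop :=
  Function.Bijective X.form.toHom

/-- A form is hyperbolic if it is isometric to `U ⊕ U^*` with the form
`((x, f), (y, g)) ↦ f y + ε * σ (g x)`, for some finitely generated projective right
`A`-module `U`. -/
def IsHyperbolic (X : Herm.{u, v} σ ε) : Prop :=
  ∃ (U : Type v) (_ : AddCommGroup U) (_ : Module Aᵐᵒᵖ U),
    Module.Finite Aᵐᵒᵖ U ∧ Module.Projective Aᵐᵒᵖ U ∧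
    ∃ e : X.carrier ≃ₗ[Aᵐᵒᵖ] U × HermDual σ U, ∀ x y : X.carrier,
      X.form.toHom x y = (e x).2 (e y).1 + ε * (σ ((e y).2 (e x).1)).unop

end Herm

end Forms

/-! ### The tensor product `M ⊗_A P` of a right `A`-module and an `A`-`B`-bimodule -/

section BimodTensor

variable (A : Type*) (B : Type*) [Ring A] [Ring B]
variable (M : Type v) [AddCommGroup M] [Module Aᵐᵒᵖ M]
variable (P : Type w) [AddCommGroup P] [Module A P] [Module Bᵐᵒᵖ P]

/-- The relations `m a ⊗ p = m ⊗ a p`. The factors are written in the order `P ⊗ M` so that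
`B` acts from the right through the factor `P`. -/
def bimodRel : Submodule Bᵐᵒᵖ (P ⊗[ℤ] M) :=
  Submodule.span Bᵐᵒᵖ
    {t | ∃ (a : A) (m : M) (p : P), t = p ⊗ₜ[ℤ] (op a • m) - (a • p) ⊗ₜ[ℤ] m}

/-- The right `B`-module `M ⊗_A P`. -/
def BimodTensor : Type (max v w) := (P ⊗[ℤ] M) ⧸ bimodRel A B M P

noncomputable instance : AddCommGroup (BimodTensor A B M P) :=
  inferInstanceAs (AddCommGroup ((P ⊗[ℤ] M) ⧸ bimodRel A B M P))

noncomputable instance : Module Bᵐᵒᵖ (BimodTensor A B M P) :=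
  inferInstanceAs (Module Bᵐᵒᵖ ((P ⊗[ℤ] M) ⧸ bimodRel A B M P))

namespace BimodTensor

variable {M P}

/-- The pure tensor `m ⊗ p`. -/
noncomputable def tmul (m : M) (p : P) : BimodTensor A B M P :=
  (bimodRel A B M P).mkQ (p ⊗ₜ[ℤ] m)

theorem tmul_add (m : M) (p q : P) : tmul A B m (p + q) = tmul A B m p + tmul A B m q := by
  simp only [tmul, TensorProduct.add_tmul, map_add]; rfl

theorem add_tmul (m n : M) (p : P) : tmul A B (m + n) p = tmul A B m p + tmul A B n p := by
  simp only [tmul, TensorProduct.tmul_add, map_add]; rfl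

theorem tmul_smul (b : Bᵐᵒᵖ) (m : M) (p : P) : tmul A B m (b • p) = b • tmul A B m p := by
  simp only [tmul, ← TensorProduct.smul_tmul', map_smul]; rfl

theorem smul_tmul (a : A) (m : M) (p : P) : tmul A B (op a • m) p = tmul A B m (a • p) := by
  refine (Submodule.Quotient.eq _).2 (Submodule.subset_span ⟨a, m, p, rfl⟩)

variable {A B}

theorem induction {motive : BimodTensor A B M P → Prop} (t : BimodTensor A B M P)
    (zero : motive 0) (tmul : ∀ m p, motive (tmul A B m p))
    (add : ∀ s t, motive s → motive t → motive (s + t)) : motive t := by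
  obtain ⟨t, rfl⟩ := (bimodRel A B M P).mkQ_surjective t
  induction t using TensorProduct.induction_on with
  | zero => rw [map_zero]; exact zero
  | tmul p m => exact tmul m p
  | add s t hs ht => rw [map_add]; exact add _ _ hs ht

theorem hom_ext {N : Type*} [AddCommGroup N] [Module Bᵐᵒᵖ N]
    {f g : BimodTensor A B M P →ₗ[Bᵐᵒᵖ] N}
    (h : ∀ m p, f (tmul A B m p) = g (tmul A B m p)) : f = g := by
  ext t
  induction t using BimodTensor.induction with
  | zero => simp
  | tmul m p => exact h m p
  | add s t hs ht => simp [hs, ht]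

/-- The universal property of `M ⊗_A P`. -/
noncomputable def lift {N : Type*} [AddCommGroup N] [Module Bᵐᵒᵖ N]
    (f : M →+ (P →ₗ[Bᵐᵒᵖ] N)) (hf : ∀ (a : A) m p, f (op a • m) p = f m (a • p)) :
    BimodTensor A B M P →ₗ[Bᵐᵒᵖ] N :=
  (bimodRel A B M P).liftQ
    (TensorProduct.AlgebraTensorModule.lift
      { toFun := fun p =>
          { toFun := fun m => f m p
            map_add' := fun m n => by simp
            map_smul' := fun c m => by simp }
        map_add' := fun p q => by ext m; simp
        map_smul' := fun b p => by ext m; simp })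
    (by
      rw [bimodRel, Submodule.span_le]
      rintro _ ⟨a, m, p, rfl⟩
      simp [hf])

@[simp]
theorem lift_tmul {N : Type*} [AddCommGroup N] [Module Bᵐᵒᵖ N]
    (f : M →+ (P →ₗ[Bᵐᵒᵖ] N)) (hf : ∀ (a : A) m p, f (op a • m) p = f m (a • p)) (m : M) (p : P) :
    lift f hf (tmul A B m p) = f m p := rfl

/-- The map `m ⊗ p ↦ f m ⊗ p`. -/
noncomputable def map {M' : Type*} [AddCommGroup M'] [Module Aᵐᵒᵖ M'] (f : M →ₗ[Aᵐᵒᵖ] M') :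
    BimodTensor A B M P →ₗ[Bᵐᵒᵖ] BimodTensor A B M' P :=
  lift
    { toFun := fun m =>
        { toFun := fun p => tmul A B (f m) p
          map_add' := fun p q => tmul_add A B _ p q
          map_smul' := fun b p => tmul_smul A B b _ p }
      map_zero' := by
        ext p
        have := add_tmul A B (0 : M') 0 p
        simpa using this
      map_add' := fun m n => by ext p; simp [add_tmul] }
    (fun a m p => by simp [smul_tmul])

@[simp]
theorem map_tmul {M' : Type*} [AddCommGroup M'] [Module Aᵐᵒᵖ M'] (f : M →ₗ[Aᵐᵒᵖ] M')
    (m : M) (p : P) : map (A := A) (B := B) f (tmul A B m p) = tmul A B (f m) p := rfl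

/-- The isomorphism `f ⊗ id_P` for an isomorphism `f`. -/
noncomputable def mapEquiv {M' : Type*} [AddCommGroup M'] [Module Aᵐᵒᵖ M']
    (f : M ≃ₗ[Aᵐᵒᵖ] M') : BimodTensor A B M P ≃ₗ[Bᵐᵒᵖ] BimodTensor A B M' P :=
  LinearEquiv.ofLinearMap (map f.toLinearMap) (map f.symm.toLinearMap)
    (hom_ext fun m p => by simp) (hom_ext fun m p => by simp)

@[simp]
theorem mapEquiv_tmul {M' : Type*} [AddCommGroup M'] [Module Aᵐᵒᵖ M']
    (f : M ≃ₗ[Aᵐᵒᵖ] M') (m : M) (p : P) :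
    mapEquiv (A := A) (B := B) f (tmul A B m p) = tmul A B (f m) p := rfl

variable (A B M P)
variable [SMulCommClass A Bᵐᵒᵖ P]

/-- If `M` is finitely generated projective, then `M ⊗_A P` is a direct summand of some `P ^ n`. -/
theorem exists_retract [Module.Finite Aᵐᵒᵖ M] [Module.Projective Aᵐᵒᵖ M] :
    ∃ (n : ℕ) (i : BimodTensor A B M P →ₗ[Bᵐᵒᵖ] (Fin n → P))
      (r : (Fin n → P) →ₗ[Bᵐᵒᵖ] BimodTensor A B M P), r ∘ₗ i = LinearMap.id := by
  obtain ⟨n, f, g, -, -, hfg⟩ := Module.Finite.exists_comp_eq_id_of_projective Aᵐᵒᵖ M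
  let i : BimodTensor A B M P →ₗ[Bᵐᵒᵖ] (Fin n → P) := lift
    { toFun := fun m =>
        { toFun := fun p k => (g m k).unop • p
          map_add' := fun p q => by ext k; simp
          map_smul' := fun b p => by ext k; simp [smul_comm] }
      map_zero' := by ext; simp
      map_add' := fun m m' => by ext; simp [add_smul] }
    (fun a m p => by ext k; simp [mul_smul])
  let r : (Fin n → P) →ₗ[Bᵐᵒᵖ] BimodTensor A B M P :=
    { toFun := fun p => ∑ k, tmul A B (f (Pi.single k 1)) (p k)
      map_add' := fun p q => by simp [tmul_add, Finset.sum_add_distrib]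
      map_smul' := fun b p => by simp [tmul_smul, Finset.smul_sum] }
  refine ⟨n, i, r, hom_ext fun m p => ?_⟩
  have h1 : f (g m) = m := LinearMap.congr_fun hfg m
  let t : M →+ BimodTensor A B M P := AddMonoidHom.mk' (fun m => tmul A B m p)
    fun m m' => add_tmul A B m m' p
  have h2 : ∀ k, tmul A B (f (Pi.single k 1)) ((g m k).unop • p) =
      t (g m k • f (Pi.single k 1)) := fun k => (smul_tmul A B _ _ _).symm
  change ∑ k, tmul A B (f (Pi.single k 1)) ((g m k).unop • p) = t m
  rw [Finset.sum_congr rfl fun k _ => h2 k, ← map_sum]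
  congr 1
  conv_rhs => rw [← h1, ← Finset.univ_sum_single (g m)]
  rw [map_sum]
  refine Finset.sum_congr rfl fun k _ => ?_
  rw [← map_smul]
  congr 1
  ext j
  by_cases hj : j = k
  · subst hj; simp
  · simp [hj]

instance [Module.Finite Aᵐᵒᵖ M] [Module.Projective Aᵐᵒᵖ M] [Module.Finite Bᵐᵒᵖ P] :
    Module.Finite Bᵐᵒᵖ (BimodTensor A B M P) := by
  obtain ⟨n, i, r, h⟩ := exists_retract A B M P
  exact Module.Finite.of_surjective r fun x => ⟨i x, LinearMap.congr_fun h x⟩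

instance [Module.Finite Aᵐᵒᵖ M] [Module.Projective Aᵐᵒᵖ M] [Module.Projective Bᵐᵒᵖ P] :
    Module.Projective Bᵐᵒᵖ (BimodTensor A B M P) := by
  obtain ⟨n, i, r, h⟩ := exists_retract A B M P
  have : Module.Projective Bᵐᵒᵖ (Fin n → P) :=
    Module.Projective.of_equiv (DFinsupp.linearEquivFunOnFintype (R := Bᵐᵒᵖ) (M := fun _ => P))
  exact Module.Projective.of_split i r h

end BimodTensor

end BimodTensor

/-! ### Hermitian forms admitting `(A, σ)` and the functor they induce -/

/-- A `δ`-hermitian form `(P, ϑ)` over `(B, τ)` which admits `(A, σ)`: the finitely generated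
projective right `B`-module `P` is an `A`-`B`-bimodule on which the left and right actions of
`S` coincide, and `ϑ (σ a p, q) = ϑ (p, a q)`. -/
structure AdmittingForm (S : Type*) {A : Type u} {B : Type v} [CommRing S] [Ring A] [Ring B]
    [Algebra S A] [Algebra S B] (σ : RingInvo A) (τ : RingInvo B) (δ : B) extends
    Herm.{v, w} τ δ where
  [leftModule : Module A carrier]
  [smulCommClass : SMulCommClass A Bᵐᵒᵖ carrier]
  central : ∀ (s : S) (p : carrier), algebraMap S A s • p = op (algebraMap S B s) • p
  admits : ∀ (a : A) (p q : carrier),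
    form.toHom ((σ a).unop • p) q = form.toHom p (a • q)

attribute [instance] AdmittingForm.leftModule AdmittingForm.smulCommClass

namespace AdmittingForm

variable {S : Type*} {A : Type u} {B : Type u} [CommRing S] [Ring A] [Ring B]
variable [Algebra S A] [Algebra S B] {σ : RingInvo A} {τ : RingInvo B} {δ : S}

section Product

variable (Θ : AdmittingForm.{u, u, v} S σ τ (algebraMap S B δ)) {ε : S}
variable {M : Type v} [AddCommGroup M] [Module Aᵐᵒᵖ M] (h : HermForm σ (algebraMap S A ε) M)

/-- For fixed `m`, `p`, the map `m' ⊗ q ↦ ϑ (p, h (m, m') q)`. -/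
noncomputable def prodAux (m : M) (p : Θ.carrier) : BimodTensor A B M Θ.carrier →ₗ[Bᵐᵒᵖ] B :=
  BimodTensor.lift
    { toFun := fun m' => (Θ.form.toHom p).comp
        (DistribSMul.toLinearMap Bᵐᵒᵖ Θ.carrier (h.toHom m m'))
      map_zero' := by
        ext q
        change Θ.form.toHom p (h.toHom m 0 • q) = 0
        simp
      map_add' := fun m' m'' => by
        ext q
        change Θ.form.toHom p (h.toHom m (m' + m'') • q) =
          Θ.form.toHom p (h.toHom m m' • q) + Θ.form.toHom p (h.toHom m m'' • q)
        simp [add_smul] }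
    (fun a m' q => by
      change Θ.form.toHom p (h.toHom m (op a • m') • q) =
        Θ.form.toHom p (h.toHom m m' • (a • q))
      simp [mul_smul])

@[simp]
theorem prodAux_tmul (m m' : M) (p q : Θ.carrier) :
    Θ.prodAux h m p (BimodTensor.tmul A B m' q) = Θ.form.toHom p (h.toHom m m' • q) := rfl

theorem prodAux_add_right (m : M) (p q : Θ.carrier) :
    Θ.prodAux h m (p + q) = Θ.prodAux h m p + Θ.prodAux h m q :=
  BimodTensor.hom_ext fun m' r => by simp

theorem prodAux_add_left (m n : M) (p : Θ.carrier) :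
    Θ.prodAux h (m + n) p = Θ.prodAux h m p + Θ.prodAux h n p :=
  BimodTensor.hom_ext fun m' r => by simp [add_smul]

theorem prodAux_smul (b : B) (m : M) (p : Θ.carrier) (t : BimodTensor A B M Θ.carrier) :
    Θ.prodAux h m (op b • p) t = (τ b).unop * Θ.prodAux h m p t := by
  induction t using BimodTensor.induction with
  | zero => simp
  | tmul m' q => exact Θ.form.smul_left b p _
  | add s t hs ht => simp only [map_add, mul_add, hs, ht]

theorem prodAux_balanced (a : A) (m : M) (p : Θ.carrier) :
    Θ.prodAux h (op a • m) p = Θ.prodAux h m (a • p) :=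
  BimodTensor.hom_ext fun m' q => by
    have := Θ.admits (σ a).unop p (h.toHom m m' • q)
    rw [σ.involution] at this
    simp only [prodAux_tmul, h.smul_left, mul_smul, this]

/-- The adjoint map of the product form. -/
noncomputable def prodAdjoint : BimodTensor A B M Θ.carrier →ₗ[Bᵐᵒᵖ]
    HermDual τ (BimodTensor A B M Θ.carrier) :=
  BimodTensor.lift
    (AddMonoidHom.mk' (fun m =>
        ({ toFun := fun p => Θ.prodAux h m p
           map_add' := fun p q => Θ.prodAux_add_right h m p q
           map_smul' := fun b p => LinearMap.ext fun t =>
             (Θ.prodAux_smul h b.unop m p t).trans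
               (HermDual.smul_apply τ b.unop (Θ.prodAux h m p) t).symm } :
          Θ.carrier →ₗ[Bᵐᵒᵖ] HermDual τ (BimodTensor A B M Θ.carrier)))
      (fun m n => LinearMap.ext fun p => Θ.prodAux_add_left h m n p))
    (fun a m p => Θ.prodAux_balanced h a m p)

/-- The product form `ϑ • h` on `M ⊗_A P`:
`(ϑ • h) (m ⊗ p, m' ⊗ p') = ϑ (p, h (m, m') p')`. -/
noncomputable def prod : HermForm τ (algebraMap S B (δ * ε)) (BimodTensor A B M Θ.carrier) where
  toHom := AddMonoidHom.mk' (fun x => (Θ.prodAdjoint h x : BimodTensor A B M Θ.carrier →ₗ[Bᵐᵒᵖ] B))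
    (fun x y => map_add (Θ.prodAdjoint h) x y)
  smul_left b x y :=
    (congrArg (fun f : HermDual τ (BimodTensor A B M Θ.carrier) => f y)
      (map_smul (Θ.prodAdjoint h) (op b) x)).trans
      (HermDual.smul_apply τ b (Θ.prodAdjoint h x) y)
  symm x y := by
    have key : ∀ x y : BimodTensor A B M Θ.carrier, Θ.prodAdjoint h x y =
        algebraMap S B (δ * ε) * (τ (Θ.prodAdjoint h y x)).unop := by
      intro x y
      have add_right : ∀ x y z, Θ.prodAdjoint h x (y + z) =
          Θ.prodAdjoint h x y + Θ.prodAdjoint h x z := fun x y z =>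
        LinearMap.map_add (Θ.prodAdjoint h x : BimodTensor A B M Θ.carrier →ₗ[Bᵐᵒᵖ] B) y z
      have zero_right : ∀ x, Θ.prodAdjoint h x 0 = 0 := fun x =>
        LinearMap.map_zero (Θ.prodAdjoint h x : BimodTensor A B M Θ.carrier →ₗ[Bᵐᵒᵖ] B)
      have add_left : ∀ x y z, Θ.prodAdjoint h (x + y) z =
          Θ.prodAdjoint h x z + Θ.prodAdjoint h y z := fun x y z => by
        rw [map_add]; rfl
      have zero_left : ∀ x, Θ.prodAdjoint h 0 x = 0 := fun x => by
        rw [map_zero]; rfl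
      induction x using BimodTensor.induction with
      | zero => rw [zero_left, zero_right]; simp
      | add s t hs ht => rw [add_left, add_right, hs, ht, map_add, MulOpposite.unop_add, mul_add]
      | tmul m p =>
        induction y using BimodTensor.induction with
        | zero => rw [zero_left, zero_right]; simp
        | add s t hs ht =>
          rw [add_left, add_right, hs, ht, map_add, MulOpposite.unop_add, mul_add]
        | tmul m' q =>
          change Θ.form.toHom p (h.toHom m m' • q) =
            algebraMap S B (δ * ε) * (τ (Θ.form.toHom q (h.toHom m' m • p))).unop
          rw [h.symm m m', mul_smul, Θ.central, map_smul, op_smul_eq_mul,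
            Θ.form.symm p, Θ.admits, map_mul, mul_assoc, mul_assoc,
            ← Algebra.commutes ε]
    exact key x y

theorem prod_tmul (m m' : M) (p p' : Θ.carrier) :
    (Θ.prod h).toHom (BimodTensor.tmul A B m p) (BimodTensor.tmul A B m' p') =
      Θ.form.toHom p (h.toHom m m' • p') := rfl

end Product

/-- The functor `(M, h) ↦ (M ⊗_A P, ϑ • h)`, `f ↦ f ⊗ id_P`. -/
noncomputable def functor (Θ : AdmittingForm.{u, u, v} S σ τ (algebraMap S B δ)) (ε : S) :
    Herm.{u, v} σ (algebraMap S A ε) ⥤ Herm.{u, v} τ (algebraMap S B (δ * ε)) where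
  obj X := { carrier := BimodTensor A B X.carrier Θ.carrier, form := Θ.prod X.form }
  map {X Y} f :=
    { toEquiv := BimodTensor.mapEquiv f.toEquiv
      map_form := fun x y => by
        induction x using BimodTensor.induction with
        | zero => simp
        | add s t hs ht => simp only [map_add, LinearMap.add_apply, hs, ht]
        | tmul m p =>
          induction y using BimodTensor.induction with
          | zero => simp
          | add s t hs ht => simp only [map_add, hs, ht]
          | tmul m' q =>
            simp only [BimodTensor.mapEquiv_tmul, prod_tmul, f.map_form] }
  map_id X := Herm.Isometry.ext <| LinearEquiv.toLinearMap_injective <|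
    BimodTensor.hom_ext fun _ _ => rfl
  map_comp f g := Herm.Isometry.ext <| LinearEquiv.toLinearMap_injective <|
    BimodTensor.hom_ext fun _ _ => rfl

/-- The functor induced by `(P, ϑ)` is an equivalence of categories, preserves orthogonal sums
(the canonical map `(m, n) ⊗ p ↦ (m ⊗ p, n ⊗ p)` is an isometry), and maps nonsingular forms to
nonsingular forms and hyperbolic forms to hyperbolic forms. -/
structure IsHermitianMorita (Θ : AdmittingForm.{u, u, v} S σ τ (algebraMap S B δ)) (ε : S) :
    Prop where
  isEquivalence : (Θ.functor ε).IsEquivalence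
  orthSum : ∀ X Y : Herm.{u, v} σ (algebraMap S A ε),
    ∃ i : Herm.Isometry ((Θ.functor ε).obj (X.orthSum Y))
        (((Θ.functor ε).obj X).orthSum ((Θ.functor ε).obj Y)),
      ∀ (x : X.carrier) (y : Y.carrier) (p : Θ.carrier),
        i.toEquiv (BimodTensor.tmul A B ((x, y) : X.carrier × Y.carrier) p) =
          ((BimodTensor.tmul A B x p, BimodTensor.tmul A B y p) :
            BimodTensor A B X.carrier Θ.carrier × BimodTensor A B Y.carrier Θ.carrier)
  nonsingular : ∀ X : Herm.{u, v} σ (algebraMap S A ε),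
    X.Nonsingular → ((Θ.functor ε).obj X).Nonsingular
  hyperbolic : ∀ X : Herm.{u, v} σ (algebraMap S A ε),
    X.IsHyperbolic → ((Θ.functor ε).obj X).IsHyperbolic

end AdmittingForm

/-! The bimodule is a Morita bimodule, and the form on it comes from comparing two involutions on
one matrix algebra. The ring `S` is semilocal because at most two of its maximal ideals lie over a
given one of `R` (`eq_or_eq_comap`). As `S` is also connected, finitely generated projective
`S`-modules are free, and Brauer equivalence becomes an isomorphism `Φ : M_n(A) ≅ M_m(B)` of
`S`-algebras. The conjugate transposes of `σ` (carried over by `Φ`) and of `τ` differ by an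
`S`-automorphism of `M_m(B)`, which is inner by the Skolem–Noether theorem over a semilocal ring
(`IsSeparabilityFamily.exists_conj`). The conjugating matrix `g` satisfies `g = u • τ.conjT g` with
`u * ι u = 1`. A unit `w` with `w * u = δ * ι w` makes `w • g` a `δ`-hermitian matrix, and its
inverse `J` defines `ϑ` on `P = Φ(e) B^m`, where `e` is a diagonal matrix unit.

If `ι` is trivial, then `u = ±1` by connectedness, and `δ = u`, `w = 1` do. If not, `ι` acts
nontrivially on every residue field of `S` (`exists_sub_notMem`, which rests on separability), and a
form of Hilbert 90 gives `w` for either sign (`exists_isUnit_add`).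

That the functor has all the required properties is formal. Since `A = End_B(P)` and `ϑ` is
nonsingular, there is a form `η` with values in `A` such that `η(p, q) r = p ϑ(q, r)`, and `1` is a
sum of values of `η` and a sum of values of `ϑ` (`MoritaData`). Contracting with `η` undoes `- ⊗ P`.
The inverse functor is given by `P` with its two sides exchanged through the involutions, carrying
the form `δ η`.

For the value of `δ` when `ι` is trivial, an arbitrary `ϑ` that induces an equivalence has to be
treated. Applying the functor to zero forms shows that it too has Morita data. These consist of
bilinear identities over `R`, so they pass to an algebraically closed field `K`. There the algebras
split, and each involution has a sign: the scalar by which it acts on `s(E) D E` for a primitive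
idempotent `E`. An element `θ(y₀, x y₀)`, conjugated in two ways, shows that the two signs differ by
`δ` (`sign_eq`). The sign fixes the dimension of the space of symmetric elements, hence the type.
These dimensions do not depend on the residue field, because `A` has an `R`-basis of symmetric and
skew elements. -/

/-! ### Separability idempotents -/

/-- The families `x`, `y` present a separability idempotent `∑ xᵢ ⊗ yᵢ` of the `R`-algebra `A`. -/
structure IsSeparabilityFamily (R : Type*) {A ι : Type*} [CommRing R] [Ring A] [Algebra R A]
    [Fintype ι] (x y : ι → A) : Prop where
  sum_mul : ∑ i, x i * y i = 1
  comm : ∀ b : A, ∑ i, (b * x i) ⊗ₜ[R] y i = ∑ i, x i ⊗ₜ[R] (y i * b)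

/-- Projectivity splits the multiplication map `A ⊗ Aᵐᵒᵖ → A`; the idempotent is the image of `1`
under the splitting. -/
theorem IsSeparableAlgebra.exists_family {R A : Type*} [CommRing R] [Ring A] [Algebra R A]
    (h : IsSeparableAlgebra R A) :
    ∃ (n : ℕ) (x y : Fin n → A), IsSeparabilityFamily R x y := by
  let _ : Module (A ⊗[R] Aᵐᵒᵖ) A := instModuleTensorProductMop R A
  have hsmul : ∀ (a : A) (b : Aᵐᵒᵖ) (z : A), (a ⊗ₜ[R] b) • z = a * z * b.unop := by
    intro a b z
    change TensorProduct.Algebra.moduleAux _ _ = _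
    simp [TensorProduct.Algebra.moduleAux, ← mul_assoc]
  have h' : Module.Projective (A ⊗[R] Aᵐᵒᵖ) A := h
  let μ : (A ⊗[R] Aᵐᵒᵖ) →ₗ[A ⊗[R] Aᵐᵒᵖ] A := LinearMap.toSpanSingleton _ _ 1
  have hμ : Function.Surjective μ := fun a => ⟨a ⊗ₜ 1, by
    simp [μ, LinearMap.toSpanSingleton_apply, hsmul]⟩
  obtain ⟨s, hs⟩ := Module.projective_lifting_property μ LinearMap.id hμ
  obtain ⟨n, x, y, hxy⟩ := TensorProduct.exists_sum_tmul_eq (s 1)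
  refine ⟨n, x, fun i => (y i).unop, ?_, fun b => ?_⟩
  · have h1 : μ (s 1) = 1 := LinearMap.congr_fun hs 1
    rw [hxy] at h1
    simpa [μ, LinearMap.toSpanSingleton_apply, Finset.sum_smul, hsmul] using h1
  -- Both `b ⊗ 1` and `1 ⊗ op b` send `1` to `b` in `A`, so they agree on `s 1` by linearity of the
  -- splitting.
  · have h1 : (b ⊗ₜ[R] (1 : Aᵐᵒᵖ)) * s 1 = ((1 : A) ⊗ₜ[R] op b) * s 1 := by
      rw [← smul_eq_mul, ← map_smul, ← smul_eq_mul, ← map_smul, hsmul, hsmul]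
      simp
    rw [hxy] at h1
    simp only [Finset.mul_sum, Algebra.TensorProduct.tmul_mul_tmul, one_mul] at h1
    have h2 := congrArg (TensorProduct.map LinearMap.id (opLinearEquiv R).symm.toLinearMap) h1
    simpa using h2

/-- Testing the tensor identity against a bilinear map. All averaging arguments below are instances,
for various `f`. -/
theorem IsSeparabilityFamily.sum_comm {R A ι : Type*} [CommRing R] [Ring A] [Algebra R A]
    [Fintype ι] {x y : ι → A} (h : IsSeparabilityFamily R x y) {N : Type*} [AddCommGroup N]
    [Module R N] (f : A →ₗ[R] A →ₗ[R] N) (b : A) :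
    ∑ i, f (b * x i) (y i) = ∑ i, f (x i) (y i * b) := by
  simpa using congrArg (TensorProduct.lift f) (h.comm b)

namespace IsSeparabilityFamily

variable {R A ι : Type*} [CommRing R] [Ring A] [Algebra R A] [Fintype ι] {x y : ι → A}

/-- The average `∑ xᵢ f(yᵢ)` of a linear map. -/
theorem sum_mul_map (h : IsSeparabilityFamily R x y) (f : A →ₗ[R] A) (b : A) :
    ∑ i, b * x i * f (y i) = ∑ i, x i * f (y i * b) :=
  h.sum_comm ((LinearMap.mul R A).compl₂ f) b

theorem sum_map_mul (h : IsSeparabilityFamily R x y) (f : A →ₗ[R] A) (b : A) :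
    ∑ i, f (b * x i) * y i = ∑ i, f (x i) * (y i * b) :=
  h.sum_comm ((LinearMap.mul R A).comp f) b

theorem mul_sandwich (h : IsSeparabilityFamily R x y) (z b : A) :
    b * ∑ i, x i * z * y i = (∑ i, x i * z * y i) * b := by
  have := h.sum_map_mul (LinearMap.mulRight R z) b
  simpa [Finset.mul_sum, Finset.sum_mul, mul_assoc] using this

theorem sandwich_mem_center (h : IsSeparabilityFamily R x y) (z : A) :
    ∑ i, x i * z * y i ∈ Subring.center A :=
  Subring.mem_center_iff.2 fun b => h.mul_sandwich z b

theorem sandwich_of_mem_center (h : IsSeparabilityFamily R x y) {z : A}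
    (hz : z ∈ Subring.center A) : ∑ i, x i * z * y i = z := by
  simp_rw [fun i => Subring.mem_center_iff.1 hz (x i), mul_assoc, ← Finset.mul_sum, h.sum_mul,
    mul_one]

/-- A separable projective algebra is finitely generated as a module. -/
theorem finite (h : IsSeparabilityFamily R x y) [Module.Projective R A] : Module.Finite R A := by
  classical
  obtain ⟨s, hs⟩ := (Module.projective_def (R := R) (P := A)).1 ‹_›
  -- `F a b` is the family of coordinates of `b` in a possibly infinite dual basis, multiplied by
  -- `a`. The sum `T a` of the `F (x i) (y i * a)` also equals the sum of the `F (a * x i) (y i)`,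
  -- whose support lies in the finite set `K` whatever `a` is. Recombining coordinates writes `a` in
  -- terms of the products `x i * k` with `k ∈ K`.
  let F : A →ₗ[R] A →ₗ[R] (A →₀ A) :=
    LinearMap.mk₂ R (fun a b => (s b).mapRange (fun r => r • a) (by simp))
      (fun a a' b => by ext; simp) (fun c a b => by ext; simp [smul_comm c])
      (fun a b b' => by ext; simp [add_smul]) (fun c a b => by ext; simp [mul_smul])
  let T : A →ₗ[R] (A →₀ A) := ∑ i, F (x i)  ∘ₗ LinearMap.mulLeft R (y i)
  have hT : ∀ a, T a = ∑ i, F (a * x i) (y i) := fun a => by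
    rw [h.sum_comm F a]; simp [T]
  let K : Finset A := Finset.univ.biUnion fun i => (s (y i)).support
  have hK : ∀ a, (T a).support ⊆ K := by
    intro a k hk
    by_contra hkK
    simp only [K, Finset.mem_biUnion, Finset.mem_univ, true_and, not_exists,
      Finsupp.mem_support_iff, not_not] at hkK
    rw [Finsupp.mem_support_iff, hT] at hk
    apply hk
    rw [Finsupp.finsetSum_apply]
    exact Finset.sum_eq_zero fun i _ => by simp [F, hkK i]
  have key : ∀ a, a = ∑ k ∈ K, T a k * k := by
    intro a
    have h1 : ∀ b c : A, (F b c).sum (fun k z => z * k) = b * c := by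
      intro b c
      have h2 : F b c = (s c).mapRange (fun r => r • b) (by simp) := rfl
      rw [h2, Finsupp.sum_mapRange_index (by simp)]
      conv_rhs => rw [← hs c]
      rw [Finsupp.linearCombination_apply, Finsupp.mul_sum]
      simp
    have h3 : (T a).sum (fun k z => z * k) = ∑ k ∈ K, T a k * k :=
      Finsupp.sum_of_support_subset _ (hK a) _ (by simp)
    rw [← h3]
    let Φ : (A →₀ A) →+ A := Finsupp.liftAddHom fun k => AddMonoidHom.mulRight k
    have h4 : ∀ w, w.sum (fun k z => z * k) = Φ w := fun w => rfl
    rw [h4, show T a = ∑ i, F (x i) (y i * a) by simp [T], map_sum]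
    simp_rw [← h4, h1, ← mul_assoc, ← Finset.sum_mul, h.sum_mul, one_mul]
  refine ⟨(Finset.univ ×ˢ K).image (fun p => x p.1 * p.2), ?_⟩
  rw [eq_top_iff]
  intro a _
  rw [key a]
  refine Submodule.sum_mem _ fun k hk => ?_
  have : T a k = ∑ i, s (y i * a) k • x i := by
    simp [T, F, Finsupp.finsetSum_apply]
  rw [this, Finset.sum_mul]
  refine Submodule.sum_mem _ fun i _ => ?_
  rw [smul_mul_assoc]
  refine Submodule.smul_mem _ _ (Submodule.subset_span ?_)
  simp only [Finset.coe_image, Set.mem_image, Finset.mem_coe, Finset.mem_product]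
  exact ⟨(i, k), ⟨Finset.mem_univ _, hk⟩, rfl⟩

/-- The canonical map `A ⊗[R] A → A ⊗[S] A` carries the idempotent along. -/
theorem extendScalars (h : IsSeparabilityFamily R x y) (S : Type*) [CommRing S] [Algebra R S]
    [Algebra S A] [IsScalarTower R S A] : IsSeparabilityFamily S x y where
  sum_mul := h.sum_mul
  comm b := by
    have := h.sum_comm (N := A ⊗[S] A)
      (LinearMap.mk₂ R (fun a b => a ⊗ₜ[S] b) (fun _ _ _ => TensorProduct.add_tmul _ _ _)
        (fun c a b => by
          rw [← algebraMap_smul S c a, ← algebraMap_smul S c (a ⊗ₜ[S] b), TensorProduct.smul_tmul'])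
        (fun _ _ _ => TensorProduct.tmul_add _ _ _)
        (fun c a b => by
          rw [← algebraMap_smul S c b, ← algebraMap_smul S c (a ⊗ₜ[S] b), TensorProduct.tmul_smul])) b
    simpa using this

theorem baseChange (h : IsSeparabilityFamily R x y) (K : Type*) [CommRing K] [Algebra R K] :
    IsSeparabilityFamily K (fun i => (1 : K) ⊗ₜ[R] x i) (fun i => (1 : K) ⊗ₜ[R] y i) where
  sum_mul := by
    simp only [Algebra.TensorProduct.tmul_mul_tmul, mul_one, ← TensorProduct.tmul_sum, h.sum_mul]
    rfl
  comm b := by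
    induction b using TensorProduct.induction_on with
    | zero => simp
    | add b c hb hc => simp only [add_mul, mul_add, TensorProduct.add_tmul, TensorProduct.tmul_add,
        Finset.sum_add_distrib, hb, hc]
    | tmul c a =>
      have hone : ∀ (c : R) (a : A), (1 : K) ⊗ₜ[R] (c • a) =
          algebraMap R K c • ((1 : K) ⊗ₜ[R] a) := fun c a => by
        rw [algebraMap_smul, TensorProduct.tmul_smul]
      have := h.sum_comm (N := (K ⊗[R] A) ⊗[K] (K ⊗[R] A))
        (LinearMap.mk₂ R (fun a b => ((1 : K) ⊗ₜ[R] a) ⊗ₜ[K] ((1 : K) ⊗ₜ[R] b))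
          (fun _ _ _ => by simp [TensorProduct.tmul_add, TensorProduct.add_tmul])
          (fun c a b => by
            rw [hone, ← TensorProduct.smul_tmul', algebraMap_smul])
          (fun _ _ _ => by simp [TensorProduct.tmul_add])
          (fun c a b => by
            rw [hone, TensorProduct.tmul_smul, algebraMap_smul])) a
      simp only [LinearMap.mk₂_apply] at this
      have h2 := congrArg (fun t => c • t) this
      simp only [Finset.smul_sum] at h2
      simp only [Algebra.TensorProduct.tmul_mul_tmul, mul_one, one_mul]
      have e1 : ∀ z : A, c ⊗ₜ[R] z = c • ((1 : K) ⊗ₜ[R] z) := fun z => by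
        rw [TensorProduct.smul_tmul', smul_eq_mul, mul_one]
      simp_rw [e1, TensorProduct.tmul_smul, ← TensorProduct.smul_tmul']
      exact h2

/-- The central elements of `K ⊗ A` come from `K ⊗ Z(A)`. -/
theorem center_baseChange (h : IsSeparabilityFamily R x y)
    (hc : ∀ z ∈ Subring.center A, ∃ r : R, algebraMap R A r = z) (K : Type*) [CommRing K]
    [Algebra R K] (z : K ⊗[R] A) (hz : z ∈ Subring.center (K ⊗[R] A)) :
    ∃ c : K, algebraMap K (K ⊗[R] A) c = z := by
  -- A central element equals its own average. The claim about averages is additive, and the average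
  -- of `c ⊗ a` is `c ⊗` the average of `a`, which is central in `A`.
  rw [← (h.baseChange K).sandwich_of_mem_center hz]
  clear hz
  induction z using TensorProduct.induction_on with
  | zero => exact ⟨0, by simp⟩
  | add s t hs ht =>
    obtain ⟨c, hc⟩ := hs
    obtain ⟨d, hd⟩ := ht
    exact ⟨c + d, by simp only [map_add, hc, hd, mul_add, add_mul, Finset.sum_add_distrib]⟩
  | tmul c a =>
    obtain ⟨r, hr⟩ := hc _ (h.sandwich_mem_center a)
    refine ⟨c * algebraMap R K r, ?_⟩
    simp only [Algebra.TensorProduct.tmul_mul_tmul, mul_one, one_mul, ← TensorProduct.tmul_sum,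
      ← hr]
    rw [Algebra.TensorProduct.algebraMap_apply, Algebra.algebraMap_eq_smul_one r (A := A),
      TensorProduct.tmul_smul, TensorProduct.smul_tmul', mul_comm, Algebra.smul_def]
    rfl

/-- Over a field, every two-sided ideal of a separable algebra is generated by a central element
which acts as the identity on it. -/
theorem exists_central_unit {k D ι : Type*} [Field k] [Ring D] [Algebra k D] [Fintype ι]
    {x y : ι → D} (h : IsSeparabilityFamily k x y) (I : Submodule k D)
    (hl : ∀ a, ∀ z ∈ I, a * z ∈ I) (hr : ∀ a, ∀ z ∈ I, z * a ∈ I) :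
    ∃ c ∈ I, c ∈ Subring.center D ∧ ∀ z ∈ I, c * z = z := by
  -- As in Maschke's theorem, a `k`-linear projection `p` onto `I` is averaged on both sides into
  -- the bimodule map `z ↦ ∑ xᵢ p(yᵢ z xⱼ) yⱼ`, which is still the identity on `I`. The required
  -- element is its value at `1`.
  obtain ⟨q, hq⟩ := LinearMap.exists_leftInverse_of_injective I.subtype (by simp)
  let p : D →ₗ[k] D := I.subtype ∘ₗ q
  have hpI : ∀ z, p z ∈ I := fun z => (q z).2
  have hp : ∀ z ∈ I, p z = z := fun z hz =>
    congrArg Subtype.val (LinearMap.congr_fun hq (⟨z, hz⟩ : I))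
  have hleft : ∀ b, b * ∑ j, ∑ i, x i * p (y i * x j) * y j =
      ∑ j, ∑ i, x i * p (y i * (b * x j)) * y j := by
    intro b
    rw [Finset.mul_sum]
    refine Finset.sum_congr rfl fun j _ => ?_
    have := h.sum_mul_map (p ∘ₗ LinearMap.mulRight k (x j)) b
    simp only [LinearMap.comp_apply, LinearMap.mulRight_apply] at this
    simp only [← Finset.sum_mul, ← mul_assoc] at this ⊢
    rw [← this, Finset.mul_sum]
    simp only [mul_assoc]
  refine ⟨∑ j, ∑ i, x i * p (y i * x j) * y j, ?_, ?_, ?_⟩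
  · exact Submodule.sum_mem _ fun j _ => Submodule.sum_mem _ fun i _ => hr _ _ (hl _ _ (hpI _))
  · rw [Subring.mem_center_iff]
    intro b
    rw [hleft]
    rw [Finset.sum_comm, Finset.sum_comm (f := fun j i => x i * p (y i * x j) * y j),
      Finset.sum_mul]
    refine Finset.sum_congr rfl fun i _ => ?_
    have := h.sum_map_mul (LinearMap.mulLeft k (x i) ∘ₗ p ∘ₗ LinearMap.mulLeft k (y i)) b
    simpa [Finset.sum_mul, mul_assoc] using this
  · intro z hz
    have h1 : ∀ b, (∑ j, ∑ i, x i * p (y i * x j) * y j) * b =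
        b * ∑ j, ∑ i, x i * p (y i * x j) * y j := by
      intro b
      rw [hleft]
      rw [Finset.sum_comm, Finset.sum_comm (f := fun j i => x i * p (y i * (b * x j)) * y j),
        Finset.sum_mul]
      refine Finset.sum_congr rfl fun i _ => ?_
      have := h.sum_map_mul (LinearMap.mulLeft k (x i) ∘ₗ p ∘ₗ LinearMap.mulLeft k (y i)) b
      simpa [Finset.sum_mul, mul_assoc] using this.symm
    rw [h1, hleft]
    have h2 : ∀ i j, p (y i * (z * x j)) = y i * (z * x j) := fun i j =>
      hp _ (hl _ _ (hr _ _ hz))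
    simp_rw [h2]
    simp only [← mul_assoc, ← Finset.sum_mul, h.sum_mul, one_mul]
    simp only [mul_assoc, ← Finset.mul_sum, h.sum_mul, mul_one]

/-- The central element generating an ideal is a scalar of the field, so it is zero or invertible.
-/
theorem isSimpleRing {k D ι : Type*} [Field k] [Ring D] [Nontrivial D] [Algebra k D] [Fintype ι]
    {x y : ι → D} (h : IsSeparabilityFamily k x y)
    (hc : ∀ z ∈ Subring.center D, ∃ r : k, algebraMap k D r = z) : IsSimpleRing D := by
  refine ⟨⟨fun I => ?_⟩⟩
  let J : Submodule k D :=
    { carrier := {z | z ∈ I}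
      add_mem' := fun ha hb => I.add_mem ha hb
      zero_mem' := I.zero_mem
      smul_mem' := fun c z hz => by
        rw [Algebra.smul_def]; exact I.mul_mem_left _ _ hz }
  obtain ⟨c, hcJ, hcc, hcz⟩ := h.exists_central_unit J (fun a z hz => I.mul_mem_left _ _ hz)
    (fun a z hz => I.mul_mem_right _ _ hz)
  obtain ⟨r, rfl⟩ := hc c hcc
  by_cases hr : r = 0
  · left
    refine eq_bot_iff.2 fun z hz => ?_
    have := hcz z hz
    rw [hr, map_zero, zero_mul] at this
    rw [← this]; exact TwoSidedIdeal.zero_mem _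
  · right
    refine eq_top_iff.2 fun z _ => ?_
    have h1 : (algebraMap k D r⁻¹ * z) * algebraMap k D r ∈ I := I.mul_mem_left _ _ hcJ
    rwa [mul_assoc, ← Algebra.commutes, ← mul_assoc, ← map_mul, inv_mul_cancel₀ hr, map_one,
      one_mul] at h1

/-- The centre of a separable algebra over a field is reduced. -/
theorem eq_zero_of_mul_self_eq_zero {k D ι : Type*} [Field k] [Ring D] [Algebra k D] [Fintype ι]
    {x y : ι → D} (h : IsSeparabilityFamily k x y) {z : D} (hz : z ∈ Subring.center D)
    (hzz : z * z = 0) : z = 0 := by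
  have hzc := Subring.mem_center_iff.1 hz
  -- The ideal `z D` has an identity `c = z b`, and then `z = c z = z² b = 0`.
  obtain ⟨c, hcJ, -, hcz⟩ := h.exists_central_unit (LinearMap.range (LinearMap.mulLeft k z))
    (by rintro a _ ⟨b, rfl⟩; exact ⟨a * b, by simp [← mul_assoc, hzc a]⟩)
    (by rintro a _ ⟨b, rfl⟩; exact ⟨b * a, by simp [mul_assoc]⟩)
  obtain ⟨b, rfl⟩ := hcJ
  have := hcz z ⟨1, by simp⟩
  rw [← this, LinearMap.mulLeft_apply, mul_assoc, hzc b, ← mul_assoc, hzz, zero_mul]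

end IsSeparabilityFamily

/-! ### The Skolem–Noether theorem -/

/-- In a central simple algebra, `D ⊗ Dᵒᵖ` acts faithfully on `D`. -/
theorem eq_zero_of_sandwich_eq_zero {k D ι : Type*} [Field k] [Ring D] [Algebra k D] [Fintype ι]
    [IsSimpleRing D] (hc : ∀ z ∈ Subring.center D, ∃ r : k, algebraMap k D r = z)
    (b : ι → D) (hb : LinearIndependent k b) (x : ι → D) (hx : ∀ z, ∑ i, x i * z * b i = 0) :
    x = 0 := by
  classical
  -- Induction on the size of the support of `x`. By simplicity, some relation supported inside that
  -- of `x` has the entry `1` at `i₀`. Its commutators with elements of `D` are relations with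
  -- smaller support, hence zero, so its entries are scalars; this contradicts the independence of
  -- `b`.
  induction hn : (Finset.univ.filter fun i => x i ≠ 0).card using Nat.strong_induction_on
    generalizing x with
  | _ n ih =>
  by_contra hx0
  obtain ⟨i₀, hi₀⟩ := Function.ne_iff.1 hx0
  let J : TwoSidedIdeal D := TwoSidedIdeal.mk'
    {a | ∃ x' : ι → D, (∀ i, x i = 0 → x' i = 0) ∧ (∀ z, ∑ i, x' i * z * b i = 0) ∧ x' i₀ = a}
    ⟨0, by simp, by simp, rfl⟩
    (by
      rintro _ _ ⟨y, hy, hy', rfl⟩ ⟨z, hz, hz', rfl⟩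
      exact ⟨y + z, fun i hi => by simp [hy i hi, hz i hi], fun t => by
        simp [add_mul, Finset.sum_add_distrib, hy', hz'], rfl⟩)
    (by
      rintro _ ⟨y, hy, hy', rfl⟩
      exact ⟨-y, fun i hi => by simp [hy i hi], fun t => by simp [hy'], rfl⟩)
    (by
      rintro a _ ⟨y, hy, hy', rfl⟩
      exact ⟨fun i => a * y i, fun i hi => by simp [hy i hi], fun t => by
        simp_rw [mul_assoc a, ← Finset.mul_sum, hy', mul_zero], rfl⟩)
    (by
      rintro _ a ⟨y, hy, hy', rfl⟩
      exact ⟨fun i => y i * a, fun i hi => by simp [hy i hi], fun t => by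
        simp_rw [mul_assoc (y _) a, hy'], rfl⟩)
  have hJ : ∀ a, a ∈ J ↔ ∃ x' : ι → D, (∀ i, x i = 0 → x' i = 0) ∧
      (∀ z, ∑ i, x' i * z * b i = 0) ∧ x' i₀ = a := fun a => TwoSidedIdeal.mem_mk' ..
  have hJt : J = ⊤ := by
    rcases eq_bot_or_eq_top J with h | h
    · exact absurd ((TwoSidedIdeal.mem_bot D).1 (h ▸ (hJ _).2 ⟨x, fun _ h => h, hx, rfl⟩)) hi₀
    · exact h
  obtain ⟨y, hy, hy', hy1⟩ := (hJ 1).1 (hJt ▸ TwoSidedIdeal.mem_top D)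
  have hcen : ∀ i, ∃ r : k, algebraMap k D r = y i := by
    intro i
    refine hc _ (Subring.mem_center_iff.2 fun d => ?_)
    have h0 : (fun i => d * y i - y i * d) = 0 := by
      refine ih _ ?_ _ (fun z => ?_) rfl
      · rw [← hn]
        refine Finset.card_lt_card ⟨fun i hi => ?_, fun h => ?_⟩
        · simp only [Finset.mem_filter, Finset.mem_univ, true_and] at hi ⊢
          exact fun h => hi (by simp [hy i h])
        · have := h (Finset.mem_filter.2 ⟨Finset.mem_univ i₀, hi₀⟩)
          simp [hy1] at this
      · simp only [sub_mul, Finset.sum_sub_distrib]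
        simp_rw [mul_assoc d, ← Finset.mul_sum, hy', mul_assoc (y _) d, hy']
        simp
    exact sub_eq_zero.1 (congrFun h0 i)
  choose r hr using hcen
  have h1 := hy' 1
  simp_rw [← hr, mul_one, ← Algebra.smul_def] at h1
  have := Fintype.linearIndependent_iff.1 hb r h1 i₀
  rw [← hr, this, map_zero] at hy1
  exact zero_ne_one hy1

/-- The twisted average `g` of any `z` satisfies `φ c * g = g * c`, so `g D` is a two-sided ideal.
Faithfulness of `D ⊗ Dᵐᵒᵖ` on `D` makes some `g` nonzero, and then simplicity makes it a unit. -/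
theorem IsSeparabilityFamily.exists_isUnit_twisted_sandwich {k D ι : Type*} [Field k] [Ring D]
    [Nontrivial D] [Algebra k D] [Module.Finite k D] [Fintype ι] {x y : ι → D}
    (h : IsSeparabilityFamily k x y)
    (hc : ∀ z ∈ Subring.center D, ∃ r : k, algebraMap k D r = z) (φ : D ≃ₐ[k] D) :
    ∃ z : D, IsUnit (∑ i, φ (x i) * z * y i) := by
  have := h.isSimpleRing hc
  have hne : ∃ z : D, ∑ i, φ (x i) * z * y i ≠ 0 := by
    by_contra! h0
    let b := Module.finBasis k D
    have h1 := eq_zero_of_sandwich_eq_zero hc b b.linearIndependent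
      (fun j => ∑ i, φ (b.repr (y i) j • x i)) (fun z => by
        rw [← h0 z]
        conv_rhs => enter [2, i]; rw [← b.sum_repr (y i)]
        simp_rw [Finset.sum_mul, Finset.mul_sum]
        rw [Finset.sum_comm]
        simp)
    have h2 : ∑ j, (∑ i, b.repr (y i) j • x i) * b j = 1 := by
      rw [← h.sum_mul]
      conv_rhs => enter [2, i]; rw [← b.sum_repr (y i)]
      simp_rw [Finset.sum_mul, Finset.mul_sum]
      rw [Finset.sum_comm]
      simp
    have h3 : ∀ j, ∑ i, b.repr (y i) j • x i = 0 := fun j => by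
      have := congrFun h1 j
      simp only [← map_sum, Pi.zero_apply] at this
      exact (map_eq_zero_iff φ φ.injective).1 this
    simp [h3] at h2
  obtain ⟨z, hz⟩ := hne
  refine ⟨z, ?_⟩
  set g := ∑ i, φ (x i) * z * y i with hg
  have hcomm : ∀ c, φ c * g = g * c := fun c => by
    have := h.sum_map_mul (LinearMap.mulRight k z ∘ₗ φ.toLinearMap) c
    simpa [hg, Finset.mul_sum, Finset.sum_mul, mul_assoc] using this
  let J : TwoSidedIdeal D := TwoSidedIdeal.mk' {a | ∃ c, g * c = a} ⟨0, mul_zero _⟩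
    (by rintro _ _ ⟨c, rfl⟩ ⟨d, rfl⟩; exact ⟨c + d, mul_add _ _ _⟩)
    (by rintro _ ⟨c, rfl⟩; exact ⟨-c, mul_neg _ _⟩)
    (by
      rintro a _ ⟨c, rfl⟩
      exact ⟨φ.symm a * c, by rw [← mul_assoc, ← mul_assoc, ← hcomm, φ.apply_symm_apply]⟩)
    (by rintro _ a ⟨c, rfl⟩; exact ⟨c * a, (mul_assoc _ _ _).symm⟩)
  have hJ : ∀ a, a ∈ J ↔ ∃ c, g * c = a := fun a => TwoSidedIdeal.mem_mk' ..
  have hJt : J = ⊤ := by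
    rcases eq_bot_or_eq_top J with h | h
    · exact absurd ((TwoSidedIdeal.mem_bot D).1 (h ▸ (hJ _).2 ⟨1, mul_one g⟩)) hz
    · exact h
  obtain ⟨c, hc⟩ := (hJ 1).1 (hJt ▸ TwoSidedIdeal.mem_top D)
  have hc' : φ c * g = 1 := (hcomm c).trans hc
  exact ⟨⟨g, c, hc, by rwa [← left_inv_eq_right_inv hc' hc]⟩, rfl⟩

/-- An element of a finite algebra over `S` is a unit if it is a unit modulo every maximal ideal
of `S`. -/
theorem isUnit_of_forall_isUnit_quotient {S C : Type*} [CommRing S] [Ring C] [Algebra S C]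
    [Module.Finite S C] (g : C)
    (hg : ∀ m : MaximalSpectrum S, IsUnit ((1 : S ⧸ m.asIdeal) ⊗ₜ[S] g)) : IsUnit g := by
  have key : ∀ f : C →ₗ[S] C, (∀ m : MaximalSpectrum S, ∀ t : (S ⧸ m.asIdeal) ⊗[S] C, ∃ c,
      (1 : S ⧸ m.asIdeal) ⊗ₜ[S] f c = t) → ∃ c, f c = 1 := by
    intro f hf
    let N := C ⧸ LinearMap.range f
    have hN : Subsingleton N := by
      -- Nakayama's lemma for the cokernel of `f`: a proper annihilator would lie in some maximal
      -- `m`, while `N = m N` yields an annihilating element congruent to `1` modulo `m`.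
      rw [← Module.annihilator_eq_top_iff (R := S)]
      by_contra hne
      obtain ⟨m, hm, hle⟩ := Ideal.exists_le_maximal _ hne
      have h1 : (⊤ : Submodule S N) ≤ m • ⊤ := by
        intro n _
        obtain ⟨a, rfl⟩ := (LinearMap.range f).mkQ_surjective n
        obtain ⟨c, hc⟩ := hf ⟨m, hm⟩ (1 ⊗ₜ a)
        have h2 : a - f c ∈ m • (⊤ : Submodule S C) := by
          have h3 : (1 : S ⧸ m) ⊗ₜ[S] (a - f c) = 0 := by
            rw [TensorProduct.tmul_sub, sub_eq_zero]; exact hc.symm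
          have h4 := congrArg (TensorProduct.quotTensorEquivQuotSMul C m) h3
          rw [map_zero] at h4
          rw [← Submodule.Quotient.mk_eq_zero, ← h4]
          exact (TensorProduct.quotTensorEquivQuotSMul_mk_tmul (I := m) 1 (a - f c)).symm ▸ by simp
        have h5 : (LinearMap.range f).mkQ a = (LinearMap.range f).mkQ (a - f c) := by
          rw [map_sub, eq_comm, sub_eq_self]
          exact (Submodule.Quotient.mk_eq_zero _).2 ⟨c, rfl⟩
        rw [h5]
        have := Submodule.mem_map_of_mem (f := (LinearMap.range f).mkQ) h2
        rw [Submodule.map_smul''] at this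
        exact smul_mono_right m (le_top (a := Submodule.map _ _)) this
      obtain ⟨r, hr, hr0⟩ := Submodule.exists_sub_one_mem_and_smul_eq_zero_of_fg_of_le_smul m
        (⊤ : Submodule S N) Module.Finite.fg_top h1
      have : r ∈ m := hle (Module.mem_annihilator.2 fun n => hr0 n trivial)
      exact hm.ne_top ((Ideal.eq_top_iff_one _).2 (by simpa using m.sub_mem this hr))
    have : (LinearMap.range f).mkQ 1 = 0 := Subsingleton.elim _ _
    exact (Submodule.Quotient.mk_eq_zero _).1 this
  have hlift : ∀ (m : MaximalSpectrum S) (t : (S ⧸ m.asIdeal) ⊗[S] C), ∃ c,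
      (1 : S ⧸ m.asIdeal) ⊗ₜ[S] c = t := fun m t =>
    TensorProduct.mk_surjective S C _ Ideal.Quotient.mk_surjective t
  obtain ⟨c, hc⟩ := key (LinearMap.mulLeft S g) fun m t => by
    obtain ⟨u, hu⟩ := hg m
    obtain ⟨c, hc⟩ := hlift m (u.inv * t)
    refine ⟨c, ?_⟩
    rw [LinearMap.mulLeft_apply, ← one_mul (1 : S ⧸ m.asIdeal),
      ← Algebra.TensorProduct.tmul_mul_tmul, hc, ← hu, ← mul_assoc, Units.val_inv, one_mul]
  obtain ⟨d, hd⟩ := key (LinearMap.mulRight S g) fun m t => by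
    obtain ⟨u, hu⟩ := hg m
    obtain ⟨c, hc⟩ := hlift m (t * u.inv)
    refine ⟨c, ?_⟩
    rw [LinearMap.mulRight_apply, ← one_mul (1 : S ⧸ m.asIdeal),
      ← Algebra.TensorProduct.tmul_mul_tmul, hc, ← hu, mul_assoc, Units.inv_val, mul_one]
  rw [LinearMap.mulLeft_apply] at hc
  rw [LinearMap.mulRight_apply] at hd
  exact ⟨⟨g, c, hc, by rwa [← left_inv_eq_right_inv hd hc]⟩, rfl⟩

/-- The **Skolem–Noether theorem** over a semilocal ring. -/
theorem IsSeparabilityFamily.exists_conj {S C ι : Type*} [CommRing S] [Finite (MaximalSpectrum S)]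
    [Ring C] [Algebra S C] [Module.Finite S C] [Fintype ι] {x y : ι → C}
    (h : IsSeparabilityFamily S x y)
    (hc : ∀ z ∈ Subring.center C, ∃ r : S, algebraMap S C r = z)
    (hinj : Function.Injective (algebraMap S C)) (φ : C ≃ₐ[S] C) :
    ∃ g : Cˣ, ∀ c, φ c * g = g * c := by
  let avg : C →ₗ[S] C := ∑ i, LinearMap.mulLeft S (φ (x i)) ∘ₗ LinearMap.mulRight S (y i)
  have havg : ∀ z, avg z = ∑ i, φ (x i) * z * y i := fun z => by simp [avg, mul_assoc]
  have hfield : ∀ m : MaximalSpectrum S, ∃ z : C,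
      IsUnit ((1 : S ⧸ m.asIdeal) ⊗ₜ[S] avg z) := by
    intro m
    let _ : Field (S ⧸ m.asIdeal) := Ideal.Quotient.field _
    -- Averaging maps `m C` into `m · 1` and fixes `1`. So if `1` were in `m C`, injectivity of `S →
    -- C` would put `1` into `m`.
    have hnt : Nontrivial ((S ⧸ m.asIdeal) ⊗[S] C) := by
      by_contra hn
      rw [not_nontrivial_iff_subsingleton] at hn
      have h1 : (1 : S ⧸ m.asIdeal) ⊗ₜ[S] (1 : C) = 0 := Subsingleton.elim _ _
      let π : C →ₗ[S] C := ∑ i, LinearMap.mulLeft S (x i) ∘ₗ LinearMap.mulRight S (y i)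
      have hπ : ∀ z, π z = ∑ i, x i * z * y i := fun z => by simp [π, mul_assoc]
      have h4 := congrArg (TensorProduct.quotTensorEquivQuotSMul C m.asIdeal) h1
      rw [map_zero] at h4
      have h2 : (1 : C) ∈ m.asIdeal • (⊤ : Submodule S C) := by
        rw [← Submodule.Quotient.mk_eq_zero, ← h4]
        exact (TensorProduct.quotTensorEquivQuotSMul_mk_tmul (I := m.asIdeal) 1 (1 : C)).symm ▸
          by simp
      have h3 : ∀ c ∈ m.asIdeal • (⊤ : Submodule S C), ∃ s ∈ m.asIdeal,
          algebraMap S C s = π c := by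
        intro c hcm
        induction hcm using Submodule.smul_induction_on' with
        | smul r hr n hn =>
          obtain ⟨s, hs⟩ := hc _ (h.sandwich_mem_center n)
          exact ⟨r * s, m.asIdeal.mul_mem_right _ hr, by
            rw [map_smul, hπ, ← hs, map_mul, Algebra.smul_def]⟩
        | add a _ b _ ha hb =>
          obtain ⟨s, hs, hs'⟩ := ha
          obtain ⟨t, ht, ht'⟩ := hb
          exact ⟨s + t, add_mem hs ht, by rw [map_add, map_add, hs', ht']⟩
      obtain ⟨s, hs, hs'⟩ := h3 1 h2
      rw [hπ, h.sandwich_of_mem_center (Subring.one_mem _), ← map_one (algebraMap S C)] at hs'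
      exact m.isMaximal.ne_top ((Ideal.eq_top_iff_one _).2 (hinj hs' ▸ hs))
    obtain ⟨t, ht⟩ := (h.baseChange (S ⧸ m.asIdeal)).exists_isUnit_twisted_sandwich
      (h.center_baseChange hc _) (Algebra.TensorProduct.congr AlgEquiv.refl φ)
    obtain ⟨z, rfl⟩ := TensorProduct.mk_surjective S C _ Ideal.Quotient.mk_surjective t
    refine ⟨z, ?_⟩
    rw [havg]
    simpa [TensorProduct.tmul_sum] using ht
  choose z hz using hfield
  -- By the Chinese remainder theorem, one element has the chosen residues at all the finitely many
  -- maximal ideals; its average is then a unit modulo each of them.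
  obtain ⟨z₀, hz₀⟩ := Ideal.pi_tensorProductMk_quotient_surjective C
    (fun m : MaximalSpectrum S => m.asIdeal)
    (fun _ _ ne => Ideal.isCoprime_of_isMaximal (MaximalSpectrum.ext_iff.ne.mp ne))
    (fun m => (1 : S ⧸ m.asIdeal) ⊗ₜ[S] z m)
  have hunit : IsUnit (avg z₀) := by
    refine isUnit_of_forall_isUnit_quotient (S := S) _ fun m => ?_
    have h1 : (1 : S ⧸ m.asIdeal) ⊗ₜ[S] z₀ = 1 ⊗ₜ z m := congrFun hz₀ m
    have h2 := congrArg (avg.lTensor (S ⧸ m.asIdeal)) h1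
    rw [LinearMap.lTensor_tmul, LinearMap.lTensor_tmul] at h2
    rw [h2]
    exact hz m
  obtain ⟨g, hg⟩ := hunit
  refine ⟨g, fun c => ?_⟩
  rw [hg, havg]
  have := h.sum_map_mul (LinearMap.mulRight S z₀ ∘ₗ φ.toLinearMap) c
  simpa [Finset.mul_sum, Finset.sum_mul, mul_assoc] using this

/-! ### Connected semilocal rings -/

theorem IsConnectedRing.preconnectedSpace {R : Type*} [CommRing R] (hR : IsConnectedRing R) :
    PreconnectedSpace (PrimeSpectrum R) := by
  refine preconnectedSpace_iff_clopen.2 fun s hs => ?_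
  obtain ⟨e, he, rfl⟩ := PrimeSpectrum.isClopen_iff.1 hs
  rcases hR.2 e he with rfl | rfl
  · left; simp
  · right; simp

/-- A finitely generated projective module over a connected semilocal ring is free. -/
theorem IsConnectedRing.exists_basis {R : Type*} [CommRing R] [Finite (MaximalSpectrum R)]
    (hR : IsConnectedRing R) (M : Type*) [AddCommGroup M] [Module R M] [Module.Finite R M]
    [Module.Projective R M] : ∃ n : ℕ, Nonempty (Module.Basis (Fin n) R M) := by
  have := hR.preconnectedSpace
  have := hR.1
  obtain ⟨p₀⟩ : Nonempty (PrimeSpectrum R) := inferInstance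
  have : Module.FinitePresentation R M := Module.finitePresentation_of_projective R M
  refine ⟨Module.rankAtStalk M p₀, Module.nonempty_basis_of_flat_of_finrank_eq R M _ fun P => ?_⟩
  let _ : Field (R ⧸ P.1) := Ideal.Quotient.field _
  -- The dimension of the fibre at a maximal ideal is the rank there, and the rank is locally
  -- constant on a connected spectrum.
  have h1 := Module.rankAtStalk_eq_finrank_of_free (R := R ⧸ P.1) (M := (R ⧸ P.1) ⊗[R] M)
  have h2 := Module.rankAtStalk_baseChange (R := R) (M := M) (S := R ⧸ P.1) ⊥
  rw [h1] at h2
  exact h2.trans (Module.isLocallyConstant_rankAtStalk.apply_eq_of_preconnectedSpace _ _)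

/-! ### Rings with an automorphism of order two -/

/-- `ι` is an involutive automorphism of `S` whose fixed ring is `R`. -/
structure IsQuadraticInvolution (R : Type*) {S : Type*} [CommRing R] [CommRing S] [Algebra R S]
    (ι : S ≃+* S) : Prop where
  invol : ∀ s, ι (ι s) = s
  map_algebraMap : ∀ r : R, ι (algebraMap R S r) = algebraMap R S r
  exists_of_fixed : ∀ s, ι s = s → ∃ r, algebraMap R S r = s

namespace IsQuadraticInvolution

variable {R S : Type*} [CommRing R] [CommRing S] [Algebra R S] {ι : S ≃+* S}

/-- Each `s` is a root of `X² - (s + ι s) X + s ι s`, whose coefficients are fixed by `ι`. -/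
theorem isIntegral (h : IsQuadraticInvolution R ι) : Algebra.IsIntegral R S := by
  refine ⟨fun s => ?_⟩
  obtain ⟨a, ha⟩ := h.exists_of_fixed (s + ι s) (by rw [map_add, h.invol, add_comm])
  obtain ⟨b, hb⟩ := h.exists_of_fixed (s * ι s) (by rw [map_mul, h.invol, mul_comm])
  refine ⟨Polynomial.X ^ 2 - Polynomial.C a * Polynomial.X + Polynomial.C b, ?_, ?_⟩
  · monicity!
  · simp only [Polynomial.eval₂_add, Polynomial.eval₂_sub, Polynomial.eval₂_mul,
      Polynomial.eval₂_pow, Polynomial.eval₂_X, Polynomial.eval₂_C, ha, hb]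
    ring

/-- Maximal ideals of `S` with the same trace on `R` are conjugate. -/
theorem eq_or_eq_comap (h : IsQuadraticInvolution R ι) (M N : Ideal S) [hM : M.IsMaximal]
    [hN : N.IsMaximal] (hMN : N.comap (algebraMap R S) ≤ M.comap (algebraMap R S)) :
    N = M ∨ N = M.comap ι := by
  have hMι : (M.comap ι).IsMaximal := Ideal.comap_isMaximal_of_equiv ι
  by_contra! hne
  -- Prime avoidance. The norm `x * ι x` comes from `R` and lies in `N`, hence in `M`, so `x` or `ι
  -- x` would lie in `M`.
  have h1 : ∃ x ∈ N, x ∉ M ∧ x ∉ M.comap ι := by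
    by_contra! h2
    have h3 : (N : Set S) ⊆ (M : Set S) ∪ (M.comap ι : Ideal S) := fun x hx => by
      by_cases hxM : x ∈ M
      · exact Or.inl hxM
      · exact Or.inr (h2 x hx hxM)
    rcases Ideal.subset_union.1 h3 with h4 | h4
    · exact hne.1 (hN.eq_of_le hM.ne_top h4)
    · exact hne.2 (hN.eq_of_le hMι.ne_top h4)
  obtain ⟨x, hxN, hxM, hxM'⟩ := h1
  obtain ⟨r, hr⟩ := h.exists_of_fixed (x * ι x) (by rw [map_mul, h.invol, mul_comm])
  have h2 : r ∈ N.comap (algebraMap R S) := by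
    rw [Ideal.mem_comap, hr]; exact N.mul_mem_right _ hxN
  have h3 := hMN h2
  rw [Ideal.mem_comap, hr] at h3
  rcases hM.isPrime.mem_or_mem h3 with h4 | h4
  · exact hxM h4
  · exact hxM' h4

/-- Contraction to `R` has fibres of the form `{M, ι⁻¹ M}`, with at most two elements. -/
theorem finite_maximalSpectrum (h : IsQuadraticInvolution R ι) [Finite (MaximalSpectrum R)] :
    Finite (MaximalSpectrum S) := by
  have := h.isIntegral
  let c : MaximalSpectrum S → MaximalSpectrum R := fun M =>
    ⟨M.1.comap (algebraMap R S),
      Ideal.isMaximal_comap_of_isIntegral_of_isMaximal (R := R) M.1 (hI := M.2)⟩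
  rw [← Set.finite_univ_iff]
  refine Set.Finite.of_finite_fibers c (Set.toFinite _) fun m _ => ?_
  by_cases hm : ∃ M : MaximalSpectrum S, c M = m
  · obtain ⟨M, rfl⟩ := hm
    have := M.2
    refine (Set.toFinite {M, ⟨M.1.comap ι, Ideal.comap_isMaximal_of_equiv ι⟩}).subset ?_
    rintro N ⟨-, hN⟩
    have := N.2
    rcases h.eq_or_eq_comap M.1 N.1 (le_of_eq (congrArg MaximalSpectrum.asIdeal hN)) with h1 | h1
    · exact Or.inl (MaximalSpectrum.ext h1)
    · exact Or.inr (MaximalSpectrum.ext h1)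
  · exact Set.Finite.subset Set.finite_empty fun N hN => hm ⟨N, hN.2⟩

/-- Hilbert's Theorem 90 for a semilocal ring, if `ι` acts nontrivially on residue fields. -/
theorem exists_isUnit_add (h : IsQuadraticInvolution R ι) [Finite (MaximalSpectrum R)]
    (hι : ∀ M : Ideal S, M.IsMaximal → ∃ s, s - ι s ∉ M) (u : S) (hu : u * ι u = 1) :
    ∃ x, IsUnit (x + ι x * u) := by
  have := h.isIntegral
  have huM : ∀ M : Ideal S, M.IsMaximal → u ∉ M := fun M hM huM =>
    hM.ne_top ((Ideal.eq_top_iff_one _).2 (hu ▸ M.mul_mem_right _ huM))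
  have local_ : ∀ m : MaximalSpectrum R, ∃ x : S, ∀ M : Ideal S, M.IsMaximal →
      M.comap (algebraMap R S) = m.asIdeal → x + ι x * u ∉ M := by
    intro m
    by_cases hm : ∃ M : Ideal S, M.IsMaximal ∧ M.comap (algebraMap R S) = m.asIdeal
    swap
    · exact ⟨0, fun M hM hMm => absurd ⟨M, hM, hMm⟩ hm⟩
    obtain ⟨M, hM, hMm⟩ := hm
    have hMι : (M.comap ι).IsMaximal := Ideal.comap_isMaximal_of_equiv ι
    have hall : ∀ x : S, x + ι x * u ∉ M → x + ι x * u ∉ M.comap ι → ∀ N : Ideal S,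
        N.IsMaximal → N.comap (algebraMap R S) = m.asIdeal → x + ι x * u ∉ N := by
      intro x h1 h2 N hN hNm
      rcases h.eq_or_eq_comap M N (hNm.trans hMm.symm).le with rfl | rfl
      · exact h1
      · exact h2
    by_cases hMM : M.comap ι = M
    -- When `M` is stable under `ι`, the choice `x = 1` works unless `u ≡ -1` modulo `M`. In that
    -- case `x + ι x * u ≡ x - ι x`, which is nonzero for the `s` supplied by the hypothesis on
    -- residue fields.
    · by_cases h1 : 1 + u ∈ M
      · obtain ⟨s, hs⟩ := hι M hM
        have h2 : s + ι s * u ∉ M := fun h3 => hs (by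
          have : s - ι s = (s + ι s * u) - ι s * (1 + u) := by ring
          rw [this]
          exact M.sub_mem h3 (M.mul_mem_left _ h1))
        exact ⟨s, hall s h2 (by rwa [hMM])⟩
      · refine ⟨1, hall 1 ?_ ?_⟩
        · simpa using h1
        · rw [hMM]; simpa using h1
    -- When the two ideals differ, `x` is taken to be `0` modulo the conjugate of `M` and `1` modulo
    -- `M`. Then `ι x` is `0` modulo `M`, so exactly one of the two summands survives at each ideal.
    · have hco : M.comap ι ⊔ M = ⊤ := hMι.coprime_of_ne hM hMM
      obtain ⟨x, hx, y, hy, hxy⟩ := Submodule.mem_sup.1 ((Ideal.eq_top_iff_one _).1 hco)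
      have hx' : ι x ∈ M := hx
      refine ⟨x, hall x (fun h1 => ?_) (fun h1 => ?_)⟩
      · have h2 : x ∈ M := by simpa using M.sub_mem h1 (M.mul_mem_right u hx')
        exact hM.ne_top ((Ideal.eq_top_iff_one _).2 (hxy ▸ M.add_mem h2 hy))
      · have h2 : ι x * u ∈ M.comap ι := by simpa using Ideal.sub_mem _ h1 hx
        rcases hMι.isPrime.mem_or_mem h2 with h3 | h3
        · rw [Ideal.mem_comap, h.invol] at h3
          exact hM.ne_top ((Ideal.eq_top_iff_one _).2 (hxy ▸ M.add_mem h3 hy))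
        · exact huM _ hMι h3
  choose x hx using local_
  obtain ⟨t, ht⟩ := Ideal.pi_tensorProductMk_quotient_surjective S
    (fun m : MaximalSpectrum R => m.asIdeal)
    (fun _ _ ne => Ideal.isCoprime_of_isMaximal (MaximalSpectrum.ext_iff.ne.mp ne))
    (fun m => (1 : R ⧸ m.asIdeal) ⊗ₜ[R] x m)
  let ιl : S →ₗ[R] S :=
    { toFun := ι
      map_add' := map_add ι
      map_smul' := fun r s => by
        rw [Algebra.smul_def, map_mul, h.map_algebraMap, ← Algebra.smul_def]; rfl }
  refine ⟨t, ?_⟩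
  by_contra hnu
  obtain ⟨M, hM, htM⟩ := exists_max_ideal_of_mem_nonunits hnu
  have hmm : (M.comap (algebraMap R S)).IsMaximal :=
    Ideal.isMaximal_comap_of_isIntegral_of_isMaximal (R := R) M
  have h1 := congrFun ht ⟨_, hmm⟩
  simp only [LinearMap.pi_apply, TensorProduct.mk_apply] at h1
  refine hx ⟨_, hmm⟩ M hM rfl ?_
  have h2 : (1 : R ⧸ M.comap (algebraMap R S)) ⊗ₜ[R] (x ⟨_, hmm⟩ - t) = 0 := by
    rw [TensorProduct.tmul_sub, sub_eq_zero]; exact h1.symm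
  have h3 : x ⟨_, hmm⟩ - t ∈ M.comap (algebraMap R S) • (⊤ : Submodule R S) := by
    have h4 := congrArg (TensorProduct.quotTensorEquivQuotSMul S (M.comap (algebraMap R S))) h2
    rw [map_zero] at h4
    rw [← Submodule.Quotient.mk_eq_zero, ← h4]
    exact (TensorProduct.quotTensorEquivQuotSMul_mk_tmul (I := M.comap (algebraMap R S)) 1
      (x ⟨_, hmm⟩ - t)).symm ▸ by simp
  -- An ideal extended from `R` is stable under `ι`, so congruence to the local choice is inherited
  -- by `x + ι x * u`.
  have hsub : ∀ s ∈ M.comap (algebraMap R S) • (⊤ : Submodule R S), s ∈ M ∧ ι s ∈ M := by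
    intro s hs
    induction hs using Submodule.smul_induction_on' with
    | smul r hr n _ =>
      have h5 : algebraMap R S r ∈ M := hr
      rw [Algebra.smul_def, map_mul, h.map_algebraMap]
      exact ⟨M.mul_mem_right _ h5, M.mul_mem_right _ h5⟩
    | add a _ b _ ha hb =>
      rw [map_add]
      exact ⟨M.add_mem ha.1 hb.1, M.add_mem ha.2 hb.2⟩
  obtain ⟨h5, h6⟩ := hsub _ h3
  have h7 : x ⟨_, hmm⟩ + ι (x ⟨_, hmm⟩) * u = (t + ι t * u) + ((x ⟨_, hmm⟩ - t) +
      ι (x ⟨_, hmm⟩ - t) * u) := by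
    rw [map_sub]; ring
  rw [h7]
  exact M.add_mem htM (M.add_mem h5 (M.mul_mem_right _ h6))

end IsQuadraticInvolution

/-- The average over a separability family, as an `S`-linear retraction of `A` onto its centre. -/
theorem IsSeparabilityFamily.exists_retraction {R S A κ : Type*} [CommRing R] [CommRing S]
    [Ring A] [Algebra R A] [Algebra S A] [Fintype κ] {x y : κ → A}
    (h : IsSeparabilityFamily R x y)
    (hc : ∀ z ∈ Subring.center A, ∃ s : S, algebraMap S A s = z)
    (hinj : Function.Injective (algebraMap S A)) :
    ∃ π : A →ₗ[S] S, ∀ s, π (algebraMap S A s) = s := by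
  let avg : A →ₗ[S] A := ∑ i, LinearMap.mulLeft S (x i) ∘ₗ LinearMap.mulRight S (y i)
  have havg : ∀ z, avg z = ∑ i, x i * z * y i := fun z => by simp [avg, mul_assoc]
  let e := LinearEquiv.ofInjective (Algebra.linearMap S A) hinj
  refine ⟨e.symm.toLinearMap ∘ₗ avg.codRestrict (LinearMap.range (Algebra.linearMap S A))
    (fun z => by rw [havg]; exact hc _ (h.sandwich_mem_center z)), fun s => ?_⟩
  rw [LinearMap.comp_apply]
  refine e.symm_apply_eq.2 (Subtype.ext ?_)
  rw [LinearMap.codRestrict_apply, havg, h.sandwich_of_mem_center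
    (Subring.mem_center_iff.2 fun b => (Algebra.commutes s b).symm)]
  rfl

/-- If `ι` is not the identity and `S` is the centre of a separable projective `R`-algebra, then
`ι` acts nontrivially on all residue fields. -/
theorem IsQuadraticInvolution.exists_sub_notMem {R S A κ : Type*} [CommRing R] [CommRing S]
    [Ring A] [Algebra R S] [Algebra R A] [Algebra S A] [IsScalarTower R S A] [Fintype κ]
    [Finite (MaximalSpectrum R)] (hR : IsConnectedRing R) (h2 : IsUnit (2 : R))
    {ι : S ≃+* S} (hι : IsQuadraticInvolution R ι)
    {x y : κ → A} (h : IsSeparabilityFamily R x y) [Module.Projective R A]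
    (hc : ∀ z ∈ Subring.center A, ∃ s : S, algebraMap S A s = z)
    (hinj : Function.Injective (algebraMap S A)) (hne : ¬ ∀ s, ι s = s)
    (M : Ideal S) (hM : M.IsMaximal) : ∃ s, s - ι s ∉ M := by
  by_contra! hall
  obtain ⟨half, hhalf⟩ := h2.exists_left_inv
  have hhalf' : algebraMap R S half * 2 = 1 := by
    rw [← map_ofNat (algebraMap R S) 2, ← map_mul, hhalf, map_one]
  have := hι.isIntegral
  have := h.finite
  obtain ⟨π, hπ⟩ := h.exists_retraction hc hinj
  -- `S` is an `R`-summand of `A`, and since `2` is invertible the skew elements are a summand of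
  -- `S`. Hence they form a free `R`-module. The contradiction will be that this module equals `m`
  -- times itself, so has rank zero.
  let πR : A →ₗ[R] S := π.restrictScalars R
  let iR : S →ₗ[R] A := (Algebra.linearMap S A).restrictScalars R
  have hsplit : πR ∘ₗ iR = LinearMap.id := LinearMap.ext hπ
  have : Module.Finite R S := Module.Finite.of_surjective πR fun s => ⟨iR s, hπ s⟩
  have : Module.Projective R S := Module.Projective.of_split iR πR hsplit
  let Skew : Submodule R S :=
    { carrier := {s | ι s = -s}
      add_mem' := fun {a b} ha hb => by
        rw [Set.mem_ofPred_eq] at *; rw [map_add, ha, hb]; ring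
      zero_mem' := by simp
      smul_mem' := fun r s hs => by
        rw [Set.mem_ofPred_eq] at *
        rw [Algebra.smul_def, map_mul, hι.map_algebraMap, hs]; ring }
  have hSkew : ∀ s, s ∈ Skew ↔ ι s = -s := fun s => Iff.rfl
  let p : S →ₗ[R] Skew :=
    { toFun := fun s => ⟨algebraMap R S half * (s - ι s), by
        rw [hSkew, map_mul, map_sub, hι.map_algebraMap, hι.invol]; ring⟩
      map_add' := fun s t => Subtype.ext (by simp only [map_add, Submodule.coe_add]; ring)
      map_smul' := fun r s => Subtype.ext (by
        simp only [Algebra.smul_def, map_mul, hι.map_algebraMap, RingHom.id_apply,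
          Submodule.coe_smul]; ring) }
  have hp : ∀ s : Skew, p s = s := fun s => Subtype.ext (by
    change algebraMap R S half * ((s : S) - ι s) = s
    rw [(hSkew s).1 s.2]
    linear_combination (s : S) * hhalf')
  have : Module.Finite R Skew := Module.Finite.of_surjective p fun s => ⟨s, hp s⟩
  have : Module.Projective R Skew := Module.Projective.of_split Skew.subtype p (LinearMap.ext hp)
  obtain ⟨n, ⟨b⟩⟩ := hR.exists_basis Skew
  let m := M.comap (algebraMap R S)
  have hm : m.IsMaximal := Ideal.isMaximal_comap_of_isIntegral_of_isMaximal (R := R) M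
  have htop : ∀ s : Skew, s ∈ m • (⊤ : Submodule R Skew) := by
    intro s
    have hsM : (s : S) ∈ M := by
      have h1 := hall s
      rw [(hSkew s).1 s.2] at h1
      have h3 : (s : S) = algebraMap R S half * ((s : S) - -s) := by
        linear_combination -(s : S) * hhalf'
      rw [h3]
      exact M.mul_mem_left _ h1
    obtain ⟨r, hr⟩ := hι.exists_of_fixed ((s : S) * s) (by
      rw [map_mul, (hSkew s).1 s.2]; ring)
    have hrm : r ∈ m := by
      rw [Ideal.mem_comap, hr]; exact M.mul_mem_right _ hsM
    let _ : Field (R ⧸ m) := Ideal.Quotient.field m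
    -- In the fibre of `A` over `m` the skew element `s` becomes central with square zero, and the
    -- centre of a separable algebra over a field is reduced.
    have hzero : (1 : R ⧸ m) ⊗ₜ[R] algebraMap S A s = 0 := by
      refine (h.baseChange (R ⧸ m)).eq_zero_of_mul_self_eq_zero ?_ ?_
      · refine Subring.mem_center_iff.2 fun t => ?_
        induction t using TensorProduct.induction_on with
        | zero => simp
        | tmul c a => simp [Algebra.commutes]
        | add a b ha hb => rw [add_mul, mul_add, ha, hb]
      · rw [Algebra.TensorProduct.tmul_mul_tmul, ← map_mul, ← hr,
          ← IsScalarTower.algebraMap_apply, Algebra.algebraMap_eq_smul_one, TensorProduct.tmul_smul,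
          TensorProduct.smul_tmul', mul_one, ← Algebra.algebraMap_eq_smul_one,
          Ideal.Quotient.algebraMap_eq, Ideal.Quotient.eq_zero_iff_mem.2 hrm,
          TensorProduct.zero_tmul]
    have h3 : algebraMap S A s ∈ m • (⊤ : Submodule R A) := by
      have h4 := congrArg (TensorProduct.quotTensorEquivQuotSMul A m) hzero
      rw [map_zero] at h4
      rw [← Submodule.Quotient.mk_eq_zero, ← h4]
      exact (TensorProduct.quotTensorEquivQuotSMul_mk_tmul (I := m) 1
        (algebraMap S A s)).symm ▸ by simp
    have h5 := Submodule.mem_map_of_mem (f := p ∘ₗ πR) h3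
    rw [Submodule.map_smul''] at h5
    have h6 : (p ∘ₗ πR) (algebraMap S A s) = s := by
      rw [LinearMap.comp_apply]
      exact (congrArg p (hπ s)).trans (hp s)
    rw [h6] at h5
    exact smul_mono_right m (le_top (a := Submodule.map _ _)) h5
  rcases Nat.eq_zero_or_pos n with rfl | hn
  · refine hne fun s => ?_
    have h3 : p s = 0 := b.ext_elem fun i => i.elim0
    have h4 : algebraMap R S half * (s - ι s) = 0 := congrArg Subtype.val h3
    linear_combination (-2 : S) * h4 + (s - ι s) * hhalf'
  -- A coordinate of a basis vector is `1`, and it would have to lie in `m`.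
  · have h3 := Submodule.mem_map_of_mem (f := b.coord ⟨0, hn⟩) (htop (b ⟨0, hn⟩))
    rw [Submodule.map_smul''] at h3
    have h4 := smul_mono_right m (le_top (a := Submodule.map (b.coord ⟨0, hn⟩) ⊤)) h3
    rw [Ideal.smul_top_eq_map] at h4
    simp at h4
    exact hm.ne_top ((Ideal.eq_top_iff_one _).2 h4)

/-! ### Additive maps out of `M ⊗_A P` -/

namespace BimodTensor

variable {A : Type*} {B : Type*} [Ring A] [Ring B]
variable {M : Type v} [AddCommGroup M] [Module Aᵐᵒᵖ M]
variable {P : Type w} [AddCommGroup P] [Module A P] [Module Bᵐᵒᵖ P]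

theorem zero_tmul (p : P) : tmul A B (0 : M) p = 0 := by
  have := add_tmul A B (0 : M) 0 p
  simpa using this

theorem tmul_sum {κ : Type*} (s : Finset κ) (m : M) (p : κ → P) :
    tmul A B m (∑ i ∈ s, p i) = ∑ i ∈ s, tmul A B m (p i) :=
  map_sum (AddMonoidHom.mk' (fun p => tmul A B m p) (tmul_add A B m)) p s

theorem sum_tmul {κ : Type*} (s : Finset κ) (m : κ → M) (p : P) :
    tmul A B (∑ i ∈ s, m i) p = ∑ i ∈ s, tmul A B (m i) p :=
  map_sum (AddMonoidHom.mk' (fun m => tmul A B m p) (fun m n => add_tmul A B m n p)) m s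

theorem addHom_ext {N : Type*} [AddCommGroup N] {f g : BimodTensor A B M P →+ N}
    (h : ∀ m p, f (tmul A B m p) = g (tmul A B m p)) : f = g := by
  ext t
  induction t using BimodTensor.induction with
  | zero => simp
  | tmul m p => exact h m p
  | add s t hs ht => simp [hs, ht]

variable [SMulCommClass A Bᵐᵒᵖ P]

/-- The additive map out of `M ⊗_A P` given by a balanced biadditive map. -/
noncomputable def liftAdd {N : Type*} [AddCommGroup N] (f : M →+ P →+ N)
    (hf : ∀ (a : A) m p, f (op a • m) p = f m (a • p)) : BimodTensor A B M P →+ N :=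
  QuotientAddGroup.lift (bimodRel A B M P).toAddSubgroup
    (TensorProduct.liftAddHom f.flip fun r p m => by simp) (by
      intro t ht
      -- The relations span a `Bᵐᵒᵖ`-submodule while the map is only additive. Proving vanishing on
      -- all multiples `b • t` at once makes the induction over the span closed under scalars.
      have key : ∀ b : Bᵐᵒᵖ, TensorProduct.liftAddHom f.flip (fun (r : ℤ) p m => by simp)
          (b • t) = 0 := by
        refine Submodule.span_induction (p := fun t _ => ∀ b : Bᵐᵒᵖ,
          TensorProduct.liftAddHom f.flip (fun (r : ℤ) p m => by simp) (b • t) = 0)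
          ?_ ?_ ?_ ?_ ht
        · rintro _ ⟨a, m, p, rfl⟩ b
          rw [smul_sub, TensorProduct.smul_tmul', TensorProduct.smul_tmul', map_sub,
            TensorProduct.liftAddHom_tmul, TensorProduct.liftAddHom_tmul, sub_eq_zero,
            AddMonoidHom.flip_apply, AddMonoidHom.flip_apply, hf, smul_comm]
        · intro b; simp
        · intro s t _ _ hs ht b
          rw [smul_add, map_add, hs, ht, add_zero]
        · intro c s _ hs b
          rw [← mul_smul]; exact hs _
      simpa using key 1)

end BimodTensor

/-! ### Hermitian forms inducing a Morita context -/

namespace AdmittingForm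

variable {S : Type*} {A : Type u} {B : Type u} [CommRing S] [Ring A] [Ring B]
variable [Algebra S A] [Algebra S B] {σ : RingInvo A} {τ : RingInvo B} {δ : S}

/-- The Morita context attached to a nonsingular form `ϑ`: a form `η` on `P` with values in `A`
such that `η (p, q) r = p ϑ (q, r)`, and presentations of `1` by values of `η` and `ϑ`. -/
structure MoritaData (Θ : AdmittingForm.{u, u, v} S σ τ (algebraMap S B δ)) where
  η : Θ.carrier →+ Θ.carrier →+ A
  η_smul : ∀ p q r, η p q • r = op (Θ.form.toHom q r) • p
  faithful : ∀ a b : A, (∀ r : Θ.carrier, a • r = b • r) → a = b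
  nondeg : ∀ p q : Θ.carrier, (∀ r, Θ.form.toHom r p = Θ.form.toHom r q) → p = q
  m : ℕ
  p : Fin m → Θ.carrier
  p' : Fin m → Θ.carrier
  sum_η : ∑ i, η (p i) (p' i) = 1
  n : ℕ
  q : Fin n → Θ.carrier
  q' : Fin n → Θ.carrier
  sum_form : ∑ j, Θ.form.toHom (q j) (q' j) = 1

namespace MoritaData

variable {Θ : AdmittingForm.{u, u, v} S σ τ (algebraMap S B δ)} (D : MoritaData Θ)

/-- Identities between elements of `A` are checked on `P`, where `A` acts faithfully and `η` is
expressed through `ϑ`. -/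
theorem η_smul_left (a : A) (p q : Θ.carrier) : D.η (a • p) q = a * D.η p q :=
  D.faithful _ _ fun r => by rw [mul_smul, D.η_smul, D.η_smul, ← smul_comm]

theorem form_smul_left (a : A) (p q : Θ.carrier) :
    Θ.form.toHom (a • p) q = Θ.form.toHom p ((σ a).unop • q) := by
  rw [← Θ.admits, σ.involution]

theorem form_smul_right (b : B) (p q : Θ.carrier) :
    Θ.form.toHom p (op b • q) = Θ.form.toHom p q * b := by
  rw [map_smul, op_smul_eq_mul]

theorem η_smul_right (a : A) (p q : Θ.carrier) : D.η p (a • q) = D.η p q * (σ a).unop :=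
  D.faithful _ _ fun r => by rw [mul_smul, D.η_smul, D.η_smul, form_smul_left]

theorem η_op_smul_left (b : B) (p q : Θ.carrier) :
    D.η (op b • p) q = D.η p (op (τ b).unop • q) :=
  D.faithful _ _ fun r => by
    rw [D.η_smul, D.η_smul, Θ.form.smul_left, τ.involution, op_mul, mul_smul]

include D in
theorem sum_smul_form (x : Θ.carrier) : ∑ j, D.η x (D.q j) • D.q' j = x := by
  simp_rw [D.η_smul]
  rw [← Finset.sum_smul, ← Finset.op_sum, D.sum_form, op_one, one_smul]

section

variable (hδ : δ * δ = 1)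
include hδ

theorem form_symm (p q : Θ.carrier) :
    (τ (Θ.form.toHom p q)).unop = algebraMap S B δ * Θ.form.toHom q p := by
  rw [Θ.form.symm q p, ← mul_assoc, ← map_mul, hδ, map_one, one_mul]

/-- Tested under `ϑ`: `ϑ(x, σ(η(p, q)) y) = ϑ(p ϑ(q, x), y) = δ ϑ(x, q) ϑ(p, y)`, and the last
expression is `δ ϑ(x, η(q, p) y)`. -/
theorem η_symm (p q : Θ.carrier) :
    (σ (D.η p q)).unop = algebraMap S A δ * D.η q p := by
  refine D.faithful _ _ fun y => D.nondeg _ _ fun x => ?_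
  rw [← form_smul_left, D.η_smul, Θ.form.smul_left, form_symm hδ, mul_smul, D.η_smul, Θ.central,
    form_smul_right, form_smul_right, mul_assoc, Algebra.commutes δ]

end

/-- The pairing `κ (m ⊗ p, q) = m η (p, q)`. -/
noncomputable def contract (M : Type w) [AddCommGroup M] [Module Aᵐᵒᵖ M] :
    BimodTensor A B M Θ.carrier →+ Θ.carrier →+ M :=
  BimodTensor.liftAdd
    (AddMonoidHom.mk' (fun m => AddMonoidHom.mk' (fun p => AddMonoidHom.mk'
        (fun q => op (D.η p q) • m)
        (fun q q' => by rw [map_add, MulOpposite.op_add, add_smul]))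
      (fun p p' => by ext q; simp [add_smul]))
      (fun m m' => by ext p q; simp))
    (fun a m p => by
      ext q
      simp [η_smul_left, mul_smul])

@[simp]
theorem contract_tmul {M : Type w} [AddCommGroup M] [Module Aᵐᵒᵖ M] (m : M) (p q : Θ.carrier) :
    D.contract M (BimodTensor.tmul A B m p) q = op (D.η p q) • m := rfl

variable {M : Type w} [AddCommGroup M] [Module Aᵐᵒᵖ M]

/-- This is `η(p, q) r = p ϑ(q, r)` read inside the tensor product. Since `1` is a sum of values of
`ϑ`, it recovers a tensor from its contractions. -/
theorem contract_tmul_eq (t : BimodTensor A B M Θ.carrier) (q r : Θ.carrier) :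
    BimodTensor.tmul A B (D.contract M t q) r = op (Θ.form.toHom q r) • t := by
  induction t using BimodTensor.induction with
  | zero => simp [BimodTensor.zero_tmul]
  | add s t hs ht => rw [map_add, AddMonoidHom.add_apply, BimodTensor.add_tmul, hs, ht, smul_add]
  | tmul m p => rw [contract_tmul, BimodTensor.smul_tmul, D.η_smul, BimodTensor.tmul_smul]

theorem eq_sum_contract (t : BimodTensor A B M Θ.carrier) :
    ∑ j, BimodTensor.tmul A B (D.contract M t (D.q j)) (D.q' j) = t := by
  simp_rw [contract_tmul_eq]
  rw [← Finset.sum_smul, ← Finset.op_sum, D.sum_form, op_one, one_smul]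

-- An element `m` is the sum of the contractions of `m ⊗ pᵢ` with `p'ᵢ`, because the elements `η(pᵢ,
-- p'ᵢ)` sum to `1`.
include D in
theorem eq_of_forall_tmul_eq {m m' : M}
    (h : ∀ p : Θ.carrier, BimodTensor.tmul A B m p = BimodTensor.tmul A B m' p) : m = m' := by
  have h1 : ∀ m : M, ∑ i, D.contract M (BimodTensor.tmul A B m (D.p i)) (D.p' i) = m := fun m => by
    simp_rw [contract_tmul]
    rw [← Finset.sum_smul, ← Finset.op_sum, D.sum_η, op_one, one_smul]
  rw [← h1 m, ← h1 m']
  simp_rw [h]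

include D in
/-- Every `B`-linear map `M ⊗_A P → M' ⊗_A P` comes from an `A`-linear map `M → M'`. -/
theorem exists_map_eq {M' : Type w} [AddCommGroup M'] [Module Aᵐᵒᵖ M']
    (G : BimodTensor A B M Θ.carrier →ₗ[Bᵐᵒᵖ] BimodTensor A B M' Θ.carrier) :
    ∃ f : M →ₗ[Aᵐᵒᵖ] M', BimodTensor.map f = G := by
  -- The only possible choice: contracting `f m ⊗ pᵢ = G (m ⊗ pᵢ)` with `p'ᵢ` and summing returns `f
  -- m`.
  let f₀ : M → M' := fun m =>
    ∑ i, D.contract M' (G (BimodTensor.tmul A B m (D.p i))) (D.p' i)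
  have hf₀ : ∀ m p, BimodTensor.tmul A B (f₀ m) p = G (BimodTensor.tmul A B m p) := fun m p => by
    simp only [f₀]
    rw [BimodTensor.sum_tmul]
    simp_rw [contract_tmul_eq, ← map_smul, ← BimodTensor.tmul_smul]
    rw [← map_sum, ← BimodTensor.tmul_sum]
    congr 2
    simp_rw [← D.η_smul]
    rw [← Finset.sum_smul, D.sum_η, one_smul]
  refine ⟨{ toFun := f₀, map_add' := fun m m' => ?_, map_smul' := fun a m => ?_ },
    BimodTensor.hom_ext fun m p => ?_⟩
  · refine D.eq_of_forall_tmul_eq fun p => ?_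
    rw [hf₀, BimodTensor.add_tmul, map_add, BimodTensor.add_tmul, hf₀, hf₀]
  · refine D.eq_of_forall_tmul_eq fun p => ?_
    rw [hf₀, ← op_unop a, BimodTensor.smul_tmul, RingHom.id_apply, BimodTensor.smul_tmul, hf₀]
  · exact hf₀ m p

include D in
theorem faithful_functor (ε : S) : (Θ.functor ε).Faithful where
  map_injective {X Y f g} h := by
    refine Herm.Isometry.ext (LinearEquiv.ext fun m => D.eq_of_forall_tmul_eq fun p => ?_)
    exact congrArg (fun k => Herm.Isometry.toEquiv k (BimodTensor.tmul A B m p)) h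

-- An isometry and its inverse both descend to `A`-linear maps, and these are mutually inverse
-- because they are so after tensoring with `P`.
include D in
theorem full_functor (ε : S) : (Θ.functor ε).Full where
  map_surjective {X Y} g := by
    obtain ⟨f, hf⟩ := D.exists_map_eq (M := X.carrier) (M' := Y.carrier) g.toEquiv.toLinearMap
    obtain ⟨f', hf'⟩ := D.exists_map_eq (M := Y.carrier) (M' := X.carrier)
      g.toEquiv.symm.toLinearMap
    have h1 : ∀ m p, BimodTensor.tmul A B (f m) p = g.toEquiv (BimodTensor.tmul A B m p) :=
      fun m p => LinearMap.congr_fun hf (BimodTensor.tmul A B m p)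
    have h2 : ∀ m p, BimodTensor.tmul A B (f' m) p = g.toEquiv.symm (BimodTensor.tmul A B m p) :=
      fun m p => LinearMap.congr_fun hf' (BimodTensor.tmul A B m p)
    let e : X.carrier ≃ₗ[Aᵐᵒᵖ] Y.carrier := LinearEquiv.ofLinearMap f f'
      (LinearMap.ext fun m => D.eq_of_forall_tmul_eq fun p => by
        rw [LinearMap.comp_apply, h1, h2]
        exact g.toEquiv.apply_symm_apply _)
      (LinearMap.ext fun m => D.eq_of_forall_tmul_eq fun p => by
        rw [LinearMap.comp_apply, h2, h1]
        exact g.toEquiv.symm_apply_apply _)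
    -- Faithfulness of `A` on `P` and nondegeneracy of `ϑ` recover `h` from `ϑ • h`.
    refine ⟨⟨e, fun x y => D.faithful _ _ fun r => D.nondeg _ _ fun s => ?_⟩, ?_⟩
    · have h3 := g.map_form (BimodTensor.tmul A B x s) (BimodTensor.tmul A B y r)
      rw [← h1, ← h1] at h3
      exact h3
    · exact Herm.Isometry.ext (LinearEquiv.toLinearMap_injective
        (BimodTensor.hom_ext fun m p => h1 m p))

end MoritaData

end AdmittingForm

/-! ### The pairing on `M ⊗_A P` induced by a sesquilinear pairing -/

namespace AdmittingForm

variable {S : Type*} {A : Type u} {B : Type u} [CommRing S] [Ring A] [Ring B]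
variable [Algebra S A] [Algebra S B] {σ : RingInvo A} {τ : RingInvo B} {δ : S}

section Pairing

variable (Θ : AdmittingForm.{u, u, v} S σ τ (algebraMap S B δ))
variable {M : Type w} [AddCommGroup M] [Module Aᵐᵒᵖ M]
variable {M' : Type v} [AddCommGroup M'] [Module Aᵐᵒᵖ M']
variable (H : M →ₗ[Aᵐᵒᵖ] HermDual σ M')

/-- For fixed `m`, `p`, the map `m' ⊗ q ↦ ϑ (p, H (m) (m') q)`. -/
noncomputable def pairingAux (m : M) (p : Θ.carrier) :
    BimodTensor A B M' Θ.carrier →ₗ[Bᵐᵒᵖ] B :=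
  BimodTensor.lift
    (AddMonoidHom.mk' (fun m' => (Θ.form.toHom p).comp
        (DistribSMul.toLinearMap Bᵐᵒᵖ Θ.carrier (H m m')))
      (fun m' m'' => LinearMap.ext fun q => by
        have h : H m (m' + m'') = H m m' + H m m'' :=
          LinearMap.map_add (H m : M' →ₗ[Aᵐᵒᵖ] A) m' m''
        change Θ.form.toHom p (H m (m' + m'') • q) =
          Θ.form.toHom p (H m m' • q) + Θ.form.toHom p (H m m'' • q)
        rw [h, add_smul, map_add]))
    (fun a m' q => by
      have h : H m (op a • m') = H m m' * a :=
        LinearMap.map_smul (H m : M' →ₗ[Aᵐᵒᵖ] A) (op a) m'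
      change Θ.form.toHom p (H m (op a • m') • q) = Θ.form.toHom p (H m m' • (a • q))
      rw [h, mul_smul])

theorem pairingAux_tmul (m : M) (m' : M') (p q : Θ.carrier) :
    Θ.pairingAux H m p (BimodTensor.tmul A B m' q) = Θ.form.toHom p (H m m' • q) := rfl

theorem pairingAux_smul (b : B) (m : M) (p : Θ.carrier) (t : BimodTensor A B M' Θ.carrier) :
    Θ.pairingAux H m (op b • p) t = (τ b).unop * Θ.pairingAux H m p t := by
  induction t using BimodTensor.induction with
  | zero => simp
  | tmul m' q => exact Θ.form.smul_left b p _
  | add s t hs ht => simp only [map_add, mul_add, hs, ht]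

/-- The pairing `(m ⊗ p, m' ⊗ q) ↦ ϑ (p, H (m) (m') q)`. -/
noncomputable def pairing : BimodTensor A B M Θ.carrier →ₗ[Bᵐᵒᵖ]
    HermDual τ (BimodTensor A B M' Θ.carrier) :=
  BimodTensor.lift
    (AddMonoidHom.mk' (fun m =>
        ({ toFun := fun p => Θ.pairingAux H m p
           map_add' := fun p q => BimodTensor.hom_ext (f := Θ.pairingAux H m (p + q))
             (g := Θ.pairingAux H m p + Θ.pairingAux H m q) fun m' r => by
               simp only [pairingAux_tmul, map_add, LinearMap.add_apply]
           map_smul' := fun b p => LinearMap.ext fun t =>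
             (Θ.pairingAux_smul H b.unop m p t).trans
               (HermDual.smul_apply τ b.unop (Θ.pairingAux H m p) t).symm } :
          Θ.carrier →ₗ[Bᵐᵒᵖ] HermDual τ (BimodTensor A B M' Θ.carrier)))
      (fun m n => LinearMap.ext fun p => BimodTensor.hom_ext
        (f := Θ.pairingAux H (m + n) p) (g := Θ.pairingAux H m p + Θ.pairingAux H n p)
        fun m' r => by
          have h : H (m + n) m' = H m m' + H n m' := by rw [map_add]; rfl
          rw [LinearMap.add_apply, pairingAux_tmul, pairingAux_tmul, pairingAux_tmul, h, add_smul,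
            map_add]))
    (fun a m p => BimodTensor.hom_ext (f := Θ.pairingAux H (op a • m) p)
      (g := Θ.pairingAux H m (a • p)) fun m' q => by
        have := Θ.admits (σ a).unop p (H m m' • q)
        rw [σ.involution] at this
        rw [pairingAux_tmul, pairingAux_tmul, H.map_smul, HermDual.smul_apply, mul_smul, this])

theorem pairing_tmul (m : M) (m' : M') (p q : Θ.carrier) :
    Θ.pairing H (BimodTensor.tmul A B m p) (BimodTensor.tmul A B m' q) =
      Θ.form.toHom p (H m m' • q) := rfl

end Pairing

end AdmittingForm

/-! ### Perfect pairings, and preservation of nonsingular forms, orthogonal sums and hyperbolic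
forms -/

theorem HermDual.add_apply {A : Type u} [Ring A] {σ : RingInvo A} {M : Type v} [AddCommGroup M]
    [Module Aᵐᵒᵖ M] (f g : HermDual σ M) (x : M) : (f + g) x = f x + g x := rfl

theorem HermDual.zero_apply {A : Type u} [Ring A] {σ : RingInvo A} {M : Type v} [AddCommGroup M]
    [Module Aᵐᵒᵖ M] (x : M) : (0 : HermDual σ M) x = 0 := rfl

theorem HermDual.map_add {A : Type u} [Ring A] {σ : RingInvo A} {M : Type v} [AddCommGroup M]
    [Module Aᵐᵒᵖ M] (f : HermDual σ M) (x y : M) : f (x + y) = f x + f y :=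
  LinearMap.map_add (f : M →ₗ[Aᵐᵒᵖ] A) x y

theorem HermDual.map_zero {A : Type u} [Ring A] {σ : RingInvo A} {M : Type v} [AddCommGroup M]
    [Module Aᵐᵒᵖ M] (f : HermDual σ M) : f 0 = 0 :=
  LinearMap.map_zero (f : M →ₗ[Aᵐᵒᵖ] A)

theorem HermDual.map_smul {A : Type u} [Ring A] {σ : RingInvo A} {M : Type v} [AddCommGroup M]
    [Module Aᵐᵒᵖ M] (f : HermDual σ M) (a : A) (x : M) : f (op a • x) = f x * a :=
  LinearMap.map_smul (f : M →ₗ[Aᵐᵒᵖ] A) (op a) x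

/-- The adjoint map of a hermitian form, as a linear map into the dual. -/
def HermForm.adjoint {A : Type u} [Ring A] {σ : RingInvo A} {ε : A} {M : Type v} [AddCommGroup M]
    [Module Aᵐᵒᵖ M] (h : HermForm σ ε M) : M →ₗ[Aᵐᵒᵖ] HermDual σ M where
  toFun m := h.toHom m
  map_add' m n := h.toHom.map_add m n
  map_smul' a m := LinearMap.ext fun x => (h.smul_left a.unop m x).trans
    (HermDual.smul_apply σ a.unop (h.toHom m) x).symm

/-- The dual, as a pairing with the module. -/
def HermDual.eval {A : Type u} [Ring A] (σ : RingInvo A) (M : Type v) [AddCommGroup M]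
    [Module Aᵐᵒᵖ M] : HermDual σ M →ₗ[Aᵐᵒᵖ] HermDual σ M := LinearMap.id

namespace AdmittingForm

variable {S : Type*} {A : Type u} {B : Type u} [CommRing S] [Ring A] [Ring B]
variable [Algebra S A] [Algebra S B] {σ : RingInvo A} {τ : RingInvo B} {δ : S}

namespace MoritaData

variable {Θ : AdmittingForm.{u, u, v} S σ τ (algebraMap S B δ)} (D : MoritaData Θ)

section Perfect

variable (hδ : δ * δ = 1)
variable {M : Type w} [AddCommGroup M] [Module Aᵐᵒᵖ M]
variable {M' : Type v} [AddCommGroup M'] [Module Aᵐᵒᵖ M']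
variable (H : M →ₗ[Aᵐᵒᵖ] HermDual σ M')

include hδ

/-- On pure tensors this is the symmetry of `η`. It expresses `H` through the induced pairing, and
so serves both for injectivity and for finding preimages. -/
theorem pairing_contract (x : BimodTensor A B M Θ.carrier) (q : Θ.carrier) (m' : M')
    (p' : Θ.carrier) : H (D.contract M x q) m' • p' =
      op (algebraMap S B δ * Θ.pairing H x (BimodTensor.tmul A B m' p')) • q := by
  induction x using BimodTensor.induction with
  | zero =>
    simp [HermDual.zero_apply]
  | add s t hs ht =>
    rw [_root_.map_add, AddMonoidHom.add_apply, _root_.map_add, HermDual.add_apply, add_smul, hs,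
      ht, _root_.map_add, HermDual.add_apply, mul_add, MulOpposite.op_add, add_smul]
  | tmul m p =>
    rw [contract_tmul, _root_.map_smul, HermDual.smul_apply, Θ.pairing_tmul, D.η_symm hδ, mul_smul,
      mul_smul, D.η_smul, Θ.central, ← mul_smul, ← op_mul, Algebra.commutes]

include D

/-- A perfect pairing induces a perfect pairing. -/
theorem pairing_bijective (hH : Function.Bijective H) :
    Function.Bijective (Θ.pairing H) := by
  constructor
  · refine (injective_iff_map_eq_zero _).2 fun x hx => ?_
    -- If `x` pairs to zero with everything, all its contractions are killed by `H`, hence vanish,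
    -- and `x` is rebuilt from them.
    have h1 : ∀ q, D.contract M x q = 0 := fun q => by
      refine (injective_iff_map_eq_zero H).1 hH.1 _ (LinearMap.ext fun m' => ?_)
      refine D.faithful _ _ fun p' => (D.pairing_contract hδ H x q m' p').trans ?_
      rw [hx, HermDual.zero_apply, mul_zero, op_zero, zero_smul]
      exact (zero_smul A p').symm
    rw [← D.eq_sum_contract x]
    simp_rw [h1, BimodTensor.zero_tmul, Finset.sum_const_zero]
  · intro F
    -- `g₀ q m'` is the element of `A` acting on `P` as `p' ↦ q δ F(m' ⊗ p')`. By
    -- `pairing_contract`, the contraction of any preimage of `F` with `q` must have this functional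
    -- as its image under `H`.
    let g₀ : Θ.carrier → M' → A := fun q m' =>
      ∑ i, D.η (op (algebraMap S B δ * F (BimodTensor.tmul A B m' (D.p i))) • q) (D.p' i)
    have hg₀ : ∀ q m' p', g₀ q m' • p' =
        op (algebraMap S B δ * F (BimodTensor.tmul A B m' p')) • q := by
      intro q m' p'
      have h1 : ∀ i, D.η (op (algebraMap S B δ * F (BimodTensor.tmul A B m' (D.p i))) • q)
          (D.p' i) • p' = op (algebraMap S B δ *
            F (BimodTensor.tmul A B m' (D.η (D.p i) (D.p' i) • p'))) • q := fun i => by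
        rw [D.η_smul, D.η_smul, BimodTensor.tmul_smul, HermDual.map_smul, ← mul_smul, ← op_mul,
          mul_assoc]
      simp only [g₀, Finset.sum_smul, h1]
      let Φ : Θ.carrier →+ Θ.carrier := AddMonoidHom.mk'
        (fun y => op (algebraMap S B δ * F (BimodTensor.tmul A B m' y)) • q) (fun y z => by
          rw [BimodTensor.tmul_add, HermDual.map_add, mul_add, MulOpposite.op_add, add_smul])
      have h2 : ∑ i, Φ (D.η (D.p i) (D.p' i) • p') = Φ p' := by
        rw [← map_sum, ← Finset.sum_smul, D.sum_η, one_smul]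
      exact h2
    have hg : ∀ q, ∃ m, ∀ m', H m m' = g₀ q m' := by
      intro q
      obtain ⟨m, hm⟩ := hH.2 (show HermDual σ M' from
        { toFun := g₀ q
          map_add' := fun m' m'' => D.faithful _ _ fun r => by
            rw [add_smul, hg₀, hg₀, hg₀, BimodTensor.add_tmul, HermDual.map_add, mul_add,
              MulOpposite.op_add, add_smul]
          map_smul' := fun a m' => D.faithful _ _ fun r => by
            rw [hg₀, ← op_unop a, BimodTensor.smul_tmul, RingHom.id_apply, op_smul_eq_mul,
              mul_smul, hg₀] })
      exact ⟨m, fun m' => by rw [hm]; rfl⟩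
    choose μ hμ using hg
    refine ⟨∑ j, BimodTensor.tmul A B (μ (D.q j)) (D.q' j), ?_⟩
    refine BimodTensor.hom_ext
      (f := (Θ.pairing H (∑ j, BimodTensor.tmul A B (μ (D.q j)) (D.q' j)) :
        BimodTensor A B M' Θ.carrier →ₗ[Bᵐᵒᵖ] B))
      (g := (F : BimodTensor A B M' Θ.carrier →ₗ[Bᵐᵒᵖ] B)) fun m' p' => ?_
    let ev : HermDual τ (BimodTensor A B M' Θ.carrier) →+ B :=
      AddMonoidHom.mk' (fun f => f (BimodTensor.tmul A B m' p')) fun f g => rfl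
    change ev (Θ.pairing H (∑ j, BimodTensor.tmul A B (μ (D.q j)) (D.q' j))) = ev F
    rw [map_sum, map_sum]
    change ∑ j, Θ.form.toHom (D.q' j) (H (μ (D.q j)) m' • p') = ev F
    -- Each coefficient becomes `τ(ϑ(qⱼ, q'ⱼ))`, and these sum to `τ 1 = 1`.
    simp_rw [hμ, hg₀, form_smul_right, ← mul_assoc, ← Algebra.commutes δ, ← form_symm hδ]
    rw [← Finset.sum_mul, ← Finset.unop_sum, ← map_sum, D.sum_form, map_one, unop_one, one_mul]
    rfl

end Perfect

section Functor

variable (hδ : δ * δ = 1) {ε : S}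
include D hδ

theorem nonsingular_functor (X : Herm.{u, v} σ (algebraMap S A ε)) (hX : X.Nonsingular) :
    ((Θ.functor ε).obj X).Nonsingular := by
  have h := D.pairing_bijective hδ X.form.adjoint hX
  have h2 : (Θ.pairing X.form.adjoint).toAddMonoidHom = (Θ.prod X.form).adjoint.toAddMonoidHom :=
    BimodTensor.addHom_ext fun m p => BimodTensor.hom_ext
      (f := (Θ.pairing X.form.adjoint (BimodTensor.tmul A B m p) :
        BimodTensor A B X.carrier Θ.carrier →ₗ[Bᵐᵒᵖ] B)) fun m' p' => rfl
  have h3 : ⇑(Θ.pairing X.form.adjoint) = ⇑(Θ.prod X.form).toHom :=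
    funext fun x => DFunLike.congr_fun h2 x
  rw [h3] at h
  exact h

end Functor

end MoritaData

/-- The canonical isomorphism `(M × N) ⊗_A P ≅ (M ⊗_A P) × (N ⊗_A P)`. -/
noncomputable def _root_.BimodTensor.prodEquiv (A B : Type*) [Ring A] [Ring B] (M N : Type*)
    [AddCommGroup M] [Module Aᵐᵒᵖ M] [AddCommGroup N] [Module Aᵐᵒᵖ N] (P : Type*)
    [AddCommGroup P] [Module A P] [Module Bᵐᵒᵖ P] [SMulCommClass A Bᵐᵒᵖ P] :
    BimodTensor A B (M × N) P ≃ₗ[Bᵐᵒᵖ] BimodTensor A B M P × BimodTensor A B N P :=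
  LinearEquiv.ofLinearMap
    ((BimodTensor.map (LinearMap.fst Aᵐᵒᵖ M N)).prod (BimodTensor.map (LinearMap.snd Aᵐᵒᵖ M N)))
    ((BimodTensor.map (LinearMap.inl Aᵐᵒᵖ M N)).coprod (BimodTensor.map (LinearMap.inr Aᵐᵒᵖ M N)))
    (by
      refine LinearMap.prod_ext (BimodTensor.hom_ext fun m p => ?_)
        (BimodTensor.hom_ext fun m p => ?_)
      · simp [BimodTensor.zero_tmul]
      · simp [BimodTensor.zero_tmul])
    (BimodTensor.hom_ext fun m p => by simp [← BimodTensor.add_tmul])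

theorem _root_.BimodTensor.prodEquiv_tmul (A B : Type*) [Ring A] [Ring B] {M N : Type*}
    [AddCommGroup M] [Module Aᵐᵒᵖ M] [AddCommGroup N] [Module Aᵐᵒᵖ N] {P : Type*}
    [AddCommGroup P] [Module A P] [Module Bᵐᵒᵖ P] [SMulCommClass A Bᵐᵒᵖ P] (x : M) (y : N) (p : P) :
    BimodTensor.prodEquiv A B M N P (BimodTensor.tmul A B (x, y) p) =
      (BimodTensor.tmul A B x p, BimodTensor.tmul A B y p) := rfl

theorem prod_of_orthogonal (Θ : AdmittingForm.{u, u, v} S σ τ (algebraMap S B δ)) {ε : S}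
    {M N : Type v} [AddCommGroup M] [Module Aᵐᵒᵖ M] [AddCommGroup N] [Module Aᵐᵒᵖ N]
    (h : HermForm σ (algebraMap S A ε) (M × N)) (h₁ : HermForm σ (algebraMap S A ε) M)
    (h₂ : HermForm σ (algebraMap S A ε) N)
    (hh : ∀ x y, h.toHom x y = h₁.toHom x.1 y.1 + h₂.toHom x.2 y.2)
    (x y : BimodTensor A B (M × N) Θ.carrier) :
    (Θ.prod h₁).toHom (BimodTensor.prodEquiv A B M N Θ.carrier x).1
        (BimodTensor.prodEquiv A B M N Θ.carrier y).1 +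
      (Θ.prod h₂).toHom (BimodTensor.prodEquiv A B M N Θ.carrier x).2
        (BimodTensor.prodEquiv A B M N Θ.carrier y).2 = (Θ.prod h).toHom x y := by
  induction x using BimodTensor.induction with
  | zero => simp only [map_zero, Prod.fst_zero, Prod.snd_zero, LinearMap.zero_apply, add_zero]
  | add s t hs ht =>
    simp only [map_add, Prod.fst_add, Prod.snd_add, LinearMap.add_apply, ← hs, ← ht]
    abel
  | tmul m p =>
    induction y using BimodTensor.induction with
    | zero => simp only [map_zero, Prod.fst_zero, Prod.snd_zero, add_zero]
    | add s t hs ht =>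
      simp only [map_add, Prod.fst_add, Prod.snd_add, ← hs, ← ht]
      abel
    | tmul m' q =>
      obtain ⟨m₁, m₂⟩ := m
      obtain ⟨n₁, n₂⟩ := m'
      rw [BimodTensor.prodEquiv_tmul, BimodTensor.prodEquiv_tmul, Θ.prod_tmul, Θ.prod_tmul,
        Θ.prod_tmul, hh, add_smul, map_add]

theorem orthSum_functor (Θ : AdmittingForm.{u, u, v} S σ τ (algebraMap S B δ)) {ε : S}
    (X Y : Herm.{u, v} σ (algebraMap S A ε)) :
    ∃ i : Herm.Isometry ((Θ.functor ε).obj (X.orthSum Y))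
        (((Θ.functor ε).obj X).orthSum ((Θ.functor ε).obj Y)),
      ∀ (x : X.carrier) (y : Y.carrier) (p : Θ.carrier),
        i.toEquiv (BimodTensor.tmul A B ((x, y) : X.carrier × Y.carrier) p) =
          ((BimodTensor.tmul A B x p, BimodTensor.tmul A B y p) :
            BimodTensor A B X.carrier Θ.carrier × BimodTensor A B Y.carrier Θ.carrier) :=
  ⟨⟨BimodTensor.prodEquiv A B X.carrier Y.carrier Θ.carrier,
    Θ.prod_of_orthogonal (X.orthSum Y).form X.form Y.form fun _ _ => rfl⟩, fun _ _ _ => rfl⟩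

namespace MoritaData

variable {Θ : AdmittingForm.{u, u, v} S σ τ (algebraMap S B δ)} (D : MoritaData Θ)
variable (hδ : δ * δ = 1) {ε : S}
include D hδ

/-- The evaluation pairing of `U^*` with `U` is perfect, so it induces `U^* ⊗ P ≅ (U ⊗ P)^*`. This
isomorphism turns the product form into the standard hyperbolic form on `U ⊗ P`. -/
theorem hyperbolic_functor (X : Herm.{u, v} σ (algebraMap S A ε)) (hX : X.IsHyperbolic) :
    ((Θ.functor ε).obj X).IsHyperbolic := by
  obtain ⟨U, _, _, hfin, hproj, e, he⟩ := hX
  let E : BimodTensor A B (HermDual σ U) Θ.carrier ≃ₗ[Bᵐᵒᵖ]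
      HermDual τ (BimodTensor A B U Θ.carrier) :=
    LinearEquiv.ofBijective (Θ.pairing (HermDual.eval σ U))
      (D.pairing_bijective hδ _ Function.bijective_id)
  let e' : BimodTensor A B X.carrier Θ.carrier ≃ₗ[Bᵐᵒᵖ]
      BimodTensor A B U Θ.carrier × HermDual τ (BimodTensor A B U Θ.carrier) :=
    BimodTensor.mapEquiv e ≪≫ₗ BimodTensor.prodEquiv A B U (HermDual σ U) Θ.carrier ≪≫ₗ
      (LinearEquiv.refl _ _).prodCongr E
  have he' : ∀ x p, e' (BimodTensor.tmul A B x p) = (BimodTensor.tmul A B (e x).1 p,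
      Θ.pairing (HermDual.eval σ U) (BimodTensor.tmul A B (e x).2 p)) := fun x p => rfl
  refine ⟨BimodTensor A B U Θ.carrier, inferInstance, inferInstance, inferInstance, inferInstance,
    e', fun x y => ?_⟩
  suffices key : ∀ x y : BimodTensor A B X.carrier Θ.carrier,
      (Θ.prod X.form).toHom x y = (e' x).2 (e' y).1 +
        algebraMap S B (δ * ε) * (τ ((e' y).2 (e' x).1)).unop from key x y
  clear x y
  intro x y
  induction x using BimodTensor.induction with
  | zero =>
    simp only [_root_.map_zero, Prod.snd_zero, Prod.fst_zero, HermDual.zero_apply,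
      HermDual.map_zero, LinearMap.zero_apply, unop_zero, mul_zero, add_zero]
  | add s t hs ht =>
    simp only [_root_.map_add, LinearMap.add_apply, hs, ht, Prod.snd_add, Prod.fst_add,
      HermDual.add_apply, HermDual.map_add, MulOpposite.unop_add, mul_add]
    abel
  | tmul m p =>
    induction y using BimodTensor.induction with
    | zero =>
      simp only [_root_.map_zero, Prod.snd_zero, Prod.fst_zero, HermDual.zero_apply,
        HermDual.map_zero, unop_zero, mul_zero, add_zero]
    | add s t hs ht =>
      simp only [_root_.map_add, hs, ht, Prod.snd_add, Prod.fst_add,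
        HermDual.add_apply, HermDual.map_add, MulOpposite.unop_add, mul_add]
      abel
    | tmul m' q =>
      rw [he', he', Θ.prod_tmul, Θ.pairing_tmul, Θ.pairing_tmul, he, add_smul, _root_.map_add]
      congr 1
      -- Moving `σ` across `ϑ` and reversing the arguments of `ϑ` costs a factor `δ`; it cancels the
      -- one in `δ * ε`.
      change Θ.form.toHom p ((algebraMap S A ε * (σ ((e m').2 (e m).1)).unop) • q) =
        algebraMap S B (δ * ε) * (τ (Θ.form.toHom q ((e m').2 (e m).1 • p))).unop
      rw [form_symm hδ, form_smul_left, ← mul_assoc, ← map_mul, mul_smul, Θ.central,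
        form_smul_right, show δ * ε * δ = ε by rw [mul_right_comm, hδ, one_mul], ← Algebra.commutes]

end MoritaData

end AdmittingForm

/-! ### The inverse functor -/

/-- Transport of a hermitian form along an equality of signs. -/
def HermForm.ofEq {A : Type u} [Ring A] {σ : RingInvo A} {ε ε' : A} (h : ε = ε') {M : Type v}
    [AddCommGroup M] [Module Aᵐᵒᵖ M] (f : HermForm σ ε M) : HermForm σ ε' M where
  toHom := f.toHom
  smul_left := f.smul_left
  symm := h ▸ f.symm

/-- An isometry is an isomorphism in the category of hermitian modules. -/
def Herm.Isometry.toIso {A : Type u} [Ring A] {σ : RingInvo A} {ε : A} {X Y : Herm.{u, v} σ ε}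
    (f : Herm.Isometry X Y) : X ≅ Y where
  hom := f
  inv := ⟨f.toEquiv.symm, fun x y => by
    rw [← f.map_form, LinearEquiv.apply_symm_apply, LinearEquiv.apply_symm_apply]⟩
  hom_inv_id := Herm.Isometry.ext (LinearEquiv.self_trans_symm _)
  inv_hom_id := Herm.Isometry.ext (LinearEquiv.symm_trans_self _)

namespace AdmittingForm

variable {S : Type*} {A : Type u} {B : Type u} [CommRing S] [Ring A] [Ring B]
variable [Algebra S A] [Algebra S B] {σ : RingInvo A} {τ : RingInvo B} {δ : S}

/-- The bimodule `P` with the roles of `A` and `B` exchanged through the involutions. -/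
def Conj (Θ : AdmittingForm.{u, u, v} S σ τ (algebraMap S B δ)) : Type v := Θ.carrier

namespace Conj

variable {Θ : AdmittingForm.{u, u, v} S σ τ (algebraMap S B δ)}

instance : AddCommGroup (Conj Θ) := inferInstanceAs (AddCommGroup Θ.carrier)

instance : Module B (Conj Θ) := Module.compHom Θ.carrier (τ.toRingEquiv : B →+* Bᵐᵒᵖ)

instance : Module Aᵐᵒᵖ (Conj Θ) := Module.compHom Θ.carrier (σ.toRingEquiv.symm : Aᵐᵒᵖ →+* A)

/-- The identity map from `P` to its conjugate. -/
def mk : Θ.carrier ≃+ Conj Θ := AddEquiv.refl _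

theorem smul_mk (b : B) (p : Θ.carrier) : b • mk p = mk (op (τ b).unop • p) := rfl

theorem op_smul_mk (a : A) (p : Θ.carrier) : op a • mk p = mk ((σ a).unop • p) := by
  have h : σ.toRingEquiv.symm (op a) = (σ a).unop := by
    rw [RingEquiv.symm_apply_eq]
    exact unop_injective (σ.involution a).symm
  rw [← h]
  rfl

theorem symm_smul (b : B) (p : Conj Θ) : mk.symm (b • p) = op (τ b).unop • mk.symm p := by
  obtain ⟨p, rfl⟩ := mk.surjective p
  rw [smul_mk, AddEquiv.symm_apply_apply, AddEquiv.symm_apply_apply]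

theorem symm_op_smul (a : A) (p : Conj Θ) : mk.symm (op a • p) = (σ a).unop • mk.symm p := by
  obtain ⟨p, rfl⟩ := mk.surjective p
  rw [op_smul_mk, AddEquiv.symm_apply_apply, AddEquiv.symm_apply_apply]

instance : SMulCommClass B Aᵐᵒᵖ (Conj Θ) where
  smul_comm b a p := by
    obtain ⟨p, rfl⟩ := mk.surjective p
    rw [← op_unop a, op_smul_mk, smul_mk, smul_mk, op_smul_mk, ← smul_comm]

end Conj

/-- The regular right module is free of rank one. -/
def _root_.MulOpposite.regularEquiv (A : Type*) [Ring A] : Aᵐᵒᵖ ≃ₗ[Aᵐᵒᵖ] A where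
  toFun := unop
  invFun := op
  map_add' _ _ := rfl
  map_smul' _ _ := rfl
  left_inv _ := rfl
  right_inv _ := rfl

instance _root_.MulOpposite.finite_regular (A : Type*) [Ring A] : Module.Finite Aᵐᵒᵖ A :=
  Module.Finite.equiv (MulOpposite.regularEquiv A)

instance _root_.MulOpposite.projective_regular (A : Type*) [Ring A] : Module.Projective Aᵐᵒᵖ A :=
  Module.Projective.of_equiv (MulOpposite.regularEquiv A)

namespace MoritaData

variable {Θ : AdmittingForm.{u, u, v} S σ τ (algebraMap S B δ)} (D : MoritaData Θ)

/-- The form `δ η` on the conjugate bimodule. -/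
noncomputable def conjForm (hδ : δ * δ = 1) : HermForm σ (algebraMap S A δ) (Conj Θ) where
  toHom := AddMonoidHom.mk' (fun p =>
      { toFun := fun q => algebraMap S A δ * D.η (Conj.mk.symm p) (Conj.mk.symm q)
        map_add' := fun q q' => by rw [map_add, map_add, mul_add]
        map_smul' := fun a q => by
          rw [← op_unop a, Conj.symm_op_smul, D.η_smul_right, σ.involution, RingHom.id_apply,
            op_smul_eq_mul, mul_assoc] })
    (fun p p' => LinearMap.ext fun q => by
      simp only [LinearMap.coe_mk, AddHom.coe_mk, LinearMap.add_apply, map_add,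
        AddMonoidHom.add_apply, mul_add])
  smul_left a p q := by
    change algebraMap S A δ * D.η (Conj.mk.symm (op a • p)) (Conj.mk.symm q) =
      (σ a).unop * (algebraMap S A δ * D.η (Conj.mk.symm p) (Conj.mk.symm q))
    rw [Conj.symm_op_smul, D.η_smul_left, ← mul_assoc, Algebra.commutes, mul_assoc]
  symm p q := by
    change algebraMap S A δ * D.η (Conj.mk.symm p) (Conj.mk.symm q) =
      algebraMap S A δ * (σ (algebraMap S A δ * D.η (Conj.mk.symm q) (Conj.mk.symm p))).unop
    rw [← D.η_symm hδ, ← D.η_symm hδ, σ.involution, D.η_symm hδ]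

theorem conjForm_apply (hδ : δ * δ = 1) (p q : Θ.carrier) :
    (D.conjForm hδ).toHom (Conj.mk p) (Conj.mk q) = algebraMap S A δ * D.η p q := rfl

-- The expansion `p = ∑ η(p, qⱼ) q'ⱼ` is a dual basis of the conjugate module.
include D in
theorem exists_conj_retract (hδ : δ * δ = 1) :
    ∃ (i : Conj Θ →ₗ[Aᵐᵒᵖ] (Fin D.n → A)) (r : (Fin D.n → A) →ₗ[Aᵐᵒᵖ] Conj Θ),
      r ∘ₗ i = LinearMap.id := by
  refine ⟨LinearMap.pi fun j => (D.conjForm hδ).toHom (Conj.mk (D.q j)),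
    { toFun := fun a => ∑ j, op (a j) • Conj.mk (D.q' j)
      map_add' := fun a b => by
        simp only [Pi.add_apply, MulOpposite.op_add, add_smul, Finset.sum_add_distrib]
      map_smul' := fun c a => by
        rw [← op_unop c]
        simp only [Pi.smul_apply, op_smul_eq_mul, op_mul, mul_smul, RingHom.id_apply,
          Finset.smul_sum] }, LinearMap.ext fun p => ?_⟩
  obtain ⟨p, rfl⟩ := Conj.mk.surjective p
  change ∑ j, op ((D.conjForm hδ).toHom (Conj.mk (D.q j)) (Conj.mk p)) • Conj.mk (D.q' j) =
    Conj.mk p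
  simp_rw [conjForm_apply, ← D.η_symm hδ p, Conj.op_smul_mk, σ.involution]
  rw [← map_sum, D.sum_smul_form p]

variable (ι : S ≃+* S)

/-- The admitting form inducing the inverse equivalence. -/
noncomputable def conj (hδ : δ * δ = 1)
    (hισ : ∀ s : S, (σ (algebraMap S A s)).unop = algebraMap S A (ι s))
    (hιτ : ∀ s : S, (τ (algebraMap S B s)).unop = algebraMap S B (ι s)) :
    AdmittingForm.{u, u, v} S τ σ (algebraMap S A δ) where
  carrier := Conj Θ
  finite := by
    obtain ⟨i, r, h⟩ := D.exists_conj_retract hδ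
    exact Module.Finite.of_surjective r fun x => ⟨i x, LinearMap.congr_fun h x⟩
  projective := by
    obtain ⟨i, r, h⟩ := D.exists_conj_retract hδ
    have : Module.Projective Aᵐᵒᵖ (Fin D.n → A) := Module.Projective.of_equiv
      (DFinsupp.linearEquivFunOnFintype (R := Aᵐᵒᵖ) (M := fun _ : Fin D.n => A))
    exact Module.Projective.of_split i r h
  form := D.conjForm hδ
  central s p := by
    obtain ⟨p, rfl⟩ := Conj.mk.surjective p
    rw [Conj.smul_mk, Conj.op_smul_mk, hισ, hιτ, Θ.central]
  admits b p q := by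
    obtain ⟨p, rfl⟩ := Conj.mk.surjective p
    obtain ⟨q, rfl⟩ := Conj.mk.surjective q
    rw [Conj.smul_mk, Conj.smul_mk, conjForm_apply, conjForm_apply, τ.involution,
      D.η_op_smul_left]

/-- The pairing `(n ⊗ q, p) ↦ n ϑ (q, p)`. -/
noncomputable def conjContract (N : Type v) [AddCommGroup N] [Module Bᵐᵒᵖ N] :
    BimodTensor B A N (Conj Θ) →+ (Θ.carrier →ₗ[Bᵐᵒᵖ] N) :=
  BimodTensor.liftAdd
    (AddMonoidHom.mk' (fun n => AddMonoidHom.mk' (fun q : Conj Θ =>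
        ({ toFun := fun p => op (Θ.form.toHom (Conj.mk.symm q) p) • n
           map_add' := fun p p' => by rw [map_add, MulOpposite.op_add, add_smul]
           map_smul' := fun b p => by
             rw [← op_unop b, form_smul_right, RingHom.id_apply, op_mul, mul_smul] } :
          Θ.carrier →ₗ[Bᵐᵒᵖ] N))
        (fun q q' => LinearMap.ext fun p => by
          simp only [LinearMap.coe_mk, AddHom.coe_mk, LinearMap.add_apply, map_add,
            MulOpposite.op_add, add_smul]))
      (fun n n' => by ext q p; exact smul_add _ _ _))
    (fun b n q => by
      ext p
      change op (Θ.form.toHom (Conj.mk.symm q) p) • op b • n =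
        op (Θ.form.toHom (Conj.mk.symm (b • q)) p) • n
      rw [Conj.symm_smul, Θ.form.smul_left, τ.involution, op_mul, mul_smul])

theorem conjContract_tmul {N : Type v} [AddCommGroup N] [Module Bᵐᵒᵖ N] (n : N)
    (q p : Θ.carrier) : conjContract (Θ := Θ) N (BimodTensor.tmul B A n (Conj.mk q)) p =
      op (Θ.form.toHom q p) • n := rfl

/-- The evaluation `n ⊗ q ⊗ p ↦ n ϑ (q, p)`. -/
noncomputable def conjEval (N : Type v) [AddCommGroup N] [Module Bᵐᵒᵖ N] :
    BimodTensor A B (BimodTensor B A N (Conj Θ)) Θ.carrier →ₗ[Bᵐᵒᵖ] N :=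
  BimodTensor.lift (conjContract N) (fun a t p => by
    induction t using BimodTensor.induction with
    | zero => simp
    | add s t hs ht => rw [smul_add, map_add, map_add, LinearMap.add_apply, hs, ht]; rfl
    | tmul n q =>
      obtain ⟨q, rfl⟩ := Conj.mk.surjective q
      rw [← BimodTensor.tmul_smul, Conj.op_smul_mk, conjContract_tmul, conjContract_tmul,
        form_smul_left, σ.involution])

theorem conjEval_tmul {N : Type v} [AddCommGroup N] [Module Bᵐᵒᵖ N] (n : N)
    (q p : Θ.carrier) : conjEval (Θ := Θ) N (BimodTensor.tmul A B
      (BimodTensor.tmul B A n (Conj.mk q)) p) = op (Θ.form.toHom q p) • n := rfl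

-- The inverse is `n ↦ ∑ (n ⊗ qⱼ) ⊗ q'ⱼ`.
include D in
theorem conjEval_bijective (hδ : δ * δ = 1) (N : Type v) [AddCommGroup N] [Module Bᵐᵒᵖ N] :
    Function.Bijective (conjEval (Θ := Θ) N) := by
  let G : N →+ BimodTensor A B (BimodTensor B A N (Conj Θ)) Θ.carrier :=
    AddMonoidHom.mk' (fun n => ∑ j, BimodTensor.tmul A B
      (BimodTensor.tmul B A n (Conj.mk (D.q j))) (D.q' j)) (fun n n' => by
        simp only [BimodTensor.add_tmul, Finset.sum_add_distrib])
  have hGF : G.comp (conjEval (Θ := Θ) N).toAddMonoidHom = AddMonoidHom.id _ := by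
    refine BimodTensor.addHom_ext fun t p => ?_
    induction t using BimodTensor.induction with
    | zero => rw [BimodTensor.zero_tmul, map_zero, map_zero]
    | add s t hs ht => rw [BimodTensor.add_tmul, map_add, map_add, hs, ht]
    | tmul n q =>
      obtain ⟨q, rfl⟩ := Conj.mk.surjective q
      change ∑ j, BimodTensor.tmul A B (BimodTensor.tmul B A (op (Θ.form.toHom q p) • n)
        (Conj.mk (D.q j))) (D.q' j) = _
      -- The scalar `ϑ(q, p)` crosses the inner tensor product and, by the relation between `η` and
      -- `ϑ`, reappears as `η(p, qⱼ)` acting on the right, ready to cross the outer one.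
      have h1 : ∀ j, BimodTensor.tmul B A (op (Θ.form.toHom q p) • n)
          (Conj.mk (D.q j)) = op (D.η p (D.q j)) •
            BimodTensor.tmul B A n (Conj.mk q) := by
        intro j
        rw [BimodTensor.smul_tmul, ← BimodTensor.tmul_smul]
        congr 1
        rw [Conj.smul_mk, Conj.op_smul_mk, form_symm hδ, D.η_symm hδ, mul_smul, D.η_smul,
          Θ.central, ← mul_smul, ← op_mul, Algebra.commutes]
      simp_rw [h1, BimodTensor.smul_tmul]
      rw [← BimodTensor.tmul_sum, D.sum_smul_form]
      rfl
  refine ⟨fun x y hxy => ?_, fun n => ⟨G n, ?_⟩⟩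
  · rw [← AddMonoidHom.id_apply _ x, ← AddMonoidHom.id_apply _ y, ← hGF]
    exact congrArg G hxy
  · change conjEval (Θ := Θ) N (∑ j, BimodTensor.tmul A B
      (BimodTensor.tmul B A n (Conj.mk (D.q j))) (D.q' j)) = n
    rw [map_sum]
    simp_rw [conjEval_tmul]
    rw [← Finset.sum_smul, ← Finset.op_sum, D.sum_form, op_one, one_smul]

-- A preimage of `Y` is `Y ⊗_B P` formed with the conjugate bimodule and its form; the signs fit
-- since `δ * (δ * ε) = ε`. The evaluation isomorphism is an isometry.
include D in
theorem essSurj_functor (hδ : δ * δ = 1)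
    (hισ : ∀ s : S, (σ (algebraMap S A s)).unop = algebraMap S A (ι s))
    (hιτ : ∀ s : S, (τ (algebraMap S B s)).unop = algebraMap S B (ι s)) (ε : S) : (Θ.functor ε).EssSurj where
  mem_essImage Y := by
    let Θ' := D.conj ι hδ hισ hιτ
    let k' : HermForm σ (algebraMap S A ε) (BimodTensor B A Y.carrier (Conj Θ)) :=
      (Θ'.prod Y.form).ofEq (by rw [← mul_assoc, hδ, one_mul])
    have hk' : ∀ n n' (q q' : Θ.carrier), k'.toHom
        (BimodTensor.tmul B A n (Conj.mk q))
        (BimodTensor.tmul B A n' (Conj.mk q')) =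
        algebraMap S A δ * D.η q (op (τ (Y.form.toHom n n')).unop • q') := fun n n' q q' => rfl
    have hf : Module.Finite Aᵐᵒᵖ (Conj Θ) := Θ'.finite
    have hp : Module.Projective Aᵐᵒᵖ (Conj Θ) := Θ'.projective
    let X : Herm.{u, v} σ (algebraMap S A ε) :=
      { carrier := BimodTensor B A Y.carrier (Conj Θ), form := k' }
    let e : BimodTensor A B (BimodTensor B A Y.carrier (Conj Θ)) Θ.carrier ≃ₗ[Bᵐᵒᵖ] Y.carrier :=
      LinearEquiv.ofBijective (conjEval (Θ := Θ) Y.carrier) (D.conjEval_bijective hδ Y.carrier)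
    have key : ∀ x y, Y.form.toHom (conjEval (Θ := Θ) Y.carrier x)
        (conjEval (Θ := Θ) Y.carrier y) = (Θ.prod k').toHom x y := by
      intro x y
      induction x using BimodTensor.induction with
      | zero => simp only [map_zero, LinearMap.zero_apply]
      | add s t hs ht => simp only [map_add, LinearMap.add_apply, hs, ht]
      | tmul t p =>
        induction y using BimodTensor.induction with
        | zero => simp only [map_zero]
        | add s t hs ht => simp only [map_add, hs, ht]
        | tmul t' p' =>
          rw [Θ.prod_tmul]
          induction t using BimodTensor.induction with
          | zero => simp only [map_zero, LinearMap.zero_apply, BimodTensor.zero_tmul, zero_smul]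
          | add s t hs ht =>
            simp only [map_add, LinearMap.add_apply, BimodTensor.add_tmul, add_smul, hs, ht]
          | tmul n q =>
            induction t' using BimodTensor.induction with
            | zero => simp only [map_zero, BimodTensor.zero_tmul, zero_smul]
            | add s t hs ht =>
              simp only [map_add, BimodTensor.add_tmul, add_smul, hs, ht]
            | tmul n' q' =>
              obtain ⟨q, rfl⟩ := Conj.mk.surjective q
              obtain ⟨q', rfl⟩ := Conj.mk.surjective q'
              rw [hk', conjEval_tmul, conjEval_tmul, Y.form.smul_left, map_smul, op_smul_eq_mul,
                form_symm hδ, mul_smul, D.η_smul, Θ.form.smul_left, τ.involution, Θ.central,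
                form_smul_right, form_smul_right, ← Algebra.commutes]
              simp only [mul_assoc]
    exact ⟨X, ⟨Herm.Isometry.toIso ⟨e, key⟩⟩⟩

include D in
theorem isHermitianMorita (hδ : δ * δ = 1)
    (hισ : ∀ s : S, (σ (algebraMap S A s)).unop = algebraMap S A (ι s))
    (hιτ : ∀ s : S, (τ (algebraMap S B s)).unop = algebraMap S B (ι s)) (ε : S) : Θ.IsHermitianMorita ε where
  isEquivalence :=
    { faithful := D.faithful_functor ε
      full := D.full_functor ε
      essSurj := D.essSurj_functor ι hδ hισ hιτ ε }
  orthSum := Θ.orthSum_functor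
  nonsingular := D.nonsingular_functor hδ
  hyperbolic := D.hyperbolic_functor hδ

end MoritaData

end AdmittingForm

/-! ### Construction of the Morita context -/

namespace AdmittingForm

variable {S : Type*} {A : Type u} {B : Type u} [CommRing S] [Ring A] [Ring B]
variable [Algebra S A] [Algebra S B] {σ : RingInvo A} {τ : RingInvo B} {δ : S}

/-- The endomorphism `r ↦ p ϑ(q, r)` is the action of a unique element of `A`, namely `η(p, q)`.
Through nonsingularity, a dual basis of `P` becomes the presentation of `1` by `η`, and functionals
generating `B` become the presentation by `ϑ`. -/
theorem nonempty_moritaData (Θ : AdmittingForm.{u, u, v} S σ τ (algebraMap S B δ))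
    (hns : Θ.Nonsingular) (hend : ∀ F : Θ.carrier →ₗ[Bᵐᵒᵖ] Θ.carrier, ∃ a : A, ∀ p, F p = a • p)
    (hfaith : ∀ a b : A, (∀ r : Θ.carrier, a • r = b • r) → a = b)
    (hgen : ∃ (n : ℕ) (f : Fin n → (Θ.carrier →ₗ[Bᵐᵒᵖ] B)) (p : Fin n → Θ.carrier),
      ∑ j, f j (p j) = 1) : Nonempty (MoritaData Θ) := by
  have hnondeg : ∀ p q : Θ.carrier, (∀ r, Θ.form.toHom r p = Θ.form.toHom r q) → p = q :=
    fun p q h => hns.1 (LinearMap.ext fun r => by rw [Θ.form.symm, h, ← Θ.form.symm])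
  have hex : ∀ p q : Θ.carrier, ∃ a : A, ∀ r, a • r = op (Θ.form.toHom q r) • p := fun p q => by
    obtain ⟨a, ha⟩ := hend
      { toFun := fun r => op (Θ.form.toHom q r) • p
        map_add' := fun r r' => by rw [map_add, MulOpposite.op_add, add_smul]
        map_smul' := fun b r => by
          rw [← op_unop b, map_smul, op_smul_eq_mul, RingHom.id_apply, op_mul, mul_smul] }
    exact ⟨a, fun r => (ha r).symm⟩
  choose e he using hex
  let η : Θ.carrier →+ Θ.carrier →+ A := AddMonoidHom.mk'
    (fun p => AddMonoidHom.mk' (fun q => e p q) (fun q q' => hfaith _ _ fun r => by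
      rw [he, add_smul, he, he, map_add, LinearMap.add_apply, MulOpposite.op_add, add_smul]))
    (fun p p' => AddMonoidHom.ext fun q => hfaith _ _ fun r => by
      change e (p + p') q • r = (e p q + e p' q) • r
      rw [he, add_smul, he, he, smul_add])
  have hη : ∀ p q r, η p q • r = op (Θ.form.toHom q r) • p := he
  obtain ⟨m, f, g, -, -, hfg⟩ := Module.Finite.exists_comp_eq_id_of_projective Bᵐᵒᵖ Θ.carrier
  have hp' : ∀ i, ∃ x : Θ.carrier, ∀ r, Θ.form.toHom x r = (g r i).unop := fun i => by
    obtain ⟨x, hx⟩ := hns.2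
      { toFun := fun r => (g r i).unop
        map_add' := fun r r' => by simp
        map_smul' := fun b r => by rw [map_smul]; rfl }
    exact ⟨x, fun r => by rw [hx]; rfl⟩
  choose p' hp' using hp'
  obtain ⟨n, φ, q', hφ⟩ := hgen
  choose q hq using fun j => hns.2 (φ j)
  exact ⟨{
    η := η
    η_smul := hη
    faithful := hfaith
    nondeg := hnondeg
    m := m
    p := fun i => f (Pi.single i 1)
    p' := p'
    sum_η := hfaith _ _ fun r => by
      rw [Finset.sum_smul, one_smul]
      simp_rw [hη, hp', op_unop, ← map_smul]
      rw [← map_sum]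
      conv_rhs => rw [← LinearMap.id_apply (R := Bᵐᵒᵖ) r, ← hfg, LinearMap.comp_apply]
      congr 1
      conv_rhs => rw [← Finset.univ_sum_single (g r)]
      refine Finset.sum_congr rfl fun i _ => ?_
      rw [← Pi.single_smul, smul_eq_mul, mul_one]
    n := n
    q := q
    q' := q'
    sum_form := by simp_rw [hq, hφ] }⟩

end AdmittingForm

/-! ### Conjugate transposes -/

section ConjTranspose

open Matrix

variable {A : Type*} [Ring A] (σ : RingInvo A) {k l m : Type*}

/-- The conjugate transpose of a matrix over a ring with involution. -/
def RingInvo.conjT (X : Matrix k l A) : Matrix l k A := Matrix.of fun i j => (σ (X j i)).unop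

/-- The conjugate of a vector over a ring with involution. -/
def RingInvo.conjV (v : k → A) : k → A := fun i => (σ (v i)).unop

namespace RingInvo

theorem conjT_apply (X : Matrix k l A) (i : l) (j : k) : σ.conjT X i j = (σ (X j i)).unop := rfl

theorem conjT_conjT (X : Matrix k l A) : σ.conjT (σ.conjT X) = X := by
  ext i j; simp only [conjT_apply, σ.involution]

theorem conjV_conjV (v : k → A) : σ.conjV (σ.conjV v) = v := by
  ext i; simp only [conjV, σ.involution]

theorem conjT_add (X Y : Matrix k l A) : σ.conjT (X + Y) = σ.conjT X + σ.conjT Y := by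
  ext i j; simp [conjT_apply]

theorem conjV_add (v w : k → A) : σ.conjV (v + w) = σ.conjV v + σ.conjV w := by
  ext i; simp [conjV]

theorem conjT_one [DecidableEq l] : σ.conjT (1 : Matrix l l A) = 1 := by
  ext i j
  by_cases h : i = j
  · subst h; simp [conjT_apply]
  · simp [conjT_apply, Matrix.one_apply_ne h, Matrix.one_apply_ne (Ne.symm h)]

theorem conjT_single [DecidableEq k] [DecidableEq l] (i : k) (j : l) (a : A) :
    σ.conjT (Matrix.single i j a) = Matrix.single j i (σ a).unop := by
  ext p q
  simp only [conjT_apply, Matrix.single_apply]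
  by_cases h : i = q ∧ j = p
  · rw [if_pos h, if_pos ⟨h.2, h.1⟩]
  · rw [if_neg h, if_neg (fun h' => h ⟨h'.2, h'.1⟩)]; simp

theorem conjT_smul {S : Type*} [CommRing S] [Algebra S A] (ι : S ≃+* S)
    (hι : ∀ s : S, (σ (algebraMap S A s)).unop = algebraMap S A (ι s)) (s : S)
    (X : Matrix k l A) : σ.conjT (s • X) = ι s • σ.conjT X := by
  ext i j
  simp only [conjT_apply, Matrix.smul_apply, Algebra.smul_def, map_mul, unop_mul, hι,
    Algebra.commutes]

variable [Fintype l]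

theorem conjT_mul (X : Matrix k l A) (Y : Matrix l m A) :
    σ.conjT (X * Y) = σ.conjT Y * σ.conjT X := by
  ext i j
  simp only [conjT_apply, Matrix.mul_apply, map_sum, Finset.unop_sum, map_mul, unop_mul]

theorem conjV_mulVec (X : Matrix k l A) (v : l → A) :
    σ.conjV (X *ᵥ v) = σ.conjV v ᵥ* σ.conjT X := by
  ext i
  simp only [conjV, Matrix.mulVec, Matrix.vecMul, dotProduct, conjT_apply, map_sum,
    Finset.unop_sum, map_mul, unop_mul]

theorem unop_dotProduct (v w : l → A) : (σ (v ⬝ᵥ w)).unop = σ.conjV w ⬝ᵥ σ.conjV v := by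
  simp only [conjV, dotProduct, map_sum, Finset.unop_sum, map_mul, unop_mul]

end RingInvo

end ConjTranspose

/-! ### The admitting form attached to an isomorphism of matrix algebras -/

section Columns

open Matrix

variable {S : Type*} {A B : Type u} [CommRing S] [Ring A] [Ring B] [Algebra S A] [Algebra S B]
variable {n m : ℕ} (Φ : Matrix (Fin n) (Fin n) A ≃ₐ[S] Matrix (Fin m) (Fin m) B) (i₀ : Fin n)

/-- The right `B`-module `f B^m`, where `f` is the image of a matrix unit. -/
def Columns : Submodule Bᵐᵒᵖ (Fin m → B) where
  carrier := {v | Φ (Matrix.single i₀ i₀ 1) *ᵥ v = v}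
  add_mem' {v w} hv hw := by
    rw [Set.mem_ofPred_eq] at *
    rw [mulVec_add, hv, hw]
  zero_mem' := mulVec_zero _
  smul_mem' b v hv := by
    rw [Set.mem_ofPred_eq] at *
    rw [mulVec_smul, hv]

namespace Columns

theorem mem_iff (v : Fin m → B) : v ∈ Columns Φ i₀ ↔ Φ (Matrix.single i₀ i₀ 1) *ᵥ v = v := Iff.rfl

theorem single_mul (a b : A) : Φ (Matrix.single i₀ i₀ a) * Φ (Matrix.single i₀ i₀ b) =
    Φ (Matrix.single i₀ i₀ (a * b)) := by
  rw [← map_mul, single_mul_single_same]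

theorem mulVec_mem (a : A) (v : Fin m → B) :
    Φ (Matrix.single i₀ i₀ a) *ᵥ v ∈ Columns Φ i₀ := by
  rw [mem_iff, mulVec_mulVec, single_mul, one_mul]

/-- Left multiplication by the corner `A` of the matrix algebra. -/
instance : Module A (Columns Φ i₀) where
  smul a v := ⟨Φ (Matrix.single i₀ i₀ a) *ᵥ v, mulVec_mem Φ i₀ a v⟩
  one_smul v := Subtype.ext v.2
  mul_smul a b v := Subtype.ext (by
    change Φ (Matrix.single i₀ i₀ (a * b)) *ᵥ v.1 =
      Φ (Matrix.single i₀ i₀ a) *ᵥ (Φ (Matrix.single i₀ i₀ b) *ᵥ v.1)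
    rw [mulVec_mulVec, single_mul])
  smul_zero a := Subtype.ext (by
    change Φ (Matrix.single i₀ i₀ a) *ᵥ (0 : Fin m → B) = 0
    exact mulVec_zero _)
  smul_add a v w := Subtype.ext (by
    change Φ (Matrix.single i₀ i₀ a) *ᵥ (v.1 + w.1) =
      Φ (Matrix.single i₀ i₀ a) *ᵥ v.1 + Φ (Matrix.single i₀ i₀ a) *ᵥ w.1
    exact mulVec_add _ _ _)
  add_smul a b v := Subtype.ext (by
    change Φ (Matrix.single i₀ i₀ (a + b)) *ᵥ v.1 =
      Φ (Matrix.single i₀ i₀ a) *ᵥ v.1 + Φ (Matrix.single i₀ i₀ b) *ᵥ v.1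
    rw [Matrix.single_add, map_add, add_mulVec])
  zero_smul v := Subtype.ext (by
    change Φ (Matrix.single i₀ i₀ 0) *ᵥ v.1 = 0
    rw [Matrix.single_zero, map_zero, zero_mulVec])

theorem coe_smul (a : A) (v : Columns Φ i₀) :
    ((a • v : Columns Φ i₀) : Fin m → B) = Φ (Matrix.single i₀ i₀ a) *ᵥ (v : Fin m → B) := rfl

instance : SMulCommClass A Bᵐᵒᵖ (Columns Φ i₀) where
  smul_comm a b v := Subtype.ext (by
    change Φ (Matrix.single i₀ i₀ a) *ᵥ (b • v.1) = b • (Φ (Matrix.single i₀ i₀ a) *ᵥ v.1)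
    exact mulVec_smul _ _ _)

/-- The projection of `B^m` onto `f B^m`. -/
def proj : (Fin m → B) →ₗ[Bᵐᵒᵖ] Columns Φ i₀ where
  toFun v := ⟨Φ (Matrix.single i₀ i₀ 1) *ᵥ v, mulVec_mem Φ i₀ 1 v⟩
  map_add' v w := Subtype.ext (by
    change Φ (Matrix.single i₀ i₀ 1) *ᵥ (v + w) =
      Φ (Matrix.single i₀ i₀ 1) *ᵥ v + Φ (Matrix.single i₀ i₀ 1) *ᵥ w
    exact mulVec_add _ _ _)
  map_smul' b v := Subtype.ext (by
    change Φ (Matrix.single i₀ i₀ 1) *ᵥ (b • v) = b • (Φ (Matrix.single i₀ i₀ 1) *ᵥ v)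
    exact mulVec_smul _ _ _)

theorem coe_proj (v : Fin m → B) :
    (proj Φ i₀ v : Fin m → B) = Φ (Matrix.single i₀ i₀ 1) *ᵥ v := rfl

theorem proj_coe (v : Columns Φ i₀) : proj Φ i₀ v = v := Subtype.ext v.2

theorem proj_comp_subtype : proj Φ i₀ ∘ₗ (Columns Φ i₀).subtype = LinearMap.id :=
  LinearMap.ext fun v => proj_coe Φ i₀ v

instance : Module.Finite Bᵐᵒᵖ (Columns Φ i₀) :=
  Module.Finite.of_surjective (proj Φ i₀) fun v => ⟨v, proj_coe Φ i₀ v⟩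

instance : Module.Projective Bᵐᵒᵖ (Columns Φ i₀) := by
  have : Module.Projective Bᵐᵒᵖ (Fin m → B) := Module.Projective.of_equiv
    (DFinsupp.linearEquivFunOnFintype (R := Bᵐᵒᵖ) (M := fun _ : Fin m => B))
  exact Module.Projective.of_split _ _ (proj_comp_subtype Φ i₀)

theorem eq_of_forall_smul_eq {a b : A} (h : ∀ v : Columns Φ i₀, a • v = b • v) : a = b := by
  have h1 : Φ (Matrix.single i₀ i₀ a) = Φ (Matrix.single i₀ i₀ b) := by
    refine ext_of_mulVec_single fun j => ?_
    have h2 := congrArg Subtype.val (h (proj Φ i₀ (Pi.single j 1)))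
    rw [coe_smul, coe_smul, coe_proj, mulVec_mulVec, mulVec_mulVec, single_mul, single_mul,
      mul_one, mul_one] at h2
    exact h2
  have h3 := congrFun (congrFun (Φ.injective h1) i₀) i₀
  rwa [single_apply_same, single_apply_same] at h3

theorem linearMap_apply_eq {N : Type*} [AddCommGroup N] [Module Bᵐᵒᵖ N]
    (F : (Fin m → B) →ₗ[Bᵐᵒᵖ] N) (v : Fin m → B) :
    F v = ∑ j, op (v j) • F (Pi.single j 1) := by
  conv_lhs => rw [← Finset.univ_sum_single v]
  rw [map_sum]
  refine Finset.sum_congr rfl fun j _ => ?_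
  rw [← map_smul, ← Pi.single_smul, op_smul_eq_mul, one_mul]

/-- Precomposed with the projection of `B^m` onto `f B^m`, the map `F` is a matrix `X` with `f X f =
X`. So the preimage of `X` under `Φ` lies in the corner at `(i₀, i₀)`, which is a copy of `A`. -/
theorem exists_eq_smul (F : Columns Φ i₀ →ₗ[Bᵐᵒᵖ] Columns Φ i₀) :
    ∃ a : A, ∀ v, F v = a • v := by
  let X : Matrix (Fin m) (Fin m) B :=
    Matrix.of fun i j => (F (proj Φ i₀ (Pi.single j 1)) : Fin m → B) i
  have hX : ∀ v, X *ᵥ v = F (proj Φ i₀ v) := fun v => by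
    have h1 := linearMap_apply_eq ((Columns Φ i₀).subtype ∘ₗ F ∘ₗ proj Φ i₀) v
    simp only [LinearMap.comp_apply, Submodule.subtype_apply] at h1
    rw [h1]
    ext i
    simp [X, mulVec, dotProduct]
  have hfX : Φ (Matrix.single i₀ i₀ 1) * X * Φ (Matrix.single i₀ i₀ 1) = X := by
    refine ext_of_mulVec_single fun j => ?_
    rw [← mulVec_mulVec, ← mulVec_mulVec, hX, hX, ← coe_proj Φ i₀ (Pi.single j 1), proj_coe]
    exact (F _).2
  have hY : Matrix.single i₀ i₀ (Φ.symm X i₀ i₀) = Φ.symm X := by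
    conv_rhs => rw [← hfX]
    rw [map_mul, map_mul, Φ.symm_apply_apply, single_mul_mul_single, one_mul, mul_one]
  refine ⟨Φ.symm X i₀ i₀, fun v => Subtype.ext ?_⟩
  rw [coe_smul, hY, Φ.apply_symm_apply, hX, proj_coe]

/-- The identity matrix is the sum of the `Φ(e_kk) = Φ(e_{k i₀}) f Φ(e_{i₀ k})`; its entry at `(j₀,
j₀)` gives the claim. -/
theorem exists_sum_eq_one (j₀ : Fin m) :
    ∃ (k : ℕ) (f : Fin k → (Columns Φ i₀ →ₗ[Bᵐᵒᵖ] B)) (p : Fin k → Columns Φ i₀),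
      ∑ j, f j (p j) = 1 := by
  let g (k : Fin n) : (Fin m → B) →ₗ[Bᵐᵒᵖ] (Fin m → B) :=
    { toFun := fun v => Φ (Matrix.single k i₀ 1) *ᵥ v
      map_add' := fun v w => mulVec_add _ _ _
      map_smul' := fun b v => mulVec_smul _ _ _ }
  refine ⟨n, fun k => LinearMap.proj j₀ ∘ₗ g k ∘ₗ (Columns Φ i₀).subtype,
    fun k => proj Φ i₀ (Φ (Matrix.single i₀ k 1) *ᵥ Pi.single j₀ 1), ?_⟩
  have h1 : ∀ k, Φ (Matrix.single k i₀ 1) *ᵥ (Φ (Matrix.single i₀ i₀ 1) *ᵥ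
      (Φ (Matrix.single i₀ k 1) *ᵥ Pi.single j₀ 1)) =
      Φ (Matrix.single k k 1) *ᵥ Pi.single j₀ 1 := fun k => by
    rw [mulVec_mulVec, mulVec_mulVec, ← map_mul, ← map_mul, single_mul_single_same,
      single_mul_single_same, one_mul, one_mul]
  simp only [g, LinearMap.comp_apply, LinearMap.coe_mk, AddHom.coe_mk, Submodule.subtype_apply,
    coe_proj, h1, LinearMap.proj_apply]
  rw [← Finset.sum_apply, ← Matrix.sum_mulVec, ← map_sum, Matrix.sum_single_one, map_one,
    one_mulVec, Pi.single_eq_same]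

section Form

variable (σ : RingInvo A) (τ : RingInvo B) {δ : S} (ι : S ≃+* S)
variable (J : Matrix (Fin m) (Fin m) B)

/-- The `δ`-hermitian form `(v, w) ↦ τ(v)ᵗ J w` on `f B^m`. -/
def form (hδ : δ * δ = 1) (hJ : τ.conjT J = δ • J) :
    HermForm τ (algebraMap S B δ) (Columns Φ i₀) where
  toHom := AddMonoidHom.mk' (fun v =>
      { toFun := fun w => τ.conjV v ⬝ᵥ (J *ᵥ w)
        map_add' := fun w w' => by rw [Submodule.coe_add, mulVec_add, dotProduct_add]
        map_smul' := fun b w => by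
          rw [Submodule.coe_smul, mulVec_smul, dotProduct_smul, RingHom.id_apply] })
    (fun v v' => LinearMap.ext fun w => by
      change τ.conjV (v.1 + v'.1) ⬝ᵥ (J *ᵥ w.1) = _
      rw [τ.conjV_add, add_dotProduct]; rfl)
  smul_left b v w := by
    change τ.conjV (op b • (v : Fin m → B)) ⬝ᵥ (J *ᵥ w) = (τ b).unop * (τ.conjV v ⬝ᵥ (J *ᵥ w))
    have h : τ.conjV (op b • (v : Fin m → B)) = (τ b).unop • τ.conjV v := by
      ext i; simp [RingInvo.conjV]
    rw [h, smul_dotProduct, smul_eq_mul]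
  symm v w := by
    change τ.conjV v ⬝ᵥ (J *ᵥ w) = algebraMap S B δ * (τ (τ.conjV w ⬝ᵥ (J *ᵥ v))).unop
    rw [τ.unop_dotProduct, τ.conjV_conjV, τ.conjV_mulVec, hJ, ← dotProduct_mulVec,
      Matrix.smul_mulVec, dotProduct_smul, ← Algebra.smul_def, smul_smul, hδ, one_smul]

theorem form_apply (hδ : δ * δ = 1) (hJ : τ.conjT J = δ • J) (v w : Columns Φ i₀) :
    (form Φ i₀ τ J hδ hJ).toHom v w = τ.conjV v ⬝ᵥ (J *ᵥ w) := rfl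

/-- The admitting form attached to an isomorphism of matrix algebras and a matrix comparing the
conjugate transposes. -/
def admittingForm (hδ : δ * δ = 1) (hJ : τ.conjT J = δ • J)
    (hΦ : ∀ X, J * Φ (σ.conjT X) = τ.conjT (Φ X) * J) :
    AdmittingForm.{u, u, u} S σ τ (algebraMap S B δ) where
  carrier := Columns Φ i₀
  form := form Φ i₀ τ J hδ hJ
  central s v := Subtype.ext (by
    rw [coe_smul, Submodule.coe_smul]
    have h1 : Matrix.single i₀ i₀ (algebraMap S A s) = s • Matrix.single i₀ i₀ (1 : A) := by
      rw [smul_single, Algebra.algebraMap_eq_smul_one]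
    rw [h1, map_smul, Matrix.smul_mulVec, (mem_iff Φ i₀ _).1 v.2]
    ext i
    simp [Algebra.smul_def, Algebra.commutes])
  admits a v w := by
    rw [form_apply, form_apply, coe_smul, coe_smul, τ.conjV_mulVec, ← dotProduct_mulVec,
      mulVec_mulVec, mulVec_mulVec, ← hΦ, σ.conjT_single, σ.involution]

/-- Since `J` is invertible, the form is nonsingular on all of `B^m`. The idempotent `f` is
self-adjoint for it, so `f B^m` is an orthogonal summand. -/
theorem nonsingular_admittingForm (hδ : δ * δ = 1) (hJ : τ.conjT J = δ • J)
    (hΦ : ∀ X, J * Φ (σ.conjT X) = τ.conjT (Φ X) * J) (hunit : IsUnit J) :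
    (admittingForm Φ i₀ σ τ J hδ hJ hΦ).Nonsingular := by
  obtain ⟨K, hJK, hKJ⟩ : ∃ K, J * K = 1 ∧ K * J = 1 :=
    ⟨hunit.unit.inv, hunit.unit.val_inv, hunit.unit.inv_val⟩
  have hf : ∀ v w : Fin m → B,
      τ.conjV (Φ (Matrix.single i₀ i₀ 1) *ᵥ v) ⬝ᵥ (J *ᵥ w) =
        τ.conjV v ⬝ᵥ (J *ᵥ (Φ (Matrix.single i₀ i₀ 1) *ᵥ w)) := fun v w => by
    have h1 := hΦ (Matrix.single i₀ i₀ 1)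
    rw [σ.conjT_single, map_one, unop_one] at h1
    rw [τ.conjV_mulVec, ← dotProduct_mulVec, mulVec_mulVec, mulVec_mulVec, h1]
  constructor
  · refine (injective_iff_map_eq_zero _).2 fun (v : Columns Φ i₀) hv => ?_
    have h1 : ∀ w : Fin m → B, τ.conjV (v : Fin m → B) ⬝ᵥ (J *ᵥ w) = 0 := fun w => by
      have h2 : τ.conjV (v : Fin m → B) ⬝ᵥ (J *ᵥ (proj Φ i₀ w : Fin m → B)) = 0 :=
        LinearMap.congr_fun hv (proj Φ i₀ w)
      rw [coe_proj, ← hf, (mem_iff Φ i₀ _).1 v.2] at h2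
      exact h2
    have h3 : τ.conjV (v : Fin m → B) = 0 := by
      ext j
      have h4 := h1 (K *ᵥ Pi.single j 1)
      rw [mulVec_mulVec, hJK, one_mulVec, dotProduct_single, mul_one] at h4
      exact h4
    refine Subtype.ext ?_
    rw [← τ.conjV_conjV (v : Fin m → B), h3]
    ext j
    simp only [RingInvo.conjV, Pi.zero_apply, map_zero, unop_zero]
    rfl
  · intro (F : Columns Φ i₀ →ₗ[Bᵐᵒᵖ] B)
    let c : Fin m → B := fun j => F (proj Φ i₀ (Pi.single j 1))
    have hc : ∀ w, c ⬝ᵥ w = F (proj Φ i₀ w) := fun w => by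
      have h1 := linearMap_apply_eq (F ∘ₗ proj Φ i₀) w
      simp only [LinearMap.comp_apply] at h1
      rw [h1]
      simp [c, dotProduct]
    refine ⟨proj Φ i₀ (τ.conjV (c ᵥ* K)), LinearMap.ext fun (w : Columns Φ i₀) => ?_⟩
    change τ.conjV (proj Φ i₀ (τ.conjV (c ᵥ* K)) : Fin m → B) ⬝ᵥ (J *ᵥ (w : Fin m → B)) = F w
    rw [coe_proj, hf, (mem_iff Φ i₀ _).1 w.2, τ.conjV_conjV, ← dotProduct_mulVec, mulVec_mulVec,
      hKJ, one_mulVec, hc, proj_coe]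

theorem nonempty_moritaData (hδ : δ * δ = 1) (hJ : τ.conjT J = δ • J)
    (hΦ : ∀ X, J * Φ (σ.conjT X) = τ.conjT (Φ X) * J) (hunit : IsUnit J) (j₀ : Fin m) :
    Nonempty (admittingForm Φ i₀ σ τ J hδ hJ hΦ).MoritaData :=
  AdmittingForm.nonempty_moritaData _ (nonsingular_admittingForm Φ i₀ σ τ J hδ hJ hΦ hunit)
    (exists_eq_smul Φ i₀) (fun _ _ h => eq_of_forall_smul_eq Φ i₀ h)
    (exists_sum_eq_one Φ i₀ j₀)

end Form

end Columns

end Columns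

/-! ### Existence of admitting forms -/

section Azumaya

variable {R S A : Type*} [CommRing R] [CommRing S] [Ring A] [Algebra R S] [Algebra R A]
  [Algebra S A] [IsScalarTower R S A] {σ : RingInvo A} {ι : S ≃+* S}

theorem IsCentreOf.exists_of_mem_center (h : IsCentreOf S A) (z : A)
    (hz : z ∈ Subring.center A) : ∃ s : S, algebraMap S A s = z := by
  obtain ⟨s, -, hs⟩ := h.surjOn hz
  exact ⟨s, hs⟩

theorem IsCentreOf.injective (h : IsCentreOf S A) : Function.Injective (algebraMap S A) :=
  Set.injOn_univ.1 h.injOn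

/-- By definition `R` is the symmetric part of the centre, which is the fixed ring of `ι` once the
centre is identified with `S`. -/
theorem IsAzumayaWithInvolution.isQuadraticInvolution (hσ : IsAzumayaWithInvolution R σ)
    (hSA : IsCentreOf S A) (hι : ∀ s : S, (σ (algebraMap S A s)).unop = algebraMap S A (ι s)) :
    IsQuadraticInvolution R ι where
  invol s := hSA.injective (by rw [← hι, ← hι, σ.involution])
  map_algebraMap r := hSA.injective (by
    rw [← hι, ← IsScalarTower.algebraMap_apply]
    exact (hσ.bijOn_center.mapsTo (Set.mem_univ r)).2)
  exists_of_fixed s hs := by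
    obtain ⟨r, -, hr⟩ := hσ.bijOn_center.surjOn (show algebraMap S A s ∈ _ from
      ⟨hSA.mapsTo (Set.mem_univ s), by rw [hι, hs]⟩)
    exact ⟨r, hSA.injective (by rw [← IsScalarTower.algebraMap_apply, hr])⟩

end Azumaya

/-- Separability of matrix algebras. -/
theorem IsSeparabilityFamily.matrix {S B κ : Type*} [CommRing S] [Ring B] [Algebra S B]
    [Fintype κ] {x y : κ → B} (h : IsSeparabilityFamily S x y) {m : Type*} [Fintype m]
    [DecidableEq m] (j₀ : m) :
    IsSeparabilityFamily S (fun i : κ × m => Matrix.single i.2 j₀ (x i.1))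
      (fun i : κ × m => Matrix.single j₀ i.2 (y i.1)) where
  sum_mul := by
    simp only [Matrix.single_mul_single_same]
    rw [Fintype.sum_prod_type_right]
    rw [← Matrix.sum_single_one]
    refine Finset.sum_congr rfl fun k _ => ?_
    rw [← h.sum_mul]
    exact (map_sum (Matrix.singleAddMonoidHom (α := B) k k) _ _).symm
  comm c := by
    induction c using Matrix.induction_on' with
    | h_zero => simp
    | h_add c c' hc hc' =>
      simp only [add_mul, mul_add, TensorProduct.add_tmul, TensorProduct.tmul_add,
        Finset.sum_add_distrib, hc, hc']
    | h_std_basis p q b =>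
      rw [Fintype.sum_prod_type_right, Fintype.sum_prod_type_right]
      -- Multiplication by the matrix unit at `(p, q)` leaves only the terms with row index `q` on
      -- the left and `p` on the right; what remains is separability of `B`.
      rw [Finset.sum_eq_single q, Finset.sum_eq_single p]
      · simp only [Matrix.single_mul_single_same]
        exact h.sum_comm (N := Matrix m m B ⊗[S] Matrix m m B)
          ((TensorProduct.mk S _ _).compl₁₂ (Matrix.singleLinearMap S p j₀)
            (Matrix.singleLinearMap S j₀ q)) b
      · intro k _ hk
        refine Finset.sum_eq_zero fun i _ => ?_
        rw [Matrix.single_mul_single_of_ne _ _ _ _ hk, TensorProduct.tmul_zero]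
      · simp
      · intro k _ hk
        refine Finset.sum_eq_zero fun i _ => ?_
        rw [Matrix.single_mul_single_of_ne _ _ _ _ hk.symm, TensorProduct.zero_tmul]
      · simp

theorem Matrix.exists_algebraMap_of_mem_center {S B : Type*} [CommRing S] [Ring B] [Algebra S B]
    (hc : ∀ z ∈ Subring.center B, ∃ s : S, algebraMap S B s = z) {m : Type*} [Fintype m]
    [DecidableEq m] (Z : Matrix m m B) (hZ : Z ∈ Subring.center (Matrix m m B)) :
    ∃ s : S, algebraMap S (Matrix m m B) s = Z := by
  rw [Matrix.subringCenter_eq_scalar_map] at hZ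
  obtain ⟨z, hz, rfl⟩ := hZ
  obtain ⟨s, rfl⟩ := hc z hz
  exact ⟨s, rfl⟩

/-- Over a connected semilocal ring, Brauer equivalent algebras have isomorphic matrix algebras. -/
theorem AzumayaBrauerEquivalent.exists_matrix_algEquiv {S A B : Type u} [CommRing S] [Ring A]
    [Ring B] [Algebra S A] [Algebra S B] [Finite (MaximalSpectrum S)] (hS : IsConnectedRing S)
    (h : AzumayaBrauerEquivalent S A B) : ∃ n m : ℕ, 0 < n ∧ 0 < m ∧
      Nonempty (Matrix (Fin n) (Fin n) A ≃ₐ[S] Matrix (Fin m) (Fin m) B) := by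
  have hnt := hS.1
  -- A faithful module over a nonzero ring is nonzero, so the ranks are positive and the matrix
  -- algebras have a row to work with.
  have pos : ∀ (Q : Type u) [AddCommGroup Q] [Module S Q] [FaithfulSMul S Q] (k : ℕ),
      Module.Basis (Fin k) S Q → 0 < k := fun Q _ _ _ k b => by
    rcases Nat.eq_zero_or_pos k with rfl | hk
    · have : Subsingleton Q := b.repr.toEquiv.subsingleton
      exact absurd (FaithfulSMul.eq_of_smul_eq_smul (M := S) (α := Q)
        fun q => Subsingleton.elim ((1 : S) • q) ((0 : S) • q)) one_ne_zero
    · exact hk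
  obtain ⟨P, Q, _, _, _, _, _, _, _, _, _, _, ⟨e⟩⟩ := h
  obtain ⟨n, ⟨b⟩⟩ := hS.exists_basis P
  obtain ⟨m, ⟨c⟩⟩ := hS.exists_basis Q
  refine ⟨n, m, pos P n b, pos Q m c, ⟨?_⟩⟩
  exact (matrixEquivTensor (Fin n) S A).trans <|
    (Algebra.TensorProduct.congr AlgEquiv.refl (algEquivMatrix b).symm).trans <|
    e.trans <| (Algebra.TensorProduct.congr AlgEquiv.refl (algEquivMatrix c)).trans
    (matrixEquivTensor (Fin m) S B).symm

section Existence

variable {R S A B : Type u} [CommRing R] [CommRing S] [Ring A] [Ring B]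
  [Algebra R S] [Algebra R A] [Algebra S A] [IsScalarTower R S A]
  [Algebra R B] [Algebra S B] [IsScalarTower R S B]
  {σ : RingInvo A} {τ : RingInvo B} {ι : S ≃+* S}

/-- The transport of the conjugate transpose along an isomorphism of matrix algebras, followed by
the conjugate transpose. -/
def RingInvo.conjTAlgEquiv {n m : Type*} [Fintype n] [Fintype m] [DecidableEq n] [DecidableEq m]
    (hι : ∀ s, ι (ι s) = s)
    (hισ : ∀ s : S, (σ (algebraMap S A s)).unop = algebraMap S A (ι s))
    (hιτ : ∀ s : S, (τ (algebraMap S B s)).unop = algebraMap S B (ι s))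
    (Φ : Matrix n n A ≃ₐ[S] Matrix m m B) : Matrix m m B ≃ₐ[S] Matrix m m B :=
  AlgEquiv.ofLinearEquiv
    { toFun := fun X => Φ (σ.conjT (Φ.symm (τ.conjT X)))
      invFun := fun X => τ.conjT (Φ (σ.conjT (Φ.symm X)))
      left_inv := fun X => by simp [RingInvo.conjT_conjT]
      right_inv := fun X => by simp [RingInvo.conjT_conjT]
      map_add' := fun X Y => by simp [RingInvo.conjT_add]
      map_smul' := fun s X => by
        rw [τ.conjT_smul ι hιτ, map_smul, σ.conjT_smul ι hισ, hι, map_smul, RingHom.id_apply] }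
    (by
      change Φ (σ.conjT (Φ.symm (τ.conjT 1))) = 1
      rw [τ.conjT_one, map_one, σ.conjT_one, map_one])
    (fun X Y => by
      change Φ (σ.conjT (Φ.symm (τ.conjT (X * Y)))) =
        Φ (σ.conjT (Φ.symm (τ.conjT X))) * Φ (σ.conjT (Φ.symm (τ.conjT Y)))
      rw [τ.conjT_mul, map_mul, σ.conjT_mul, map_mul])

/-- The involutions on isomorphic matrix algebras differ by a matrix which is hermitian up to a
central unit. -/
theorem RingInvo.exists_conjT_comparison [Finite (MaximalSpectrum S)] [Module.Finite S B]
    {κ : Type*} [Fintype κ] {x y : κ → B} (h : IsSeparabilityFamily S x y)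
    (hSB : IsCentreOf S B) (hι : ∀ s, ι (ι s) = s)
    (hισ : ∀ s : S, (σ (algebraMap S A s)).unop = algebraMap S A (ι s))
    (hιτ : ∀ s : S, (τ (algebraMap S B s)).unop = algebraMap S B (ι s))
    {n m : ℕ} (j₀ : Fin m) (Φ : Matrix (Fin n) (Fin n) A ≃ₐ[S] Matrix (Fin m) (Fin m) B) :
    ∃ (g : (Matrix (Fin m) (Fin m) B)ˣ) (u : S), u * ι u = 1 ∧ g.val = u • τ.conjT g.val ∧
      ∀ X, Φ (σ.conjT X) * g.val = g.val * τ.conjT (Φ X) := by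
  have hinj : Function.Injective (algebraMap S (Matrix (Fin m) (Fin m) B)) := fun s s' hs =>
    hSB.injective (by
      have h1 := congrFun (congrFun hs j₀) j₀
      simpa [Matrix.algebraMap_matrix_apply] using h1)
  have : Module.Finite S (Matrix (Fin m) (Fin m) B) :=
    inferInstanceAs (Module.Finite S (Fin m → Fin m → B))
  -- Each conjugate transpose is `ι`-semilinear and reverses products. Their composite is therefore
  -- an `S`-algebra automorphism, and Skolem–Noether applies.
  obtain ⟨g, hg⟩ := (h.matrix j₀).exists_conj
    (Matrix.exists_algebraMap_of_mem_center hSB.exists_of_mem_center (m := Fin m)) hinj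
    (RingInvo.conjTAlgEquiv hι hισ hιτ Φ)
  have hg1 : ∀ X, Φ (σ.conjT X) * g.val = g.val * τ.conjT (Φ X) := fun X => by
    have h1 := hg (τ.conjT (Φ X))
    change Φ (σ.conjT (Φ.symm (τ.conjT (τ.conjT (Φ X))))) * g.val = _ at h1
    rwa [τ.conjT_conjT, Φ.symm_apply_apply] at h1
  let g' : (Matrix (Fin m) (Fin m) B)ˣ :=
    ⟨τ.conjT g.val, τ.conjT g.inv, by rw [← τ.conjT_mul, g.inv_val, τ.conjT_one],
      by rw [← τ.conjT_mul, g.val_inv, τ.conjT_one]⟩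
  have hg2 : ∀ X, g'.val * τ.conjT (Φ X) = Φ (σ.conjT X) * g'.val := fun X => by
    have h1 := congrArg τ.conjT (hg1 (σ.conjT X))
    rw [σ.conjT_conjT, τ.conjT_mul, τ.conjT_mul, τ.conjT_conjT] at h1
    exact h1
  -- The matrix `g` and its conjugate transpose intertwine the same two involutions, so their
  -- quotient is central.
  have hcen : g.val * g'.inv ∈ Subring.center (Matrix (Fin m) (Fin m) B) := by
    refine Subring.mem_center_iff.2 fun Y => ?_
    obtain ⟨X, rfl⟩ : ∃ X, Φ (σ.conjT X) = Y := ⟨σ.conjT (Φ.symm Y), by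
      rw [σ.conjT_conjT, Φ.apply_symm_apply]⟩
    have h3 : τ.conjT (Φ X) * g'.inv = g'.inv * Φ (σ.conjT X) := by
      calc τ.conjT (Φ X) * g'.inv = g'.inv * (g'.val * τ.conjT (Φ X)) * g'.inv := by
            rw [← mul_assoc, g'.inv_val, one_mul]
        _ = _ := by rw [hg2, mul_assoc, mul_assoc, g'.val_inv, mul_one]
    rw [← mul_assoc, hg1, mul_assoc, h3, mul_assoc]
  obtain ⟨u, hu⟩ := Matrix.exists_algebraMap_of_mem_center hSB.exists_of_mem_center _ hcen
  have hgu : g.val = u • τ.conjT g.val := by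
    rw [Algebra.smul_def, hu, mul_assoc]
    change g.val = g.val * (g'.inv * g'.val)
    rw [g'.inv_val, mul_one]
  refine ⟨g, u, hinj ?_, hgu, hg1⟩
  -- Substituting `g = u • τ.conjT g` into itself gives `g = (u * ι u) • g`.
  have h4 : g.val = (u * ι u) • g.val := by
    conv_lhs => rw [hgu, hgu, τ.conjT_smul ι hιτ, τ.conjT_conjT, smul_smul]
  rw [map_one]
  calc algebraMap S _ (u * ι u) = ((u * ι u) • g.val) * g.inv := by
        rw [smul_mul_assoc, g.val_inv, Algebra.algebraMap_eq_smul_one]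
    _ = 1 := by rw [← h4, g.val_inv]

/-- A comparison matrix rescales to a `δ`-hermitian one. -/
theorem RingInvo.exists_hermitian_comparison
    (hιτ : ∀ s : S, (τ (algebraMap S B s)).unop = algebraMap S B (ι s))
    {n m : ℕ} {Φ : Matrix (Fin n) (Fin n) A ≃ₐ[S] Matrix (Fin m) (Fin m) B}
    {g : (Matrix (Fin m) (Fin m) B)ˣ} {u : S} (hgu : g.val = u • τ.conjT g.val)
    (hg : ∀ X, Φ (σ.conjT X) * g.val = g.val * τ.conjT (Φ X))
    {w δ : S} (hw : IsUnit w) (hδ : δ * δ = 1) (hwu : w * u = δ * ι w) :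
    ∃ J : Matrix (Fin m) (Fin m) B, IsUnit J ∧ τ.conjT J = δ • J ∧
      ∀ X, J * Φ (σ.conjT X) = τ.conjT (Φ X) * J := by
  obtain ⟨w, rfl⟩ := hw
  have hu : w.inv * w.val = 1 := w.inv_val
  have hGδ : τ.conjT (w.val • g.val) = δ • (w.val • g.val) := by
    have h1 : w.val • g.val = δ • τ.conjT (w.val • g.val) := by
      conv_lhs => rw [hgu, smul_smul, hwu, mul_smul]
      rw [τ.conjT_smul ι hιτ]
    conv_rhs => rw [h1, smul_smul, hδ, one_smul]
  -- The inverse is taken because `g` intertwines the two involutions in the direction opposite to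
  -- the one required of `J`.
  let J := w.inv • g.inv
  have hJG : J * (w.val • g.val) = 1 := by
    simp only [J, smul_mul_smul_comm, hu, g.inv_val, one_smul]
  have hGJ : (w.val • g.val) * J = 1 := by
    simp only [J, smul_mul_smul_comm, w.val_inv, g.val_inv, one_smul]
  refine ⟨J, ⟨⟨J, _, hJG, hGJ⟩, rfl⟩, ?_, fun X => ?_⟩
  · have h1 : τ.conjT J * (δ • (w.val • g.val)) = 1 := by
      rw [← hGδ, ← τ.conjT_mul, hGJ, τ.conjT_one]
    calc τ.conjT J = τ.conjT J * (δ • (w.val • g.val)) * (δ • J) := by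
          rw [mul_assoc, smul_mul_smul_comm, hδ, hGJ, one_smul, mul_one]
      _ = δ • J := by rw [h1, one_mul]
  · have h1 : Φ (σ.conjT X) * (w.val • g.val) = (w.val • g.val) * τ.conjT (Φ X) := by
      rw [mul_smul_comm, hg, smul_mul_assoc]
    calc J * Φ (σ.conjT X) = J * (Φ (σ.conjT X) * (w.val • g.val)) * J := by
          rw [mul_assoc, mul_assoc, hGJ, mul_one]
      _ = τ.conjT (Φ X) * J := by rw [h1, ← mul_assoc J, hJG, one_mul]

/-- The sign of an element of norm one when the involution of the centre is trivial. -/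
theorem IsConnectedRing.eq_one_or_neg_one (hS : IsConnectedRing S) (h2 : IsUnit (2 : S)) {u : S}
    (hu : u * u = 1) : u = 1 ∨ u = -1 := by
  obtain ⟨t, ht⟩ := h2.exists_left_inv
  -- With `u² = 1`, the element `(1 + u) / 2` is idempotent.
  rcases hS.2 (t * (1 + u)) (by
      change t * (1 + u) * (t * (1 + u)) = t * (1 + u)
      linear_combination t * t * hu + t * (1 + u) * ht) with h | h
  · right; linear_combination 2 * h - (1 + u) * ht
  · left; linear_combination 2 * h - (1 + u) * ht

/-- The existence of admitting forms: with some sign, and with both signs if the involution of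
the centre is nontrivial. -/
theorem exists_admittingForm (h2 : IsUnit (2 : R)) (hRsl : IsSemilocalRing R)
    (hR : IsConnectedRing R) (hσ : IsAzumayaWithInvolution R σ) (hτ : IsAzumayaWithInvolution R τ)
    (hSA : IsCentreOf S A) (hSB : IsCentreOf S B) (hS : IsConnectedRing S)
    (hAB : AzumayaBrauerEquivalent S A B)
    (hισ : ∀ s : S, (σ (algebraMap S A s)).unop = algebraMap S A (ι s))
    (hιτ : ∀ s : S, (τ (algebraMap S B s)).unop = algebraMap S B (ι s)) :
    ∃ δ₀ : S, (δ₀ = 1 ∨ δ₀ = -1) ∧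
      ∀ δ : S, (δ = 1 ∨ δ = -1) → (δ = δ₀ ∨ ¬ ∀ s, ι s = s) →
      ∃ Θ : AdmittingForm.{u, u, u} S σ τ (algebraMap S B δ), Θ.Nonsingular ∧
        ∀ ε : S, ι ε * ε = 1 → Θ.IsHermitianMorita ε := by
  have : Finite (MaximalSpectrum R) := hRsl
  have hq := hσ.isQuadraticInvolution hSA hισ
  have := hq.finite_maximalSpectrum
  have := hτ.projective
  obtain ⟨N, x, y, hxy⟩ := hτ.separable.exists_family
  have : Module.Finite R B := hxy.finite
  have : Module.Finite S B := Module.Finite.of_restrictScalars_finite R S B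
  obtain ⟨n, m, hn, hm, ⟨Φ⟩⟩ := hAB.exists_matrix_algEquiv hS
  let i₀ : Fin n := ⟨0, hn⟩
  let j₀ : Fin m := ⟨0, hm⟩
  obtain ⟨g, u, hu, hgu, hg⟩ := RingInvo.exists_conjT_comparison (hxy.extendScalars S) hSB
    hq.invol hισ hιτ j₀ Φ
  have main : ∀ δ w : S, (δ = 1 ∨ δ = -1) → IsUnit w → w * u = δ * ι w →
      ∃ Θ : AdmittingForm.{u, u, u} S σ τ (algebraMap S B δ), Θ.Nonsingular ∧
        ∀ ε : S, ι ε * ε = 1 → Θ.IsHermitianMorita ε := by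
    intro δ w hδ hw hwu
    have hδδ : δ * δ = 1 := by rcases hδ with rfl | rfl <;> simp
    obtain ⟨J, hJu, hJ, hΦ⟩ := RingInvo.exists_hermitian_comparison hιτ hgu hg hw hδδ hwu
    obtain ⟨D⟩ := Columns.nonempty_moritaData Φ i₀ σ τ J hδδ hJ hΦ hJu j₀
    exact ⟨_, Columns.nonsingular_admittingForm Φ i₀ σ τ J hδδ hJ hΦ hJu, fun ε _ =>
      D.isHermitianMorita ι hδδ hισ hιτ ε⟩
  have h2S : IsUnit (2 : S) := by
    have h := h2.map (algebraMap R S)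
    rwa [map_ofNat] at h
  by_cases hid : ∀ s, ι s = s
  · rw [hid] at hu
    have hu1 := hS.eq_one_or_neg_one h2S hu
    refine ⟨u, hu1, ?_⟩
    rintro δ hδ (rfl | hne)
    · exact main _ 1 hδ isUnit_one (by rw [map_one, mul_one, one_mul])
    · exact absurd hid hne
  · refine ⟨1, Or.inl rfl, fun δ hδ _ => ?_⟩
    have hδδ : δ * δ = 1 := by rcases hδ with rfl | rfl <;> simp
    have hδι : ι δ = δ := by rcases hδ with rfl | rfl <;> simp
    -- The unit `w = z + ι z * (δ * ι u)` satisfies `w * u = z * u + δ * ι z = δ * ι w`, since `u *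
    -- ι u = 1` and `δ² = 1`.
    obtain ⟨z, hz⟩ := hq.exists_isUnit_add
      (hq.exists_sub_notMem hR h2 hxy hSB.exists_of_mem_center hSB.injective hid)
      (δ * ι u) (by
        rw [map_mul, hq.invol, hδι]
        linear_combination u * ι u * hδδ + hu)
    refine main δ _ hδ hz ?_
    rw [map_add, map_mul, map_mul, hq.invol, hq.invol, hδι]
    linear_combination ι z * δ * hu - z * u * hδδ

end Existence

/-! ### Admitting forms that induce equivalences are Morita data -/

section ZeroForm

variable {A : Type u} [Ring A]

/-- The zero form on a module. -/
def HermForm.zero (σ : RingInvo A) (ε : A) (M : Type v) [AddCommGroup M] [Module Aᵐᵒᵖ M] :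
    HermForm σ ε M where
  toHom := 0
  smul_left _ _ _ := (mul_zero _).symm
  symm _ _ := by simp

/-- A module with the zero form. -/
def Herm.zeroForm (σ : RingInvo A) (ε : A) (M : Type v) [AddCommGroup M] [Module Aᵐᵒᵖ M]
    [Module.Finite Aᵐᵒᵖ M] [Module.Projective Aᵐᵒᵖ M] : Herm.{u, v} σ ε where
  carrier := M
  form := HermForm.zero σ ε M

end ZeroForm

namespace AdmittingForm

variable {S : Type*} {A B : Type u} [CommRing S] [Ring A] [Ring B]
variable [Algebra S A] [Algebra S B] {σ : RingInvo A} {τ : RingInvo B} {δ : S}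
variable (Θ : AdmittingForm.{u, u, u} S σ τ (algebraMap S B δ))

/-- Between zero forms every module isomorphism is an isometry. So on them the equivalence becomes a
statement about modules only, whatever `ε` is. -/
theorem prod_zero (ε : S) (M : Type u) [AddCommGroup M] [Module Aᵐᵒᵖ M]
    (t t' : BimodTensor A B M Θ.carrier) :
    (Θ.prod (HermForm.zero σ (algebraMap S A ε) M)).toHom t t' = 0 := by
  induction t using BimodTensor.induction with
  | zero => rw [map_zero, LinearMap.zero_apply]
  | add s t hs ht => rw [map_add, LinearMap.add_apply, hs, ht, add_zero]
  | tmul m p =>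
    induction t' using BimodTensor.induction with
    | zero => rw [map_zero]
    | add s t hs ht => rw [map_add, hs, ht, add_zero]
    | tmul m' q =>
      rw [prod_tmul]
      change Θ.form.toHom p ((0 : A) • q) = 0
      rw [zero_smul, map_zero]

/-- The elementary automorphism `(x, y) ↦ (x + a y, y)`. -/
def shear (a : A) : (A × A) ≃ₗ[Aᵐᵒᵖ] (A × A) where
  toFun x := (x.1 + a * x.2, x.2)
  invFun x := (x.1 - a * x.2, x.2)
  left_inv x := by simp
  right_inv x := by simp
  map_add' x y := by ext <;> simp [mul_add]; abel
  map_smul' b x := by ext <;> simp [mul_assoc]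

/-- The isometry of a zero form given by an elementary automorphism. -/
def shearIsometry (ε : A) (a : A) :
    Herm.zeroForm σ ε (A × A) ⟶ Herm.zeroForm σ ε (A × A) :=
  (⟨shear a, fun _ _ => rfl⟩ : Herm.Isometry _ _)

theorem tmul_prod (x y : A) (p : Θ.carrier) :
    BimodTensor.tmul A B ((x, y) : A × A) p =
      BimodTensor.tmul A B ((1, 0) : A × A) (x • p) +
        BimodTensor.tmul A B ((0, 1) : A × A) (y • p) := by
  rw [← BimodTensor.smul_tmul, ← BimodTensor.smul_tmul, ← BimodTensor.add_tmul]
  simp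

/-- The category contains isomorphisms only, so an element `a` is encoded in the automorphism `shear
a` of `A × A`. Elements acting alike on `P` give shears with the same image, and the functor is
faithful. -/
theorem eq_of_forall_smul_eq {ε : S} (hΘ : Θ.IsHermitianMorita ε) (a b : A)
    (hab : ∀ p : Θ.carrier, a • p = b • p) : a = b := by
  have := hΘ.isEquivalence
  have h1 : (Θ.functor ε).map (shearIsometry (algebraMap S A ε) a) =
      (Θ.functor ε).map (shearIsometry (algebraMap S A ε) b) := by
    refine Herm.Isometry.ext (LinearEquiv.toLinearMap_injective (BimodTensor.hom_ext ?_))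
    rintro ⟨x, y⟩ p
    change BimodTensor.tmul A B ((x + a * y, y) : A × A) p =
      BimodTensor.tmul A B ((x + b * y, y) : A × A) p
    rw [tmul_prod, tmul_prod Θ (x + b * y), add_smul, add_smul, mul_smul, mul_smul, hab]
  have h2 := (Θ.functor ε).map_injective h1
  have h3 : (shear a ((0, 1) : A × A)) = shear b (0, 1) :=
    congrArg (fun f : Herm.Isometry (Herm.zeroForm σ (algebraMap S A ε) (A × A))
      (Herm.zeroForm σ (algebraMap S A ε) (A × A)) => f.toEquiv ((0, 1) : A × A)) h2
  simpa [shear] using h3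

/-- The first component `(x, y) ⊗ p ↦ x p`. -/
noncomputable def fstSMul : BimodTensor A B (A × A) Θ.carrier →ₗ[Bᵐᵒᵖ] Θ.carrier :=
  BimodTensor.lift
    (AddMonoidHom.mk' (fun x => DistribSMul.toLinearMap Bᵐᵒᵖ Θ.carrier x.1)
      (fun x y => LinearMap.ext fun p => add_smul x.1 y.1 p))
    (fun a x p => mul_smul x.1 a p)

/-- The second component `(x, y) ⊗ p ↦ y p`. -/
noncomputable def sndSMul : BimodTensor A B (A × A) Θ.carrier →ₗ[Bᵐᵒᵖ] Θ.carrier :=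
  BimodTensor.lift
    (AddMonoidHom.mk' (fun x => DistribSMul.toLinearMap Bᵐᵒᵖ Θ.carrier x.2)
      (fun x y => LinearMap.ext fun p => add_smul x.2 y.2 p))
    (fun a x p => mul_smul x.2 a p)

theorem fstSMul_tmul (x : A × A) (p : Θ.carrier) :
    Θ.fstSMul (BimodTensor.tmul A B x p) = x.1 • p := rfl

theorem sndSMul_tmul (x : A × A) (p : Θ.carrier) :
    Θ.sndSMul (BimodTensor.tmul A B x p) = x.2 • p := rfl

/-- The inclusion `p ↦ (1, 0) ⊗ p`. -/
noncomputable def inlTmul : Θ.carrier →ₗ[Bᵐᵒᵖ] BimodTensor A B (A × A) Θ.carrier where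
  toFun p := BimodTensor.tmul A B ((1, 0) : A × A) p
  map_add' p q := BimodTensor.tmul_add A B _ p q
  map_smul' b p := BimodTensor.tmul_smul A B b _ p

theorem sndSMul_inlTmul (p : Θ.carrier) : Θ.sndSMul (Θ.inlTmul p) = 0 :=
  zero_smul A p

theorem fstSMul_inlTmul (p : Θ.carrier) : Θ.fstSMul (Θ.inlTmul p) = p :=
  one_smul A p

/-- An endomorphism `G` is encoded in the unipotent automorphism `1 + N` of `(A × A) ⊗ P`. By
fullness it comes from an automorphism of `A × A`, and `a` is the first coordinate of the image of
`(0, 1)`. -/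
theorem exists_eq_smul {ε : S} (hΘ : Θ.IsHermitianMorita ε) (G : Θ.carrier →ₗ[Bᵐᵒᵖ] Θ.carrier) :
    ∃ a : A, ∀ p, G p = a • p := by
  have := hΘ.isEquivalence
  let N : BimodTensor A B (A × A) Θ.carrier →ₗ[Bᵐᵒᵖ] BimodTensor A B (A × A) Θ.carrier :=
    Θ.inlTmul ∘ₗ G ∘ₗ Θ.sndSMul
  have hN : ∀ t, N (N t) = 0 := fun t => by
    simp only [N, LinearMap.comp_apply, sndSMul_inlTmul, map_zero]
  let e : BimodTensor A B (A × A) Θ.carrier ≃ₗ[Bᵐᵒᵖ] BimodTensor A B (A × A) Θ.carrier :=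
    LinearEquiv.ofLinearMap (LinearMap.id + N) (LinearMap.id - N)
      (LinearMap.ext fun t => by simp [hN])
      (LinearMap.ext fun t => by simp [hN])
  let X := Herm.zeroForm σ (algebraMap S A ε) (A × A)
  let i : (Θ.functor ε).obj X ⟶ (Θ.functor ε).obj X :=
    (⟨e, fun t t' => (Θ.prod_zero ε (A × A) _ _).trans
      (Θ.prod_zero ε (A × A) _ _).symm⟩ : Herm.Isometry _ _)
  obtain ⟨f, hf⟩ := (Θ.functor ε).map_surjective i
  let x : A × A := (show Herm.Isometry X X from f).toEquiv ((0, 1) : A × A)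
  have h1 : ∀ p : Θ.carrier, BimodTensor.tmul A B x p =
      BimodTensor.tmul A B ((0, 1) : A × A) p + N (BimodTensor.tmul A B ((0, 1) : A × A) p) :=
    fun p => congrArg (fun j : Herm.Isometry ((Θ.functor ε).obj X) ((Θ.functor ε).obj X) =>
      j.toEquiv (BimodTensor.tmul A B ((0, 1) : A × A) p)) hf
  refine ⟨x.1, fun p => ?_⟩
  have h2 := congrArg Θ.fstSMul (h1 p)
  rw [map_add, fstSMul_tmul, fstSMul_tmul, zero_smul, zero_add] at h2
  simp only [N, LinearMap.comp_apply, fstSMul_inlTmul, sndSMul_tmul, one_smul] at h2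
  exact h2.symm

/-- By essential surjectivity `B` is isomorphic to some `X ⊗_A P`, a summand of a power of `P`. The
components of the resulting map onto `B` are the functionals. -/
theorem exists_sum_eq_one {ε : S} (hΘ : Θ.IsHermitianMorita ε) :
    ∃ (n : ℕ) (f : Fin n → (Θ.carrier →ₗ[Bᵐᵒᵖ] B)) (p : Fin n → Θ.carrier),
      ∑ j, f j (p j) = 1 := by
  have := hΘ.isEquivalence
  let Y := Herm.zeroForm τ (algebraMap S B (δ * ε)) B
  let X := (Θ.functor ε).objPreimage Y
  let i : Herm.Isometry ((Θ.functor ε).obj X) Y := ((Θ.functor ε).objObjPreimageIso Y).hom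
  let i' : BimodTensor A B X.carrier Θ.carrier ≃ₗ[Bᵐᵒᵖ] B := i.toEquiv
  obtain ⟨n, s, r, hr⟩ := BimodTensor.exists_retract A B X.carrier Θ.carrier
  let v := s (i'.symm 1)
  have hv : i' (r v) = 1 := by
    have : r v = i'.symm 1 := LinearMap.congr_fun hr _
    rw [this, i'.apply_symm_apply]
  refine ⟨n, fun j => i'.toLinearMap ∘ₗ r ∘ₗ LinearMap.single Bᵐᵒᵖ (fun _ => Θ.carrier) j, v, ?_⟩
  simp only [LinearMap.comp_apply, LinearMap.coe_single, LinearEquiv.coe_coe]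
  rw [← map_sum, ← map_sum, Finset.univ_sum_single, hv]

theorem IsHermitianMorita.nonempty_moritaData {ε : S} (hΘ : Θ.IsHermitianMorita ε)
    (hns : Θ.Nonsingular) : Nonempty (MoritaData Θ) :=
  Θ.nonempty_moritaData hns (Θ.exists_eq_smul hΘ) (Θ.eq_of_forall_smul_eq hΘ)
    (Θ.exists_sum_eq_one hΘ)

end AdmittingForm

/-! ### The sign of an involution of a split algebra -/

theorem isCompl_eqLocus_neg {R V : Type*} [CommRing R] [AddCommGroup V] [Module R V]
    (h2 : IsUnit (2 : R)) (T : V →ₗ[R] V) (hT : ∀ v, T (T v) = v) :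
    IsCompl (LinearMap.eqLocus T LinearMap.id) (LinearMap.eqLocus T (-LinearMap.id)) := by
  obtain ⟨c, hc⟩ := h2.exists_left_inv
  constructor
  · refine Submodule.disjoint_def.2 fun v hv hv' => ?_
    have h1 : T v = v := hv
    have h3 : T v = -v := hv'
    have h4 : (2 : R) • v = 0 := by rw [two_smul]; nth_rewrite 1 [← h1]; rw [h3, neg_add_cancel]
    rw [← one_smul R v, ← hc, mul_smul, h4, smul_zero]
  · refine codisjoint_iff.2 (eq_top_iff.2 fun v _ => Submodule.mem_sup.2
      ⟨c • (v + T v), ?_, c • (v - T v), ?_, ?_⟩)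
    · change T _ = _
      rw [map_smul, map_add, hT, add_comm, LinearMap.id_apply]
    · change T _ = _
      rw [map_smul, map_sub, hT, LinearMap.neg_apply, LinearMap.id_apply, ← smul_neg, neg_sub]
    · rw [← smul_add, add_add_sub_cancel, smul_add, ← add_smul, ← mul_two, hc, one_smul]

/-- The space of `α`-symmetric matrices. -/
def Matrix.signSymm (K : Type*) [Field K] (n : Type*) (α : K) :
    Submodule K (Matrix n n K) :=
  LinearMap.eqLocus (Matrix.transposeLinearEquiv n n K K).toLinearMap (α • LinearMap.id)

theorem Matrix.mem_signSymm {K : Type*} [Field K] {n : Type*} {α : K} {Y : Matrix n n K} :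
    Y ∈ Matrix.signSymm K n α ↔ Y.transpose = α • Y := Iff.rfl

/-- Symmetric matrices are functions on unordered pairs of indices. -/
theorem Matrix.two_mul_finrank_signSymm_one (K : Type*) [Field K] (n : ℕ) :
    2 * Module.finrank K (Matrix.signSymm K (Fin n) 1) = n * (n + 1) := by
  let e : Matrix.signSymm K (Fin n) 1 ≃ₗ[K] (Sym2 (Fin n) → K) :=
    { toFun := fun Y => Sym2.lift ⟨fun i j => Y.1 i j, fun i j => by
        have h1 := congrFun (congrFun (Matrix.mem_signSymm.1 Y.2) j) i
        simpa using h1⟩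
      invFun := fun f => ⟨Matrix.of fun i j => f s(i, j), Matrix.mem_signSymm.2 (by
        ext i j; simp [Sym2.eq_swap])⟩
      left_inv := fun Y => by ext i j; rfl
      right_inv := fun f => by
        funext z
        induction z using Sym2.ind with
        | _ i j => rfl
      map_add' := fun Y Z => by
        funext z
        induction z using Sym2.ind with
        | _ i j => rfl
      map_smul' := fun c Y => by
        funext z
        induction z using Sym2.ind with
        | _ i j => rfl }
  rw [e.finrank_eq, Module.finrank_fintype_fun_eq_card, Sym2.card, Fintype.card_fin,
    Nat.choose_two_right, Nat.add_sub_cancel, mul_comm (n + 1),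
    Nat.two_mul_div_two_of_even (Nat.even_mul_succ_self n)]

theorem Matrix.two_mul_finrank_signSymm_neg_one (K : Type*) [Field K] (h2 : (2 : K) ≠ 0) (n : ℕ) :
    2 * Module.finrank K (Matrix.signSymm K (Fin n) (-1)) = n * (n - 1) := by
  have h1 := Submodule.finrank_add_eq_of_isCompl (isCompl_eqLocus_neg (isUnit_iff_ne_zero.2 h2)
    (Matrix.transposeLinearEquiv (Fin n) (Fin n) K K).toLinearMap
    (fun Y => Matrix.transpose_transpose Y))
  have h3 : Matrix.signSymm K (Fin n) 1 = LinearMap.eqLocus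
      (Matrix.transposeLinearEquiv (Fin n) (Fin n) K K).toLinearMap LinearMap.id := by
    rw [Matrix.signSymm, one_smul]
  have h4 : Matrix.signSymm K (Fin n) (-1) = LinearMap.eqLocus
      (Matrix.transposeLinearEquiv (Fin n) (Fin n) K K).toLinearMap (-LinearMap.id) :=
    Submodule.ext fun Y => by
      change Y.transpose = (-1 : K) • Y ↔ Y.transpose = -Y
      rw [neg_one_smul]
  rw [← h3, ← h4, Module.finrank_matrix, Module.finrank_self, Fintype.card_fin] at h1
  have h5 := Matrix.two_mul_finrank_signSymm_one K n
  -- The case `n = 0` is split off because `n - 1` is a truncated subtraction.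
  cases n with
  | zero => omega
  | succ n =>
    rw [Nat.add_sub_cancel]
    nlinarith

/-- The sign `α` of the `K`-linear anti-automorphism `s` of a split central simple algebra: `E` is
a primitive idempotent, and `s` acts on the nonzero space `s(E) D E` as `α`. -/
structure HasInvolutionSign {K D : Type*} [Field K] [Ring D] [Algebra K D] (s : D →ₗ[K] D) (α : K)
    (E x : D) : Prop where
  mul_self : E * E = E
  ne_zero : E ≠ 0
  corner : ∀ d, ∃ c : K, E * d * E = c • E
  full : ∃ (n : ℕ) (c d : Fin n → D), ∑ k, c k * E * d k = 1
  x_ne_zero : x ≠ 0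
  left : s E * x = x
  right : x * E = x
  map : ∀ d, s (s E * d * E) = α • (s E * d * E)

theorem HasInvolutionSign.of_algEquiv {K D C : Type*} [Field K] [Ring D] [Algebra K D] [Ring C]
    [Algebra K C] (e : D ≃ₐ[K] C) {s : D →ₗ[K] D} {α : K} {E x : C}
    (h : HasInvolutionSign (e.toLinearMap ∘ₗ s ∘ₗ e.symm.toLinearMap) α E x) :
    HasInvolutionSign s α (e.symm E) (e.symm x) where
  mul_self := by rw [← map_mul, h.mul_self]
  ne_zero := (EmbeddingLike.map_ne_zero_iff (f := e.symm)).2 h.ne_zero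
  corner d := by
    obtain ⟨c, hc⟩ := h.corner (e d)
    exact ⟨c, e.injective (by simpa using hc)⟩
  full := by
    obtain ⟨n, c, d, hcd⟩ := h.full
    exact ⟨n, fun k => e.symm (c k), fun k => e.symm (d k), by
      simp_rw [← map_mul, ← map_sum, hcd, map_one]⟩
  x_ne_zero := (EmbeddingLike.map_ne_zero_iff (f := e.symm)).2 h.x_ne_zero
  left := e.injective (by simpa using h.left)
  right := e.injective (by simpa using h.right)
  map d := e.injective (by simpa using h.map (e d))

section MatrixSign

open Matrix

variable {K : Type*} [Field K] {n : ℕ} (s : Matrix (Fin n) (Fin n) K →ₗ[K] Matrix (Fin n) (Fin n) K)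

/-- An involution of a matrix algebra is the transpose followed by a conjugation. -/
theorem exists_eq_conj_transpose (i₀ : Fin n) (hmul : ∀ X Y, s (X * Y) = s Y * s X)
    (hs : ∀ X, s (s X) = X) :
    ∃ (h : (Matrix (Fin n) (Fin n) K)ˣ) (α : K), (α = 1 ∨ α = -1) ∧ h.valᵀ = α • h.val ∧
      ∀ X, s X * h.val = h.val * Xᵀ := by
  have hone : s 1 = 1 := by
    have h1 := hmul (s 1) 1
    rw [mul_one, hs, mul_one] at h1
    exact h1.symm
  let φ : Matrix (Fin n) (Fin n) K ≃ₐ[K] Matrix (Fin n) (Fin n) K :=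
    AlgEquiv.ofLinearEquiv
      { toFun := fun X => s Xᵀ
        invFun := fun X => (s X)ᵀ
        left_inv := fun X => by simp [hs]
        right_inv := fun X => by simp [hs]
        map_add' := fun X Y => by simp
        map_smul' := fun c X => by simp }
      (by change s 1ᵀ = 1; rw [transpose_one, hone])
      (fun X Y => by
        change s (X * Y)ᵀ = s Xᵀ * s Yᵀ
        rw [transpose_mul, hmul])
  -- The field is separable over itself by `1 ⊗ 1`, so Skolem–Noether applies to the automorphism `X
  -- ↦ s(Xᵀ)`.
  have hK : IsSeparabilityFamily K (fun _ : Unit => (1 : K)) (fun _ => 1) :=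
    ⟨by simp, fun b => by
      have h1 := TensorProduct.smul_tmul (R := K) b (1 : K) (1 : K)
      simp only [smul_eq_mul, mul_one] at h1
      simp only [mul_one, one_mul, h1]⟩
  have hcen := Matrix.exists_algebraMap_of_mem_center (S := K) (B := K)
    (fun z _ => ⟨z, rfl⟩) (m := Fin n)
  have hinj : Function.Injective (algebraMap K (Matrix (Fin n) (Fin n) K)) := fun a b hab => by
    have h1 := congrFun (congrFun hab i₀) i₀
    simpa [Matrix.algebraMap_matrix_apply] using h1
  obtain ⟨h, hh⟩ := (hK.matrix i₀).exists_conj hcen hinj φ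
  have hh1 : ∀ X, s X * h.val = h.val * Xᵀ := fun X => by
    have h1 := hh Xᵀ
    change s Xᵀᵀ * h.val = _ at h1
    rwa [transpose_transpose] at h1
  have hT1 : h.valᵀ * h.invᵀ = 1 := by rw [← transpose_mul, h.inv_val, transpose_one]
  have hh2 : ∀ X, s X * h.valᵀ = h.valᵀ * Xᵀ := fun X => by
    have h1 := congrArg transpose (hh1 (s X))
    rw [hs, transpose_mul, transpose_mul, transpose_transpose] at h1
    exact h1.symm
  -- Both `h` and its transpose conjugate the transpose into `s`, so they are proportional;
  -- transposing twice gives `α² = 1`.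
  have hZ : h.inv * h.valᵀ ∈ Subring.center (Matrix (Fin n) (Fin n) K) := by
    refine Subring.mem_center_iff.2 fun Y => ?_
    have h3 : Y * h.inv = h.inv * s Yᵀ := by
      have h4 := hh1 Yᵀ
      rw [transpose_transpose] at h4
      calc Y * h.inv = h.inv * (h.val * Y) * h.inv := by rw [← mul_assoc, h.inv_val, one_mul]
        _ = _ := by rw [← h4, mul_assoc, mul_assoc, h.val_inv, mul_one]
    rw [← mul_assoc, h3, mul_assoc, hh2, transpose_transpose, mul_assoc]
  obtain ⟨α, hα⟩ := hcen _ hZ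
  have hα1 : h.valᵀ = α • h.val := by
    calc h.valᵀ = h.val * (h.inv * h.valᵀ) := by rw [← mul_assoc, h.val_inv, one_mul]
      _ = _ := by rw [← hα, ← Algebra.commutes, ← Algebra.smul_def]
  refine ⟨h, α, ?_, hα1, hh1⟩
  have h5 : (α * α) • h.val = h.val := by
    conv_rhs => rw [← transpose_transpose h.val, hα1, transpose_smul, hα1, smul_smul]
  have h6 : α * α = 1 := hinj (by
    rw [map_one]
    calc algebraMap K _ (α * α) = ((α * α) • h.val) * h.inv := by
          rw [smul_mul_assoc, h.val_inv, Algebra.algebraMap_eq_smul_one]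
      _ = 1 := by rw [h5, h.val_inv])
  exact mul_self_eq_one_iff.1 h6

/-- With `s X = h Xᵀ h⁻¹` and `hᵀ = α h`, the map `X ↦ X h` takes `s`-symmetric matrices to
`α`-symmetric ones, which gives the dimension. For a diagonal matrix unit `E`, the space `s(E) D E`
is the line through `h E`, and `s (h E) = h E hᵀ h⁻¹ = α h E`. -/
theorem exists_hasInvolutionSign_matrix (h2 : (2 : K) ≠ 0) (i₀ : Fin n)
    (hmul : ∀ X Y, s (X * Y) = s Y * s X) (hs : ∀ X, s (s X) = X) :
    ∃ α : K, (α = 1 ∧ 2 * Module.finrank K (LinearMap.eqLocus s LinearMap.id) = n * (n + 1) ∨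
      α = -1 ∧ 2 * Module.finrank K (LinearMap.eqLocus s LinearMap.id) = n * (n - 1)) ∧
      ∃ E x, HasInvolutionSign s α E x := by
  obtain ⟨h, α, hα, hα1, hh⟩ := exists_eq_conj_transpose s i₀ hmul hs
  have hαα : α * α = 1 := by rcases hα with rfl | rfl <;> simp
  have hsX : ∀ X, s X = h.val * Xᵀ * h.inv := fun X => by
    rw [← hh, mul_assoc, h.val_inv, mul_one]
  let e : LinearMap.eqLocus s LinearMap.id ≃ₗ[K] Matrix.signSymm K (Fin n) α :=
    { toFun := fun X => ⟨X.1 * h.val, mem_signSymm.2 (by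
        have h1 : s X.1 = X.1 := X.2
        rw [transpose_mul, hα1, smul_mul_assoc, ← hh, h1])⟩
      invFun := fun Y => ⟨Y.1 * h.inv, by
        change s (Y.1 * h.inv) = Y.1 * h.inv
        have h3 : h.val * h.invᵀ = α • 1 := by
          have h4 : h.valᵀ * h.invᵀ = 1 := by rw [← transpose_mul, h.inv_val, transpose_one]
          rw [hα1, smul_mul_assoc] at h4
          rw [← h4, smul_smul, hαα, one_smul]
        rw [hsX, transpose_mul, ← mul_assoc, h3, mem_signSymm.1 Y.2, smul_mul_assoc, one_mul,
          smul_smul, hαα, one_smul]⟩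
      left_inv := fun X => Subtype.ext (by
        change X.1 * h.val * h.inv = X.1
        rw [mul_assoc, h.val_inv, mul_one])
      right_inv := fun Y => Subtype.ext (by
        change Y.1 * h.inv * h.val = Y.1
        rw [mul_assoc, h.inv_val, mul_one])
      map_add' := fun X Y => Subtype.ext (add_mul _ _ _)
      map_smul' := fun c X => Subtype.ext (smul_mul_assoc _ _ _) }
  refine ⟨α, ?_, single i₀ i₀ 1, h.val * single i₀ i₀ 1, ?_⟩
  · rw [e.finrank_eq]
    rcases hα with rfl | rfl
    · exact Or.inl ⟨rfl, two_mul_finrank_signSymm_one K n⟩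
    · exact Or.inr ⟨rfl, two_mul_finrank_signSymm_neg_one K h2 n⟩
  have hE : (single i₀ i₀ (1 : K)) * single i₀ i₀ 1 = single i₀ i₀ 1 := by
    rw [single_mul_single_same, one_mul]
  have hET : (single i₀ i₀ (1 : K))ᵀ = single i₀ i₀ 1 := transpose_single _ _ _
  have hsE : s (single i₀ i₀ 1) = h.val * single i₀ i₀ 1 * h.inv := by rw [hsX, hET]
  have hEne : (single i₀ i₀ (1 : K)) ≠ 0 := fun h0 => by
    have := congrFun (congrFun h0 i₀) i₀
    simp at this
  have corner : ∀ d : Matrix (Fin n) (Fin n) K, ∃ c : K,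
      single i₀ i₀ 1 * d * single i₀ i₀ 1 = c • single i₀ i₀ (1 : K) := fun d => ⟨d i₀ i₀, by
    rw [single_mul_mul_single, one_mul, mul_one, smul_single, smul_eq_mul, mul_one]⟩
  refine ⟨hE, hEne, corner, ⟨n, fun k => single k i₀ 1, fun k => single i₀ k 1, ?_⟩, ?_, ?_, ?_, ?_⟩
  · simp only [single_mul_single_same, mul_one]
    exact sum_single_one
  · intro h0
    refine hEne ?_
    rw [← one_mul (single i₀ i₀ (1 : K)), ← h.inv_val, mul_assoc, h0, mul_zero]
  · rw [hsE, mul_assoc, ← mul_assoc h.inv, h.inv_val, one_mul, mul_assoc, hE]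
  · rw [mul_assoc, hE]
  · intro d
    obtain ⟨c, hc⟩ := corner (h.inv * d)
    have h3 : s (single i₀ i₀ 1) * d * single i₀ i₀ 1 = c • (h.val * single i₀ i₀ 1) := by
      rw [hsE, ← mul_smul_comm, ← hc]
      simp only [mul_assoc]
    rw [h3, map_smul, hsX, transpose_mul, hET, hα1, mul_smul_comm, mul_smul_comm, smul_mul_assoc,
      mul_assoc, mul_assoc, h.val_inv, mul_one, smul_comm]

end MatrixSign

/-- An involution of a central simple algebra over an algebraically closed field has a sign, which
determines the dimension of the space of symmetric elements. -/
theorem exists_hasInvolutionSign {K D : Type*} [Field K] [IsAlgClosed K] [Ring D] [Algebra K D]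
    [IsSimpleRing D] [FiniteDimensional K D] (h2 : (2 : K) ≠ 0) (s : D →ₗ[K] D)
    (hmul : ∀ a b, s (a * b) = s b * s a) (hs : ∀ a, s (s a) = a) :
    ∃ (n : ℕ) (α : K), 0 < n ∧ Module.finrank K D = n ^ 2 ∧
      (α = 1 ∧ 2 * Module.finrank K (LinearMap.eqLocus s LinearMap.id) = n * (n + 1) ∨
        α = -1 ∧ 2 * Module.finrank K (LinearMap.eqLocus s LinearMap.id) = n * (n - 1)) ∧
      ∃ E x, HasInvolutionSign s α E x := by
  obtain ⟨n, hn, ⟨e⟩⟩ := IsSimpleRing.exists_algEquiv_matrix_of_isAlgClosed K D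
  have hn' : 0 < n := Nat.pos_of_ne_zero hn.out
  let t := e.toLinearMap ∘ₗ s ∘ₗ e.symm.toLinearMap
  obtain ⟨α, hα, E, x, hEx⟩ := exists_hasInvolutionSign_matrix t h2 ⟨0, hn'⟩
    (fun X Y => by simp [t, hmul]) (fun X => by simp [t, hs])
  let f : LinearMap.eqLocus s LinearMap.id ≃ₗ[K] LinearMap.eqLocus t LinearMap.id :=
    { toFun := fun a => ⟨e a.1, by
        have h1 : s a.1 = a.1 := a.2
        change t (e a.1) = e a.1
        simp [t, h1]⟩
      invFun := fun X => ⟨e.symm X.1, by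
        have h1 : e (s (e.symm X.1)) = X.1 := X.2
        change s (e.symm X.1) = e.symm X.1
        exact e.injective (by rw [h1, e.apply_symm_apply])⟩
      left_inv := fun a => Subtype.ext (e.symm_apply_apply _)
      right_inv := fun X => Subtype.ext (e.apply_symm_apply _)
      map_add' := fun a b => Subtype.ext (map_add e _ _)
      map_smul' := fun c a => Subtype.ext (map_smul e _ _) }
  refine ⟨n, α, hn', ?_, ?_, _, _, HasInvolutionSign.of_algEquiv e hEx⟩
  · rw [e.toLinearEquiv.finrank_eq, Module.finrank_matrix, Module.finrank_self, Fintype.card_fin]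
    ring
  · rwa [f.finrank_eq]

/-! ### Scalar extension of Morita contexts and comparison of signs -/

/-- Scalar extension of bilinear maps. -/
noncomputable def LinearMap.baseChange₂ {R : Type*} [CommRing R] (K : Type*) [CommRing K]
    [Algebra R K] {M N Q : Type*} [AddCommGroup M] [AddCommGroup N] [AddCommGroup Q] [Module R M]
    [Module R N] [Module R Q] (f : M →ₗ[R] N →ₗ[R] Q) :
    K ⊗[R] M →ₗ[K] K ⊗[R] N →ₗ[K] K ⊗[R] Q :=
  (LinearMap.baseChangeHom R K N Q ∘ₗ f).liftBaseChange K

@[simp]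
theorem LinearMap.baseChange₂_tmul {R : Type*} [CommRing R] (K : Type*) [CommRing K]
    [Algebra R K] {M N Q : Type*} [AddCommGroup M] [AddCommGroup N] [AddCommGroup Q] [Module R M]
    [Module R N] [Module R Q] (f : M →ₗ[R] N →ₗ[R] Q) (k l : K) (m : M) (n : N) :
    f.baseChange₂ K (k ⊗ₜ m) (l ⊗ₜ n) = (k * l) ⊗ₜ f m n := by
  simp [LinearMap.baseChange₂, TensorProduct.smul_tmul']

/-- The identities between the left and right actions `l`, `r` on `P`, the `δ`-hermitian forms `θ`
and `η` and the involutions `s` and `t` in a Morita context with involutions. -/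
structure IsInvolutiveMorita {R A B P : Type*} [CommRing R] [Ring A] [Ring B] [Algebra R A]
    [Algebra R B] [AddCommGroup P] [Module R P] (s : A →ₗ[R] A) (t : B →ₗ[R] B)
    (l : A →ₗ[R] P →ₗ[R] P) (r : P →ₗ[R] B →ₗ[R] P) (θ : P →ₗ[R] P →ₗ[R] B)
    (η : P →ₗ[R] P →ₗ[R] A) (δ : R) : Prop where
  s_mul : ∀ a b, s (a * b) = s b * s a
  l_mul : ∀ a b p, l (a * b) p = l a (l b p)
  r_one : ∀ p, r p 1 = p
  r_mul : ∀ p b c, r p (b * c) = r (r p b) c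
  l_r : ∀ a p b, l a (r p b) = r (l a p) b
  η_l : ∀ a p q, η (l a p) q = a * η p q
  η_r : ∀ p b q, η (r p b) q = η p (r q (t b))
  l_η : ∀ p q x, l (η p q) x = r p (θ q x)
  η_symm : ∀ p q, η q p = δ • s (η p q)
  θ_symm : ∀ p q, t (θ p q) = δ • θ q p
  θ_l : ∀ a p q, θ (l a p) q = θ p (l (s a) q)
  θ_r : ∀ p q b, θ p (r q b) = θ p q * b
  θ_r_left : ∀ p b q, θ (r p b) q = t b * θ p q
  exists_sum : ∃ (n : ℕ) (p q : Fin n → P), ∑ i, η (p i) (q i) = 1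

namespace IsInvolutiveMorita

/-- Every identity is multilinear, so pure tensors suffice. This is why the context is recorded by
bilinear maps over `R` instead of module structures. -/
theorem baseChange {R A B P : Type*} [CommRing R] [Ring A] [Ring B] [Algebra R A]
    [Algebra R B] [AddCommGroup P] [Module R P] {s : A →ₗ[R] A} {t : B →ₗ[R] B}
    {l : A →ₗ[R] P →ₗ[R] P} {r : P →ₗ[R] B →ₗ[R] P} {θ : P →ₗ[R] P →ₗ[R] B}
    {η : P →ₗ[R] P →ₗ[R] A} {δ : R} (h : IsInvolutiveMorita s t l r θ η δ)
    (K : Type*) [CommRing K] [Algebra R K] :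
    IsInvolutiveMorita (s.baseChange K) (t.baseChange K) (l.baseChange₂ K) (r.baseChange₂ K)
      (θ.baseChange₂ K) (η.baseChange₂ K) (algebraMap R K δ) where
  s_mul a b := by
    induction a with
    | zero => simp
    | add a a' ha ha' => simp only [add_mul, mul_add, map_add, ha, ha']
    | tmul k a =>
      induction b with
      | zero => simp
      | add b b' hb hb' => simp only [add_mul, mul_add, map_add, hb, hb']
      | tmul k' b => simp [h.s_mul, mul_comm]
  l_mul a b p := by
    induction a with
    | zero => simp
    | add a a' ha ha' => simp only [add_mul, map_add, LinearMap.add_apply, ha, ha']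
    | tmul k a =>
      induction b with
      | zero => simp
      | add b b' hb hb' => simp only [mul_add, map_add, LinearMap.add_apply, hb, hb']
      | tmul k' b =>
        induction p with
        | zero => simp
        | add p p' hp hp' => simp only [map_add, hp, hp']
        | tmul k'' p => simp [h.l_mul, mul_assoc]
  r_one p := by
    induction p with
    | zero => simp
    | add p p' hp hp' => simp only [map_add, LinearMap.add_apply, hp, hp']
    | tmul k p => rw [Algebra.TensorProduct.one_def, LinearMap.baseChange₂_tmul, h.r_one, mul_one]
  r_mul p b c := by
    induction p with
    | zero => simp
    | add p p' hp hp' => simp only [map_add, LinearMap.add_apply, hp, hp']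
    | tmul k p =>
      induction b with
      | zero => simp
      | add b b' hb hb' => simp only [add_mul, map_add, LinearMap.add_apply, hb, hb']
      | tmul k' b =>
        induction c with
        | zero => simp
        | add c c' hc hc' => simp only [mul_add, map_add, hc, hc']
        | tmul k'' c => simp [h.r_mul, mul_assoc]
  l_r a p b := by
    induction a with
    | zero => simp
    | add a a' ha ha' => simp only [map_add, LinearMap.add_apply, ha, ha']
    | tmul k a =>
      induction p with
      | zero => simp
      | add p p' hp hp' => simp only [map_add, LinearMap.add_apply, hp, hp']
      | tmul k' p =>
        induction b with
        | zero => simp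
        | add b b' hb hb' => simp only [map_add, hb, hb']
        | tmul k'' b => simp [h.l_r, mul_assoc]
  η_l a p q := by
    induction a with
    | zero => simp
    | add a a' ha ha' => simp only [add_mul, map_add, LinearMap.add_apply, ha, ha']
    | tmul k a =>
      induction p with
      | zero => simp
      | add p p' hp hp' => simp only [mul_add, map_add, LinearMap.add_apply, hp, hp']
      | tmul k' p =>
        induction q with
        | zero => simp
        | add q q' hq hq' => simp only [mul_add, map_add, hq, hq']
        | tmul k'' q => simp [h.η_l, mul_assoc]
  η_r p b q := by
    induction p with
    | zero => simp
    | add p p' hp hp' => simp only [map_add, LinearMap.add_apply, hp, hp']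
    | tmul k p =>
      induction b with
      | zero => simp
      | add b b' hb hb' => simp only [map_add, LinearMap.add_apply, hb, hb']
      | tmul k' b =>
        induction q with
        | zero => simp
        | add q q' hq hq' => simp only [map_add, LinearMap.add_apply, hq, hq']
        | tmul k'' q => simp [h.η_r, mul_assoc, mul_comm k']
  l_η p q x := by
    induction p with
    | zero => simp
    | add p p' hp hp' => simp only [map_add, LinearMap.add_apply, hp, hp']
    | tmul k p =>
      induction q with
      | zero => simp
      | add q q' hq hq' => simp only [map_add, LinearMap.add_apply, hq, hq']
      | tmul k' q =>
        induction x with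
        | zero => simp
        | add x x' hx hx' => simp only [map_add, hx, hx']
        | tmul k'' x => simp [h.l_η, mul_assoc]
  η_symm p q := by
    induction p with
    | zero => simp
    | add p p' hp hp' => simp only [map_add, LinearMap.add_apply, smul_add, hp, hp']
    | tmul k p =>
      induction q with
      | zero => simp
      | add q q' hq hq' => simp only [map_add, LinearMap.add_apply, smul_add, hq, hq']
      | tmul k' q =>
        rw [LinearMap.baseChange₂_tmul, LinearMap.baseChange₂_tmul, LinearMap.baseChange_tmul,
          h.η_symm p q, mul_comm k', algebraMap_smul, TensorProduct.tmul_smul]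
  θ_symm p q := by
    induction p with
    | zero => simp
    | add p p' hp hp' => simp only [map_add, LinearMap.add_apply, smul_add, hp, hp']
    | tmul k p =>
      induction q with
      | zero => simp
      | add q q' hq hq' => simp only [map_add, LinearMap.add_apply, smul_add, hq, hq']
      | tmul k' q =>
        rw [LinearMap.baseChange₂_tmul, LinearMap.baseChange₂_tmul, LinearMap.baseChange_tmul,
          h.θ_symm p q, mul_comm k', algebraMap_smul, TensorProduct.tmul_smul]
  θ_l a p q := by
    induction a with
    | zero => simp
    | add a a' ha ha' => simp only [map_add, LinearMap.add_apply, ha, ha']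
    | tmul k a =>
      induction p with
      | zero => simp
      | add p p' hp hp' => simp only [map_add, LinearMap.add_apply, hp, hp']
      | tmul k' p =>
        induction q with
        | zero => simp
        | add q q' hq hq' => simp only [map_add, hq, hq']
        | tmul k'' q => simp [h.θ_l, mul_assoc, mul_left_comm k]
  θ_r p q b := by
    induction p with
    | zero => simp
    | add p p' hp hp' => simp only [add_mul, map_add, LinearMap.add_apply, hp, hp']
    | tmul k p =>
      induction q with
      | zero => simp
      | add q q' hq hq' => simp only [add_mul, map_add, LinearMap.add_apply, hq, hq']
      | tmul k' q =>
        induction b with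
        | zero => simp
        | add b b' hb hb' => simp only [mul_add, map_add, hb, hb']
        | tmul k'' b => simp [h.θ_r, mul_assoc]
  θ_r_left p b q := by
    induction p with
    | zero => simp
    | add p p' hp hp' => simp only [mul_add, map_add, LinearMap.add_apply, hp, hp']
    | tmul k p =>
      induction b with
      | zero => simp
      | add b b' hb hb' => simp only [add_mul, map_add, LinearMap.add_apply, hb, hb']
      | tmul k' b =>
        induction q with
        | zero => simp
        | add q q' hq hq' => simp only [mul_add, map_add, hq, hq']
        | tmul k'' q => simp [h.θ_r_left, mul_assoc, mul_left_comm k]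
  exists_sum := by
    obtain ⟨n, p, q, hpq⟩ := h.exists_sum
    refine ⟨n, fun i => 1 ⊗ₜ p i, fun i => 1 ⊗ₜ q i, ?_⟩
    simp only [LinearMap.baseChange₂_tmul, mul_one, ← TensorProduct.tmul_sum, hpq]
    rfl

/-- In a Morita context with `δ`-hermitian forms, the signs of the involutions differ by `δ`. -/
theorem sign_eq {K A B P : Type*} [Field K] [Ring A] [Ring B] [Algebra K A]
    [Algebra K B] [AddCommGroup P] [Module K P] {s : A →ₗ[K] A} {t : B →ₗ[K] B}
    {l : A →ₗ[K] P →ₗ[K] P} {r : P →ₗ[K] B →ₗ[K] P} {θ : P →ₗ[K] P →ₗ[K] B}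
    {η : P →ₗ[K] P →ₗ[K] A} {δ : K} (h : IsInvolutiveMorita s t l r θ η δ) (hδ : δ ≠ 0)
    {α β : K} {E x : A} {F y : B} (hs : HasInvolutionSign s α E x)
    (ht : HasInvolutionSign t β F y) : β = δ * α := by
  obtain ⟨n, p, q, hpq⟩ := h.exists_sum
  obtain ⟨m, c, d, hcd⟩ := ht.full
  -- Expanding `1` by values of `η`, and then `1` in `B` through the full idempotent `F`, writes `E`
  -- as the sum of these terms; one of them is nonzero.
  have hterm : ∃ i k, E * η (r (r (p i) (c k)) F) (r (q i) (t (d k))) * E ≠ 0 := by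
    by_contra! h0
    refine hs.ne_zero ?_
    calc E = E * (∑ i, η (p i) (q i)) * E := by rw [hpq, mul_one, hs.mul_self]
      _ = ∑ i, ∑ k, E * η (r (r (p i) (c k)) F) (r (q i) (t (d k))) * E := by
        rw [Finset.mul_sum, Finset.sum_mul]
        refine Finset.sum_congr rfl fun i _ => ?_
        have h1 : η (p i) (q i) = ∑ k, η (r (r (p i) (c k)) F) (r (q i) (t (d k))) := by
          conv_lhs => rw [← h.r_one (p i), ← hcd, map_sum, map_sum, LinearMap.sum_apply]
          exact Finset.sum_congr rfl fun k _ => by rw [h.r_mul, h.r_mul, h.η_r]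
        rw [h1, Finset.mul_sum, Finset.sum_mul]
      _ = 0 := Finset.sum_eq_zero fun i _ => Finset.sum_eq_zero fun k _ => h0 i k
  obtain ⟨i, k, hik⟩ := hterm
  let y₁ := r (p i) (c k)
  let y₀ := r y₁ F
  obtain ⟨κ, hκ⟩ := hs.corner (η y₀ (r (q i) (t (d k))))
  have hκ0 : κ ≠ 0 := by
    rintro rfl
    exact hik (by rw [hκ, zero_smul])
  let z := κ⁻¹ • r (q i) (t (d k))
  have hz : E * η y₀ z * E = E := by
    rw [map_smul, mul_smul_comm, smul_mul_assoc, hκ, smul_smul, inv_mul_cancel₀ hκ0, one_smul]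
  have hx : s x = α • x := by
    have h1 := hs.map x
    rwa [hs.left, hs.right] at h1
  -- This element lies in `t(F) B F`, so `t` multiplies it by `β`. On the other hand, the symmetry
  -- of `θ` contributes `δ`, and moving `x` across `θ` replaces it by `s x = α x`.
  let w := θ y₀ (l x y₀)
  have hwF : w = t F * θ y₁ (l x y₁) * F := by
    simp only [w, y₀]
    rw [h.l_r, h.θ_r, h.θ_r_left]
  have hw1 : t w = β • w := by rw [hwF]; exact ht.map _
  have hw2 : t w = (δ * α) • w := by
    simp only [w]
    rw [h.θ_symm, h.θ_l, hx, map_smul, LinearMap.smul_apply, map_smul, smul_smul]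
  -- If `w = 0`, then `η(z, y₀)` kills `x y₀`, so `s(η(y₀, z)) x η(y₀, z) = 0`. Cutting down by `E`,
  -- where `η(y₀, z)` becomes `E`, forces `x = 0`.
  have hw0 : w ≠ 0 := by
    intro hw
    have h1 : l (η z y₀) (l x y₀) = 0 := by
      rw [h.l_η]
      change r z w = 0
      rw [hw, map_zero]
    rw [h.η_symm y₀ z, map_smul, LinearMap.smul_apply] at h1
    have h2 := (smul_eq_zero.1 h1).resolve_left hδ
    have h3 : s (η y₀ z) * x * η y₀ z = 0 := by
      rw [← h.η_l, h.l_mul, h2, map_zero, LinearMap.zero_apply]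
    refine hs.x_ne_zero ?_
    calc x = s (E * η y₀ z * E) * x * (E * η y₀ z * E) := by rw [hz, hs.left, hs.right]
      _ = s E * (s (η y₀ z) * (s E * x * E) * η y₀ z) * E := by
        rw [h.s_mul, h.s_mul]
        simp only [mul_assoc]
      _ = 0 := by rw [hs.left, hs.right, h3, mul_zero, zero_mul]
  have h5 : (β - δ * α) • w = 0 := by rw [sub_smul, ← hw1, ← hw2, sub_self]
  exact sub_eq_zero.1 ((smul_eq_zero.1 h5).resolve_right hw0)

end IsInvolutiveMorita

/-! ### The type of an involution -/

namespace IsAzumayaWithInvolution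

variable {R A : Type*} [CommRing R] [Ring A] [Algebra R A] {σ : RingInvo A}

/-- The ranks of the symmetric and the skew-symmetric elements. -/
theorem exists_finrank (hσ : IsAzumayaWithInvolution R σ) (h2 : IsUnit (2 : R))
    (hRsl : IsSemilocalRing R) (hR : IsConnectedRing R) :
    ∃ m n : ℕ, ∀ (F : Type*) [Field F] [Algebra R F], Module.finrank F (F ⊗[R] A) = m + n ∧
      Module.finrank F (LinearMap.eqLocus (hσ.linearMap.baseChange F) LinearMap.id) = m := by
  have : Finite (MaximalSpectrum R) := hRsl
  have := hσ.projective
  obtain ⟨N, x, y, hxy⟩ := hσ.separable.exists_family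
  have : Module.Finite R A := hxy.finite
  -- Symmetric and skew elements are complementary summands, hence both free. An eigenbasis of `A`
  -- over `R` stays an eigenbasis over every field, so the dimensions do not depend on the field.
  have hc := isCompl_eqLocus_neg h2 hσ.linearMap (fun a => σ.involution a)
  let U := LinearMap.eqLocus hσ.linearMap LinearMap.id
  let W := LinearMap.eqLocus hσ.linearMap (-LinearMap.id)
  let e := Submodule.prodEquivOfIsCompl U W hc
  have : Module.Finite R U := Module.Finite.of_surjective
    (LinearMap.fst R U W ∘ₗ e.symm.toLinearMap) ((LinearMap.fst_surjective (R := R) (M := U) (M₂ := W)).comp e.symm.surjective)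
  have : Module.Finite R W := Module.Finite.of_surjective
    (LinearMap.snd R U W ∘ₗ e.symm.toLinearMap) ((LinearMap.snd_surjective (R := R) (M := U) (M₂ := W)).comp e.symm.surjective)
  have : Module.Projective R (U × W) := Module.Projective.of_equiv e.symm
  have : Module.Projective R U := Module.Projective.of_split (LinearMap.inl R U W)
    (LinearMap.fst R U W) (LinearMap.fst_comp_inl R U W)
  have : Module.Projective R W := Module.Projective.of_split (LinearMap.inr R U W)
    (LinearMap.snd R U W) (LinearMap.snd_comp_inr R U W)
  obtain ⟨m, ⟨b⟩⟩ := hR.exists_basis U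
  obtain ⟨n, ⟨b'⟩⟩ := hR.exists_basis W
  let c := (b.prod b').map e
  have hcl : ∀ i, hσ.linearMap (c (Sum.inl i)) = c (Sum.inl i) := fun i => by
    have h1 : c (Sum.inl i) = b i := by simp [c, e]
    rw [h1]; exact (b i).2
  have hcr : ∀ i, hσ.linearMap (c (Sum.inr i)) = -c (Sum.inr i) := fun i => by
    have h1 : c (Sum.inr i) = b' i := by simp [c, e]
    rw [h1]; exact (b' i).2
  refine ⟨m, n, fun F _ _ => ?_⟩
  let cF := c.baseChange F
  refine ⟨by rw [Module.finrank_eq_card_basis cF]; simp, ?_⟩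
  have h2F : (2 : F) ≠ 0 := by
    have h := h2.map (algebraMap R F)
    rw [map_ofNat] at h
    exact h.ne_zero
  let T := hσ.linearMap.baseChange F
  have hTl : ∀ i, T (cF (Sum.inl i)) = cF (Sum.inl i) := fun i => by simp [T, cF, hcl]
  have hTr : ∀ i, T (cF (Sum.inr i)) = -cF (Sum.inr i) := fun i => by
    simp [T, cF, hcr, TensorProduct.tmul_neg]
  have hexp : ∀ a, T a = ∑ i, cF.repr a (Sum.inl i) • cF (Sum.inl i) -
      ∑ i, cF.repr a (Sum.inr i) • cF (Sum.inr i) := fun a => by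
    conv_lhs => rw [← cF.sum_repr a, map_sum, Fintype.sum_sum_type]
    have hl : ∀ i, T (cF.repr a (Sum.inl i) • cF (Sum.inl i)) =
        cF.repr a (Sum.inl i) • cF (Sum.inl i) := fun i => (T.map_smul _ _).trans (by rw [hTl])
    have hr : ∀ i, T (cF.repr a (Sum.inr i) • cF (Sum.inr i)) =
        -(cF.repr a (Sum.inr i) • cF (Sum.inr i)) := fun i =>
      (T.map_smul _ _).trans (by rw [hTr]; exact smul_neg _ _)
    rw [Finset.sum_congr rfl fun i _ => hl i, Finset.sum_congr rfl fun i _ => hr i,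
      Finset.sum_neg_distrib, sub_eq_add_neg]
  have hfix : ∀ a, T a = a → ∑ i, cF.repr a (Sum.inl i) • cF (Sum.inl i) = a := fun a ha => by
    have h1 := cF.sum_repr a
    rw [Fintype.sum_sum_type] at h1
    have key : ∀ p q a : F ⊗[R] A, p + q = a → a = p - q → (2 : F) • (p - a) = 0 := by
      intro p q a hp hq
      have h3 : p - a + (p - a) = (p - q - a) + (p + q - a) := by abel
      rw [two_smul, h3, hp, ← hq, sub_self, add_zero]
    have h3 := key _ _ _ h1 (ha.symm.trans (hexp a))
    exact sub_eq_zero.1 ((smul_eq_zero.1 h3).resolve_left h2F)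
  let f : LinearMap.eqLocus T LinearMap.id ≃ₗ[F] (Fin m → F) :=
    { toFun := fun a i => cF.repr a.1 (Sum.inl i)
      invFun := fun v => ⟨∑ i, v i • cF (Sum.inl i), by
        change T _ = _
        simp [hTl]⟩
      left_inv := fun a => Subtype.ext (hfix a.1 a.2)
      right_inv := fun v => by
        funext i
        simp [Finsupp.single_apply]
      map_add' := fun a a' => by funext i; simp
      map_smul' := fun k a => by funext i; simp }
  rw [f.finrank_eq, Module.finrank_fin_fun]

end IsAzumayaWithInvolution

section Types

variable {R A : Type u} [CommRing R] [Ring A] [Algebra R A] {σ : RingInvo A}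

/-- If the centre is `R`, then the sign of the involution over an algebraically closed field is
defined, and the type of the involution is given by this sign. -/
theorem IsAzumayaWithInvolution.exists_hasInvolutionSign (hσ : IsAzumayaWithInvolution R σ)
    (h2 : IsUnit (2 : R)) (hRsl : IsSemilocalRing R) (hR : IsConnectedRing R)
    (hc : ∀ z ∈ Subring.center A, ∃ r : R, algebraMap R A r = z) (K : Type u) [Field K]
    [IsAlgClosed K] [Algebra R K] :
    ∃ α : K, (α = 1 ∧ hσ.IsOrthogonal ∧ ¬ hσ.IsSymplectic ∨
      α = -1 ∧ ¬ hσ.IsOrthogonal ∧ hσ.IsSymplectic) ∧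
      ∃ E x, HasInvolutionSign (hσ.linearMap.baseChange K) α E x := by
  obtain ⟨m, n, hmn⟩ := hσ.exists_finrank h2 hRsl hR
  have := hσ.projective
  obtain ⟨N, x, y, hxy⟩ := hσ.separable.exists_family
  have : Module.Finite R A := hxy.finite
  have hinj : Function.Injective (algebraMap R A) := Set.injOn_univ.1 hσ.bijOn_center.injOn
  have h2K : (2 : K) ≠ 0 := by
    have h := h2.map (algebraMap R K)
    rw [map_ofNat] at h
    exact h.ne_zero
  have : Nontrivial (K ⊗[R] A) := by
    -- Averaging makes `R` a direct summand of `A`, so `K` embeds in `K ⊗ A`.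
    obtain ⟨π, hπ⟩ := hxy.exists_retraction hc hinj
    refine ⟨1, 0, fun h => one_ne_zero (α := K) ?_⟩
    have h1 := congrArg ((TensorProduct.rid R K).toLinearMap ∘ₗ π.lTensor K) h
    rw [Algebra.TensorProduct.one_def, map_zero] at h1
    simp [show π 1 = 1 by simpa using hπ 1] at h1
  have := (hxy.baseChange K).isSimpleRing (hxy.center_baseChange hc K)
  have hmul : ∀ a b : K ⊗[R] A, hσ.linearMap.baseChange K (a * b) =
      hσ.linearMap.baseChange K b * hσ.linearMap.baseChange K a := fun a b => by
    induction a with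
    | zero => simp
    | add a a' ha ha' => simp only [add_mul, mul_add, map_add, ha, ha']
    | tmul k a =>
      induction b with
      | zero => simp
      | add b b' hb hb' => simp only [add_mul, mul_add, map_add, hb, hb']
      | tmul k' b => simp [linearMap, mul_comm]
  have hinv : ∀ a : K ⊗[R] A, hσ.linearMap.baseChange K (hσ.linearMap.baseChange K a) = a :=
    fun a => by
    induction a with
    | zero => simp
    | add a a' ha ha' => simp only [map_add, ha, ha']
    | tmul k a => simp [linearMap]
  obtain ⟨d, α, hd, hdim, hα, hEx⟩ :=
    _root_.exists_hasInvolutionSign h2K (hσ.linearMap.baseChange K) hmul hinv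
  refine ⟨α, ?_, hEx⟩
  rw [(hmn K).1] at hdim
  rw [(hmn K).2] at hα
  -- When the centre of `A` is `R`, the centre of each fibre consists of scalars, which the
  -- involution fixes.
  have first : ∀ p, hσ.FirstKindAt p := fun p z hz => by
    obtain ⟨c, rfl⟩ := hxy.center_baseChange hc p.asIdeal.ResidueField z hz
    change hσ.linearMap.baseChange _ (c ⊗ₜ 1) = c ⊗ₜ 1
    simp [linearMap]
  have := hR.1
  obtain ⟨p₀⟩ : Nonempty (PrimeSpectrum R) := inferInstance
  have hsym : ∀ p, Module.finrank p.asIdeal.ResidueField (hσ.symAt p) = m := fun p =>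
    (hmn p.asIdeal.ResidueField).2
  have orth : hσ.IsOrthogonal → 2 * m = d * (d + 1) := fun h => by
    obtain ⟨-, k, hk, hk'⟩ := h p₀
    rw [(hmn _).1, hdim] at hk
    rw [hsym, ← Nat.pow_left_injective two_ne_zero hk] at hk'
    exact hk'
  have symp : hσ.IsSymplectic → 2 * m = d * (d - 1) := fun h => by
    obtain ⟨-, k, hk, hk'⟩ := h p₀
    rw [(hmn _).1, hdim] at hk
    rw [hsym, ← Nat.pow_left_injective two_ne_zero hk] at hk'
    exact hk'
  -- Since the degree is positive, the two possible dimensions differ; hence the involution has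
  -- exactly one of the two types.
  have hlt : d * (d - 1) < d * (d + 1) := by
    refine Nat.mul_lt_mul_of_pos_left ?_ hd
    omega
  rcases hα with ⟨rfl, hα⟩ | ⟨rfl, hα⟩
  · refine Or.inl ⟨rfl, fun p => ⟨first p, d, by rw [(hmn _).1, hdim], by rw [hsym, hα]⟩, ?_⟩
    intro h
    have := symp h
    omega
  · refine Or.inr ⟨rfl, ?_, fun p => ⟨first p, d, by rw [(hmn _).1, hdim], by rw [hsym, hα]⟩⟩
    intro h
    have := orth h
    omega

end Types

/-! ### The sign of an admitting form, and the theorem -/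

section Main

variable {R S A B : Type u} [CommRing R] [CommRing S] [Ring A] [Ring B]
  [Algebra R S] [Algebra R A] [Algebra S A] [IsScalarTower R S A]
  [Algebra R B] [Algebra S B] [IsScalarTower R S B]
  {σ : RingInvo A} {τ : RingInvo B} {δ : S}

theorem IsAzumayaWithInvolution.apply_algebraMap (hσ : IsAzumayaWithInvolution R σ) (c : R) :
    (σ (algebraMap R A c)).unop = algebraMap R A c :=
  (hσ.bijOn_center.mapsTo (Set.mem_univ c)).2

namespace AdmittingForm

/-- The `R`-bilinear Morita context attached to an admitting form. -/
theorem MoritaData.exists_isInvolutiveMorita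
    {Θ : AdmittingForm.{u, u, u} S σ τ (algebraMap S B δ)} (D : MoritaData Θ)
    (hσ : IsAzumayaWithInvolution R σ) (hτ : IsAzumayaWithInvolution R τ) {d : R}
    (hd : d * d = 1) (hdδ : algebraMap R S d = δ) :
    ∃ (_ : Module R Θ.carrier) (l : A →ₗ[R] Θ.carrier →ₗ[R] Θ.carrier)
      (r : Θ.carrier →ₗ[R] B →ₗ[R] Θ.carrier) (θ : Θ.carrier →ₗ[R] Θ.carrier →ₗ[R] B)
      (η : Θ.carrier →ₗ[R] Θ.carrier →ₗ[R] A),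
      IsInvolutiveMorita hσ.linearMap hτ.linearMap l r θ η d := by
  -- The action of `R` through `A` agrees with that through `B`, because `S` acts alike on both
  -- sides of `P`.
  let _ : Module R Θ.carrier := Module.compHom Θ.carrier (algebraMap R A)
  have hsmul : ∀ (c : R) (p : Θ.carrier), c • p = algebraMap R A c • p := fun _ _ => rfl
  have hsmul' : ∀ (c : R) (p : Θ.carrier), c • p = op (algebraMap R B c) • p := fun c p => by
    rw [hsmul, IsScalarTower.algebraMap_apply R S A, IsScalarTower.algebraMap_apply R S B,
      Θ.central]
  have hδ : δ * δ = 1 := by rw [← hdδ, ← map_mul, hd, map_one]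
  have hA : ∀ a : A, algebraMap S A δ * a = d • a := fun a => by
    rw [← hdδ, ← IsScalarTower.algebraMap_apply, Algebra.smul_def]
  have hB : ∀ b : B, algebraMap S B δ * b = d • b := fun b => by
    rw [← hdδ, ← IsScalarTower.algebraMap_apply, Algebra.smul_def]
  refine ⟨inferInstance,
    LinearMap.mk₂ R (fun a p => a • p) (fun a b p => add_smul a b p)
      (fun c a p => by rw [hsmul, Algebra.smul_def, mul_smul]) (fun a p q => smul_add a p q)
      (fun c a p => by rw [hsmul, hsmul, ← mul_smul, ← mul_smul, Algebra.commutes]),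
    LinearMap.mk₂ R (fun p b => op b • p) (fun p q b => smul_add _ p q)
      (fun c p b => by rw [hsmul, hsmul]; exact (smul_comm _ _ _).symm)
      (fun p b c => by rw [MulOpposite.op_add, add_smul])
      (fun c p b => by
        rw [hsmul', ← mul_smul, ← MulOpposite.op_mul, Algebra.smul_def, Algebra.commutes]),
    LinearMap.mk₂ R (fun p q => Θ.form.toHom p q) (fun p q r => by simp)
      (fun c p q => by
        rw [hsmul', Θ.form.smul_left, hτ.apply_algebraMap, Algebra.smul_def])
      (fun p q r => by simp)
      (fun c p q => by
        rw [hsmul', form_smul_right, ← Algebra.commutes, Algebra.smul_def]),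
    LinearMap.mk₂ R (fun p q => D.η p q) (fun p q r => by simp)
      (fun c p q => by rw [hsmul, D.η_smul_left, Algebra.smul_def])
      (fun p q r => by simp)
      (fun c p q => by
        rw [hsmul, D.η_smul_right, hσ.apply_algebraMap, ← Algebra.commutes, Algebra.smul_def]),
    ?_⟩
  exact
    { s_mul := fun a b => by simp [IsAzumayaWithInvolution.linearMap]
      l_mul := fun a b p => mul_smul a b p
      r_one := fun p => one_smul Bᵐᵒᵖ p
      r_mul := fun p b c => by
        change op (b * c) • p = op c • op b • p
        rw [MulOpposite.op_mul, mul_smul]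
      l_r := fun a p b => smul_comm a (op b) p
      η_l := fun a p q => D.η_smul_left a p q
      η_r := fun p b q => D.η_op_smul_left b p q
      l_η := fun p q x => D.η_smul p q x
      η_symm := fun p q => by
        change D.η q p = d • (σ (D.η p q)).unop
        rw [D.η_symm hδ, hA, smul_smul, hd, one_smul]
      θ_symm := fun p q => (form_symm hδ p q).trans (hB _)
      θ_l := fun a p q => form_smul_left a p q
      θ_r := fun p q b => form_smul_right b p q
      θ_r_left := fun p b q => Θ.form.smul_left b p q
      exists_sum := ⟨D.m, D.p, D.p', D.sum_η⟩ }

/-- If the centre of `A` and `B` is `R`, then the sign `δ` of an admitting form that induces an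
equivalence is `1` exactly if the involutions are of the same type. -/
theorem IsHermitianMorita.sign (h2 : IsUnit (2 : R)) (hRsl : IsSemilocalRing R)
    (hR : IsConnectedRing R) (hσ : IsAzumayaWithInvolution R σ) (hτ : IsAzumayaWithInvolution R τ)
    (hcA : ∀ z ∈ Subring.center A, ∃ r : R, algebraMap R A r = z)
    (hcB : ∀ z ∈ Subring.center B, ∃ r : R, algebraMap R B r = z)
    (hδ : δ = 1 ∨ δ = -1) {Θ : AdmittingForm.{u, u, u} S σ τ (algebraMap S B δ)} {ε : S}
    (hΘ : Θ.IsHermitianMorita ε) (hns : Θ.Nonsingular) :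
    (((hσ.IsOrthogonal ∧ hτ.IsOrthogonal) ∨ (hσ.IsSymplectic ∧ hτ.IsSymplectic) → δ = 1) ∧
      (¬((hσ.IsOrthogonal ∧ hτ.IsOrthogonal) ∨ (hσ.IsSymplectic ∧ hτ.IsSymplectic)) →
        δ = -1)) := by
  obtain ⟨D⟩ := hΘ.nonempty_moritaData Θ hns
  have := hR.1
  obtain ⟨p⟩ : Nonempty (PrimeSpectrum R) := inferInstance
  -- Any prime will do: the type is the same at every prime and is read off from the sign over `K`.
  let K := AlgebraicClosure p.asIdeal.ResidueField
  have h2K : (2 : K) ≠ 0 := by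
    have h := h2.map (algebraMap R K)
    rw [map_ofNat] at h
    exact h.ne_zero
  obtain ⟨α, hα, E, x, hEx⟩ := hσ.exists_hasInvolutionSign h2 hRsl hR hcA K
  obtain ⟨β, hβ, F, y, hFy⟩ := hτ.exists_hasInvolutionSign h2 hRsl hR hcB K
  -- The sign `δ` is lifted to `d : R` so that the whole context is defined over `R` and can be
  -- extended to `K`.
  have key : ∀ d : R, d * d = 1 → algebraMap R S d = δ → β = algebraMap R K d * α := by
    intro d hd hdδ
    obtain ⟨_, l, r, θ, η, h⟩ := D.exists_isInvolutiveMorita hσ hτ hd hdδ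
    refine (h.baseChange K).sign_eq (fun h0 => ?_) hEx hFy
    have h1 := congrArg (algebraMap R K) hd
    rw [map_mul, h0, zero_mul, map_one] at h1
    exact zero_ne_one h1
  have hneg : (1 : K) ≠ -1 := fun h => h2K (by linear_combination h)
  rcases hδ with rfl | rfl
  · refine ⟨fun _ => rfl, fun hne => absurd ?_ hne⟩
    have hβα := key 1 (one_mul 1) (map_one _)
    rw [map_one, one_mul] at hβα
    subst hβα
    rcases hα with ⟨h1, ho, -⟩ | ⟨h1, -, hs⟩ <;> rcases hβ with ⟨h1', ho', -⟩ | ⟨h1', -, hs'⟩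
    · exact Or.inl ⟨ho, ho'⟩
    · exact absurd (h1.symm.trans h1') hneg
    · exact absurd (h1'.symm.trans h1) hneg
    · exact Or.inr ⟨hs, hs'⟩
  · refine ⟨fun heq => absurd heq ?_, fun _ => rfl⟩
    have hβα := key (-1) (by simp) (by simp)
    rw [map_neg, map_one, neg_one_mul] at hβα
    subst hβα
    rcases hα with ⟨rfl, ho, hs⟩ | ⟨rfl, ho, hs⟩ <;>
      rcases hβ with ⟨h1', ho', hs'⟩ | ⟨h1', ho', hs'⟩
    · exact absurd h1'.symm hneg
    · tauto
    · tauto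
    · exact absurd (by rwa [neg_neg] at h1') hneg

end AdmittingForm

end Main

theorem theoremA1 {R S A B : Type u} [CommRing R] [CommRing S] [Ring A] [Ring B]
    [Algebra R S] [Algebra R A] [Algebra S A] [IsScalarTower R S A]
    [Algebra R B] [Algebra S B] [IsScalarTower R S B]
    (h2 : IsUnit (2 : R)) (hRsl : IsSemilocalRing R) (hR : IsConnectedRing R)
    (σ : RingInvo A) (τ : RingInvo B)
    (hσ : IsAzumayaWithInvolution R σ) (hτ : IsAzumayaWithInvolution R τ)
    -- `S` is the common centre of `A` and `B`, and it is connected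
    (hSA : IsCentreOf S A) (hSB : IsCentreOf S B) (hS : IsConnectedRing S)
    -- `A` and `B` are Brauer equivalent
    (hAB : AzumayaBrauerEquivalent S A B)
    -- `ι` is the common restriction of `σ` and `τ` to `S`
    (ι : S ≃+* S)
    (hισ : ∀ s : S, (σ (algebraMap S A s)).unop = algebraMap S A (ι s))
    (hιτ : ∀ s : S, (τ (algebraMap S B s)).unop = algebraMap S B (ι s)) :
    -- existence of `δ` and `(P, ϑ)`
    (∃ δ : S, (δ = 1 ∨ δ = -1) ∧
      ∃ Θ : AdmittingForm.{u, u, u} S σ τ (algebraMap S B δ), Θ.Nonsingular ∧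
        ∀ ε : S, ι ε * ε = 1 → Θ.IsHermitianMorita ε) ∧
    -- the value of `δ` if `σ` and `τ` are the identity on `S`
    ((∀ s, ι s = s) →
      ∀ δ : S, (δ = 1 ∨ δ = -1) →
        ∀ Θ : AdmittingForm.{u, u, u} S σ τ (algebraMap S B δ), Θ.Nonsingular →
          ∀ ε : S, ι ε * ε = 1 → Θ.IsHermitianMorita ε →
            (((hσ.IsOrthogonal ∧ hτ.IsOrthogonal) ∨ (hσ.IsSymplectic ∧ hτ.IsSymplectic) → δ = 1) ∧
            (¬((hσ.IsOrthogonal ∧ hτ.IsOrthogonal) ∨ (hσ.IsSymplectic ∧ hτ.IsSymplectic)) →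
              δ = -1))) ∧
    -- `δ` can be chosen freely otherwise
    ((¬ ∀ s, ι s = s) →
      ∀ δ : S, (δ = 1 ∨ δ = -1) →
        ∃ Θ : AdmittingForm.{u, u, u} S σ τ (algebraMap S B δ), Θ.Nonsingular ∧
          ∀ ε : S, ι ε * ε = 1 → Θ.IsHermitianMorita ε) := by
  obtain ⟨δ₀, hδ₀, hex⟩ := exists_admittingForm h2 hRsl hR hσ hτ hSA hSB hS hAB hισ hιτ
  refine ⟨⟨δ₀, hδ₀, hex δ₀ hδ₀ (Or.inl rfl)⟩, fun hid δ hδ Θ hns ε _ hΘ => ?_,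
    fun hne δ hδ => hex δ hδ (Or.inr hne)⟩
  have hq := hσ.isQuadraticInvolution hSA hισ
  -- With `ι` trivial, every element of `S` is fixed and so comes from `R`; the centres of `A` and
  -- `B` are therefore the image of `R`.
  refine hΘ.sign h2 hRsl hR hσ hτ (fun z hz => ?_) (fun z hz => ?_) hδ hns
  · obtain ⟨s, rfl⟩ := hSA.exists_of_mem_center z hz
    obtain ⟨r, rfl⟩ := hq.exists_of_fixed s (hid s)
    exact ⟨r, IsScalarTower.algebraMap_apply R S A r⟩
  · obtain ⟨s, rfl⟩ := hSB.exists_of_mem_center z hz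
    obtain ⟨r, rfl⟩ := hq.exists_of_fixed s (hid s)
    exact ⟨r, IsScalarTower.algebraMap_apply R S B r⟩
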